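/- Let $\mathbb T^2=\mathbb R^2/2\pi\mathbb Z^2$ with Lebesgue measure (total mass $4\pi^2$), let $x_1,x_2\in\mathbb T^2$, let $x_0=x_2-x_1$, and assume that $x_0/\pi$ is Diophantine: for a representative $\alpha\in\mathbb R^2$ of $x_0$ there are $\kappa\in\mathbb R$ and $C>0$ with $\max_{j=1,2}\left|\frac{\alpha_j}{\pi}-\frac{p_j}{q}\right|>\frac{C}{q^{\kappa}}$ for all $p_1,p_2,q\in\mathbb Z$ with $q>0$. Let $-\Delta_0$ be the restriction of $-\Delta$ to $C_c^\infty(\mathbb T^2\setminus\{x_1,x_2\})$, as an operator in $L^2(\mathbb T^2)$. For $z\notin\sigma(-\Delta)$ and $y\in\mathbb T^2$ let $$G_z(x,y)=(\Delta+z)^{-1}\delta_y(x)=-\frac1{4\pi^2}\sum_{\xi\in\mathbb Z^2}\frac{e^{i\langle\xi,x-y\rangle}}{|\xi|^2-z}\quad\text{in }L^2(\mathbb T^2),\qquad \mathbb G_z(x)=(G_z(x,x_1),G_z(x,x_2)).$$ Put $c_1=\|G_i(\cdot,x_1)\|_2^2$ and $c_2=\int_{\mathbb T^2} G_i(x,x_1)\overline{G_i(x,x_2)}\,dx\in\mathbb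 R$, and $$T=\begin{pmatrix}\frac1{\sqrt{c_1}}&0\\-\frac{c_2}{\sqrt{c_1(c_1^2-c_2^2)}}&\sqrt{\frac{c_1}{c_1^2-c_2^2}}\end{pmatrix}.$$ For $U\in U(2)$ let $-\Delta_U$ be the self-adjoint extension of $-\Delta_0$ given by restricting the adjoint $-\Delta_0^*$ to the domain of all $$g=f+\langle v,T\mathbb G_i\rangle+\langle v,UT\mathbb G_{-i}\rangle,\qquad v\in\mathbb C^2,\quad f\in H^2(\mathbb T^2),\quad f(x_1)=f(x_2)=0,$$ where $\langle v,w\rangle=\overline{v_1}w_1+\overline{v_2}w_2$. A perturbed eigenfunction of $-\Delta_U$ is an eigenfunction whose eigenvalue is not an eigenvalue of the standard Laplacian $-\Delta$ on $\mathbb T^2$. Let $U\in U(2)$ with $U\neq -I$, and let $\{\varphi_k\}_{k\in\mathbb N}$ be an orthonormal basis of the closed subspace of $L^2(\mathbb T^2)$ spanned by the perturbed eigenfunctions of $-\Delta_U$, such that each $\varphi_k$ is a perturbed eigenfunction, with eigenvalue $\lambda_k\in\mathbb R$. Then for every $\epsilon>0$ there is a subsequence $(k_j)$ such that $\{\lambda_{k_j}\}$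 has density one in $\{\lambda_k\}$, that is, $$\lim_{X\to\infty}\frac{\#\{j:\lambda_{k_j}\le X\}}{\#\{k:\lambda_k\le X\}}=1,$$ and such that for every $a\in C^\infty(\mathbb T^2)$ $$\int_{\mathbb T^2}a(x)\,|\varphi_{k_j}(x)|^2\,dx=\frac1{4\pi^2}\int_{\mathbb T^2}a(x)\,dx+O_{a,\epsilon}\bigl(\lambda_{k_j}^{-1/8+\epsilon}\bigr)\qquad\text{as }j\to\infty .$$ -/

import Mathlib

open MeasureTheory Filter Topology Asymptotics
open scoped ContDiff ComplexConjugate Laplacian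

noncomputable section

namespace TwoScatterers

/-- The length `2π` of the circle `ℝ / 2πℤ` is positive. -/
instance factTwoPiPos : Fact (0 < 2 * Real.pi) := ⟨Real.two_pi_pos⟩

/-- The flat torus `𝕋² = ℝ² / 2πℤ²`; its `volume` is Lebesgue measure, of total mass `4π²`. -/
abbrev Torus : Type := Fin 2 → AddCircle (2 * Real.pi)

/-- The complex Hilbert space `L²(𝕋²)`. -/
abbrev L2 : Type := Lp ℂ 2 (volume : Measure Torus)

/-- The quotient map `ℝ² → 𝕋²`. -/
def proj (y : EuclideanSpace ℝ (Fin 2)) : Torus :=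
  fun i => ((y i : ℝ) : AddCircle (2 * Real.pi))

/-- The representative in `[0, 2π)²` of a point of the torus. -/
def rep (x : Torus) : EuclideanSpace ℝ (Fin 2) :=
  WithLp.toLp 2 fun i => ((AddCircle.equivIco (2 * Real.pi) 0 (x i) : ℝ))

/-- `f ∈ C^∞(𝕋²)`: the `2πℤ²`-periodic lift of `f` to `ℝ²` is smooth. -/
def IsSmooth (f : Torus → ℂ) : Prop :=
  ContDiff ℝ ∞ fun y : EuclideanSpace ℝ (Fin 2) => f (proj y)

/-- The Laplacian `Δ f` of a function on the torus, computed on the periodic lift of `f`. -/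
def lap (f : Torus → ℂ) (x : Torus) : ℂ :=
  (Δ fun y : EuclideanSpace ℝ (Fin 2) => f (proj y)) (rep x)

lemma proj_rep (x : Torus) : proj (rep x) = x := by
  funext i
  exact (AddCircle.equivIco (2 * Real.pi) 0).symm_apply_apply (x i)

lemma proj_add (y z : EuclideanSpace ℝ (Fin 2)) : proj (y + z) = proj y + proj z := by
  funext i
  simp [proj]

/-- The value of `lap f` can be computed at any representative of the point. -/
lemma lap_proj (f : Torus → ℂ) (y : EuclideanSpace ℝ (Fin 2)) :
    lap f (proj y) = (Δ fun z : EuclideanSpace ℝ (Fin 2) => f (proj z)) y := by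
  have h0 : proj (rep (proj y) - y) = 0 := by
    have h := proj_add (rep (proj y) - y) y
    rw [sub_add_cancel, proj_rep] at h
    simpa using h.symm
  have hper : (fun z : EuclideanSpace ℝ (Fin 2) => f (proj z)) =
      fun z => f (proj (z + (rep (proj y) - y))) := by
    funext z
    rw [proj_add, h0, add_zero]
  unfold lap
  simp only [InnerProductSpace.laplacian_eq_iteratedFDeriv_stdOrthonormalBasis]
  conv_rhs => rw [hper]
  simp only [iteratedFDeriv_comp_add_right
    (f := fun z : EuclideanSpace ℝ (Fin 2) => f (proj z)), add_sub_cancel]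

lemma two_le_infty : (2 : WithTop ℕ∞) ≤ ∞ := by
  exact WithTop.coe_le_coe.2 (le_top (a := (2 : ℕ∞)))

lemma lap_add {f g : Torus → ℂ} (hf : IsSmooth f) (hg : IsSmooth g) (x : Torus) :
    lap (f + g) x = lap f x + lap g x :=
  (hf.of_le two_le_infty).contDiffAt.laplacian_add
    (hg.of_le two_le_infty).contDiffAt

lemma lap_smul {f : Torus → ℂ} (c : ℂ) (hf : IsSmooth f) (x : Torus) :
    lap (c • f) x = c * lap f x :=
  InnerProductSpace.laplacian_smul c (hf.of_le two_le_infty).contDiffAt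

/-- The character `x ↦ e^{i⟨ξ, x⟩}` of the torus, for `ξ ∈ ℤ²`. -/
def character (ξ : Fin 2 → ℤ) : C(Torus, ℂ) where
  toFun x := fourier (ξ 0) (x 0) * fourier (ξ 1) (x 1)
  continuous_toFun := by fun_prop

/-- `|ξ|²` for `ξ ∈ ℤ²`. -/
def normSq (ξ : Fin 2 → ℤ) : ℤ := ξ 0 ^ 2 + ξ 1 ^ 2

/-- The Fourier coefficient `(1/4π²) ∫ f(x) e^{-i⟨ξ, x⟩} dx`. -/
def fourierCoef (f : C(Torus, ℂ)) (ξ : Fin 2 → ℤ) : ℂ :=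
  (1 / (4 * Real.pi ^ 2) : ℝ) * ∫ x : Torus, f x * conj (character ξ x)

/-- The Sobolev space `H²(𝕋²)`, each class being represented by its continuous member (in dimension
two every `H²` function has one): `∑ (1 + |ξ|²)² |f̂(ξ)|² < ∞`. -/
def MemH2 (f : C(Torus, ℂ)) : Prop :=
  Summable fun ξ : Fin 2 → ℤ => (1 + (normSq ξ : ℝ)) ^ 2 * ‖fourierCoef f ξ‖ ^ 2

/-- The class in `L²(𝕋²)` of a continuous function. -/
def toL2 (f : C(Torus, ℂ)) : L2 := ContinuousMap.toLp 2 volume ℂ f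

/-- `λ` is an eigenvalue of the standard Laplacian `-Δ` on `𝕋²`. -/
def IsLaplaceEigenvalue (lam : ℝ) : Prop :=
  ∃ f : Torus → ℂ, IsSmooth f ∧ f ≠ 0 ∧ ∀ x, -lap f x = lam * f x

/-- The graph in `L² × L²` of `-Δ₀`, the restriction of `-Δ` to the smooth functions on the torus
that are supported away from the points `x 0` and `x 1`. -/
def graphZero (x : Fin 2 → Torus) : Submodule ℂ (L2 × L2) where
  carrier := {p | ∃ ψ : Torus → ℂ, IsSmooth ψ ∧ (∀ j, x j ∉ tsupport ψ) ∧
    p.1 =ᵐ[volume] ψ ∧ p.2 =ᵐ[volume] fun y => -lap ψ y}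
  zero_mem' := by
    refine ⟨0, contDiff_const, fun j => by simp, Lp.coeFn_zero _ _ _, ?_⟩
    have h : ∀ y, lap 0 y = 0 := fun y => by
      have := lap_smul (0 : ℂ) (f := 0) contDiff_const y
      simpa using this
    simp only [h, neg_zero]
    exact Lp.coeFn_zero _ _ _
  add_mem' := by
    rintro p q ⟨ψ, hψ, hψs, h1, h2⟩ ⟨χ, hχ, hχs, h3, h4⟩
    refine ⟨ψ + χ, hψ.add hχ, fun j hj => ?_, ?_, ?_⟩
    · rcases tsupport_add ψ χ hj with h | h
      · exact hψs j h
      · exact hχs j h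
    · exact (Lp.coeFn_add _ _).trans (h1.add h3)
    · filter_upwards [Lp.coeFn_add p.2 q.2, h2, h4] with y h5 h6 h7
      rw [Prod.snd_add, h5, Pi.add_apply, h6, h7, lap_add hψ hχ]
      ring
  smul_mem' := by
    rintro c p ⟨ψ, hψ, hψs, h1, h2⟩
    refine ⟨c • ψ, hψ.const_smul c, fun j hj => hψs j ?_, ?_, ?_⟩
    · exact closure_mono (Function.support_const_smul_subset c ψ) hj
    · exact (Lp.coeFn_smul _ _).trans (h1.const_smul c)
    · filter_upwards [Lp.coeFn_smul c p.2, h2] with y h5 h6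
      rw [Prod.smul_snd, h5, Pi.smul_apply, h6, lap_smul c hψ, smul_eq_mul]
      ring

/-- The Green's function `G_z(·, y) = (Δ + z)⁻¹ δ_y ∈ L²(𝕋²)`, for `z` outside the spectrum of `-Δ`,
through its `L²`-convergent expansion
`-(1/4π²) ∑_ξ e^{i⟨ξ, x - y⟩} / (|ξ|² - z)`. -/
def green (z : ℂ) (y : Torus) : L2 :=
  ∑' ξ : Fin 2 → ℤ,
    (-(1 / (4 * Real.pi ^ 2) : ℝ) * (conj (character ξ y) / ((normSq ξ : ℂ) - z))) •
      toL2 (character ξ)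

/-- `c₁ = ‖G_i(·, x₁)‖²`, which is also `‖G_{±i}(·, x_j)‖²` for either sign and either point. -/
def c₁ (x : Fin 2 → Torus) : ℝ := ‖green Complex.I (x 0)‖ ^ 2

/-- `c₂ = ∫ G_i(·, x₁) \overline{G_i(·, x₂)}`, a real number (Mathlib's inner product is conjugate
linear in the first variable). -/
def c₂ (x : Fin 2 → Torus) : ℝ :=
  (inner ℂ (green Complex.I (x 1)) (green Complex.I (x 0))).re

/-- The matrix `T` such that the two entries of `T (G_i(·, x₁), G_i(·, x₂))`, and those of
`T (G_{-i}(·, x₁), G_{-i}(·, x₂))`, are orthonormal: Gram-Schmidt orthonormalisation. -/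
def T (x : Fin 2 → Torus) : Matrix (Fin 2) (Fin 2) ℂ :=
  !![((1 / √(c₁ x) : ℝ) : ℂ), 0;
    ((-(c₂ x / √(c₁ x * (c₁ x ^ 2 - c₂ x ^ 2))) : ℝ) : ℂ),
      ((√(c₁ x / (c₁ x ^ 2 - c₂ x ^ 2)) : ℝ) : ℂ)]

/-- `⟨v, M 𝔾_z⟩ = v* M (G_z(·, x₁), G_z(·, x₂)) ∈ L²(𝕋²)`, conjugate linear in `v`. -/
def pairing (x : Fin 2 → Torus) (M : Matrix (Fin 2) (Fin 2) ℂ) (z : ℂ) (v : Fin 2 → ℂ) : L2 :=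
  ∑ j, Matrix.vecMul (star v) M j • green z (x j)

/-- The domain of `-Δ_U`: the functions `g = f + ⟨v, T 𝔾_i⟩ + ⟨v, U T 𝔾_{-i}⟩` with `v ∈ ℂ²` and
`f ∈ H²(𝕋²)` vanishing at both scatterers. -/
def domainU (x : Fin 2 → Torus) (U : Matrix.unitaryGroup (Fin 2) ℂ) : Set L2 :=
  {g | ∃ (f : C(Torus, ℂ)) (v : Fin 2 → ℂ), MemH2 f ∧ (∀ j, f (x j) = 0) ∧
    g = toL2 f + pairing x (T x) Complex.I v
      + pairing x ((U : Matrix (Fin 2) (Fin 2) ℂ) * T x) (-Complex.I) v}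

/-- The graph of the self-adjoint extension `-Δ_U` of `-Δ₀`: the restriction of the adjoint operator
`-Δ₀*` to the domain of `-Δ_U`. -/
def graphU (x : Fin 2 → Torus) (U : Matrix.unitaryGroup (Fin 2) ℂ) : Set (L2 × L2) :=
  {p | p ∈ (graphZero x).adjoint ∧ p.1 ∈ domainU x U}

/-- `g` is an eigenfunction of `-Δ_U` with the eigenvalue `λ`. -/
def IsEigenfunction (x : Fin 2 → Torus) (U : Matrix.unitaryGroup (Fin 2) ℂ) (lam : ℝ)
    (g : L2) : Prop :=
  g ≠ 0 ∧ (g, (lam : ℂ) • g) ∈ graphU x U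

/-- `g` is a perturbed (new) eigenfunction of `-Δ_U` with the eigenvalue `λ`: the eigenvalue is not
one of the standard Laplacian. -/
def IsPerturbedEigenfunction (x : Fin 2 → Torus) (U : Matrix.unitaryGroup (Fin 2) ℂ) (lam : ℝ)
    (g : L2) : Prop :=
  IsEigenfunction x U lam g ∧ ¬ IsLaplaceEigenvalue lam

/-- The closed subspace of `L²(𝕋²)` spanned by the perturbed eigenfunctions of `-Δ_U`. -/
def perturbedSubspace (x : Fin 2 → Torus) (U : Matrix.unitaryGroup (Fin 2) ℂ) : Submodule ℂ L2 :=
  (Submodule.span ℂ {g | ∃ lam : ℝ, IsPerturbedEigenfunction x U lam g}).topologicalClosure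

/-- `(φ_k)` is an orthonormal basis, consisting of perturbed eigenfunctions of `-Δ_U` with the
eigenvalues `(λ_k)`, of the subspace of the perturbed eigenfunctions. -/
structure IsPerturbedBasis (x : Fin 2 → Torus) (U : Matrix.unitaryGroup (Fin 2) ℂ)
    (φ : ℕ → L2) (lam : ℕ → ℝ) : Prop where
  orthonormal : Orthonormal ℂ φ
  eigenfunction : ∀ k, IsPerturbedEigenfunction x U (lam k) (φ k)
  span_eq : (Submodule.span ℂ (Set.range φ)).topologicalClosure = perturbedSubspace x U

/-- The sequence `(λ_{k_j})_j` has density one in `(λ_k)_k`: the quotient of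
`#{j : λ_{k_j} ≤ X}` by `#{k : λ_k ≤ X}` tends to `1` as `X → ∞`. -/
def DensityOne (lam : ℕ → ℝ) (k : ℕ → ℕ) : Prop :=
  Tendsto (fun X : ℝ => (Set.ncard {j | lam (k j) ≤ X} : ℝ) / (Set.ncard {n | lam n ≤ X} : ℝ))
    atTop (𝓝 1)

/-- The vector `α ∈ ℝ²` is Diophantine of type `κ`. -/
def DiophantineOfType (κ : ℝ) (α : Fin 2 → ℝ) : Prop :=
  ∃ C : ℝ, 0 < C ∧ ∀ (p : Fin 2 → ℤ) (q : ℤ), 0 < q →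
    C / (q : ℝ) ^ κ < max |α 0 - p 0 / q| |α 1 - p 1 / q|

/-- The vector `α ∈ ℝ²` is Diophantine (of some type). -/
def Diophantine (α : Fin 2 → ℝ) : Prop := ∃ κ : ℝ, DiophantineOfType κ α

end TwoScatterers

end

open MeasureTheory Filter Topology Asymptotics
open scoped ContDiff ComplexConjugate Laplacian

noncomputable section

namespace TwoScatterers

/-! For a unit eigenfunction `g` with eigenvalue `λ`, the distribution `(-Δ - λ) g` is a combination
of two deltas. Hence, up to a constant, `ĝ(ξ)` is `d₀ e^{-i⟨ξ,x₁⟩} + d₁ e^{-i⟨ξ,x₂⟩}` divided by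
`|ξ|² - λ` (`DeltaRel`). The Fourier coefficient of `|g|²` at `ζ ≠ 0` is the correlation of `ĝ` with
its translate by `ζ`. If no two lattice points differing by a short `ζ` both lie in a thin annulus
around the circle, this correlation is at most twice the square root of the mass outside the annulus
(`norm_inner_charMul_le`). Long `ζ` are handled by the decay of the Fourier coefficients of the
observable.

Let `n` be the last sum of two squares before `λ`. The strengths `d` are bounded without estimating
any Green's function from below: since `|ĝ| ≤ 1` on the circle `|ξ|² = n`, two frequencies on it
whose phases at `x₂ - x₁` differ by `δ` force `|d| ≲ |n - λ| / δ` (`DeltaRel.norm_coeff_le`). With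
`|n - λ| ≤ n^s`, `δ = n^{-s}` and the annulus `||ξ|² - n| ≤ L = n^{1/4 - 2s}`, the outside mass is
at most `n^{-1/4 + O(s)}`, because an integer has few representations as a sum of two squares
(`sum_inv_sq_le`). The square root gives the exponent `1/8`.

This fails only for `Exceptional` `n`: a long gap follows, the phases on the circle nearly agree, or
there is a close pair near the circle. Up to `X` there are `O(X^{1-η})` of these
(`card_exceptional_le`). Long gaps are few by spacing. The symmetries of the circle turn near
agreement of phases into near returns of multiples of `α / π` to the lattice, which the Diophantine
condition keeps apart. A close pair is encoded by a few integers with about `√X L²` choices up to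
`X^{2s}`, which is what fixes the exponent `1/4` in `L`.

It remains to compare eigenvalues with sums of two squares. Above: since `d` lives in `ℂ²`, a gap of
the Laplace spectrum carries at most two members of the basis (`not_three_eigenvalues`). Below: a
gap whose two end circles both separate the scatterers contains a perturbed eigenvalue
(`exists_perturbedEigenfunction`), because the quantisation condition involves a Hermitian matrix
running from `-∞` to `+∞` across the gap; `U ≠ -I` keeps that condition nontrivial. Sums of two
squares number at least `X^{1-η/2}` up to a constant (`card_isNorm_ge`), so the indices attached to
exceptional `n` have density zero. -/

/-- The lattice `ℤ²` of frequencies. -/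
abbrev Freq : Type := Fin 2 → ℤ

/-! ### Fourier series on the torus -/

lemma character_apply (ξ : Freq) (x : Torus) :
    character ξ x = fourier (ξ 0) (x 0) * fourier (ξ 1) (x 1) := rfl

lemma character_add (ξ η : Freq) (x : Torus) :
    character (ξ + η) x = character ξ x * character η x := by
  simp only [character_apply, Pi.add_apply, fourier_add]
  ring

lemma character_neg (ξ : Freq) (x : Torus) : character (-ξ) x = conj (character ξ x) := by
  simp only [character_apply, Pi.neg_apply, fourier_neg, map_mul]

lemma character_zero (x : Torus) : character 0 x = 1 := by
  simp [character_apply]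

lemma fourier_map_add (n : ℤ) (x y : AddCircle (2 * Real.pi)) :
    fourier n (x + y) = fourier n x * fourier n y := by
  simp only [fourier_apply, smul_add, AddCircle.toCircle_add, Circle.coe_mul]

lemma character_map_add (ξ : Freq) (x y : Torus) :
    character ξ (x + y) = character ξ x * character ξ y := by
  simp only [character_apply, Pi.add_apply, fourier_map_add]
  ring

lemma norm_character (ξ : Freq) (x : Torus) : ‖character ξ x‖ = 1 := by
  rw [character_apply, norm_mul, fourier_apply, fourier_apply, Circle.norm_coe, Circle.norm_coe,
    one_mul]

lemma character_map_neg (ξ : Freq) (x : Torus) :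
    character ξ (-x) = conj (character ξ x) := by
  have h := character_map_add ξ x (-x)
  have h0 : character ξ (x + -x) = 1 := by simp [character_apply]
  rw [h0] at h
  have hn : character ξ x * conj (character ξ x) = 1 := by
    rw [Complex.mul_conj, Complex.normSq_eq_norm_sq, norm_character]; simp
  have hx : character ξ x ≠ 0 := by
    intro h'; simpa [h'] using norm_character ξ x
  exact mul_left_cancel₀ hx (h.symm.trans hn.symm)

lemma character_conj_mul (ξ : Freq) (x : Torus) :
    conj (character ξ x) * character ξ x = 1 := by
  rw [mul_comm, Complex.mul_conj, Complex.normSq_eq_norm_sq, norm_character]; simp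

lemma character_map_sub (ξ : Freq) (x y : Torus) :
    character ξ (x - y) = character ξ x * conj (character ξ y) := by
  rw [sub_eq_add_neg, character_map_add, character_map_neg]

lemma norm_character_eq_one (ξ : Freq) : ‖character ξ‖ = 1 := by
  apply le_antisymm
  · exact (ContinuousMap.norm_le _ zero_le_one).mpr fun x => (norm_character ξ x).le
  · rw [← norm_character ξ 0]
    exact (character ξ).norm_coe_le_norm 0

/-- The star subalgebra of `C(𝕋², ℂ)` generated by the characters. -/
def characterSubalgebra : StarSubalgebra ℂ C(Torus, ℂ) where
  toSubalgebra := Algebra.adjoin ℂ (Set.range character)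
  star_mem' := by
    change Algebra.adjoin ℂ (Set.range character) ≤ star (Algebra.adjoin ℂ (Set.range character))
    refine Algebra.adjoin_le ?_
    rintro _ ⟨n, rfl⟩
    refine Algebra.subset_adjoin ⟨-n, ?_⟩
    ext1 x
    simp only [character_neg, starRingEnd_apply, ContinuousMap.star_apply]

lemma characterSubalgebra_toSubmodule :
    characterSubalgebra.toSubalgebra.toSubmodule = Submodule.span ℂ (Set.range character) := by
  apply Algebra.adjoin_eq_span_of_subset
  refine .trans (fun x ↦ Submonoid.closure_induction (fun _ ↦ id) ⟨0, ?_⟩ ?_)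
    Submodule.subset_span
  · ext z
    simp [character_zero]
  · rintro _ _ _ _ ⟨m, rfl⟩ ⟨n, rfl⟩
    refine ⟨m + n, ?_⟩
    ext z
    simp [character_add]

lemma characterSubalgebra_separatesPoints :
    characterSubalgebra.SeparatesPoints := by
  intro x y hxy
  rw [Ne, funext_iff, not_forall] at hxy
  obtain ⟨i, hi⟩ := hxy
  refine ⟨_, ⟨character (Pi.single i 1), Algebra.subset_adjoin ⟨Pi.single i 1, rfl⟩, rfl⟩, ?_⟩
  have key : ∀ z : Torus, character (Pi.single i 1) z = (AddCircle.toCircle (z i) : ℂ) := by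
    intro z
    fin_cases i <;> simp [character_apply, fourier_apply]
  change character (Pi.single i 1) x ≠ character (Pi.single i 1) y
  rw [key, key]
  exact fun h => hi (AddCircle.injective_toCircle Real.two_pi_pos.ne' (Circle.ext h))

/-- Stone–Weierstrass. The characters are closed under products and conjugation, so the star algebra
they generate is merely their linear span. -/
lemma span_character_closure_eq_top :
    (Submodule.span ℂ (Set.range character)).topologicalClosure = ⊤ := by
  rw [← characterSubalgebra_toSubmodule]
  exact congr_arg (Subalgebra.toSubmodule <| StarSubalgebra.toSubalgebra ·)
    (ContinuousMap.starSubalgebra_topologicalClosure_eq_top_of_separatesPoints _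
      characterSubalgebra_separatesPoints)

lemma volume_torus : (volume : Measure Torus).real Set.univ = 4 * Real.pi ^ 2 := by
  rw [Measure.real, ← Set.pi_univ Set.univ, volume_pi_pi]
  simp only [AddCircle.measure_univ, Fin.prod_univ_two]
  rw [ENNReal.toReal_mul, ENNReal.toReal_ofReal Real.two_pi_pos.le]
  ring

lemma integral_character (ξ : Freq) :
    ∫ x : Torus, character ξ x = if ξ = 0 then (4 * Real.pi ^ 2 : ℂ) else 0 := by
  split_ifs with h
  · subst h
    simp only [character_zero, integral_const, volume_torus]
    simp
  · obtain ⟨i, hi⟩ := Function.ne_iff.mp h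
    -- A translation by half a wavelength in a coordinate with `ξ i ≠ 0` changes the sign of the
    -- character, so the invariant integral equals its own negative.
    let z : Torus := Pi.single i (((2 * Real.pi) / 2 / (ξ i : ℝ) : ℝ) : AddCircle (2 * Real.pi))
    have hz : character ξ z = -1 := by
      have h1 := fourier_add_half_inv_index (T := 2 * Real.pi) (n := ξ i) (by simpa using hi)
        Real.two_pi_pos 0
      rw [zero_add, fourier_eval_zero] at h1
      have h2 : fourier (ξ i) (((2 * Real.pi) / 2 / (ξ i : ℝ) : ℝ) : AddCircle (2 * Real.pi))
          = -1 := by rw [← h1]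
      fin_cases i <;> simpa [character_apply, z] using h2
    have := integral_add_right_eq_self (μ := (volume : Measure Torus)) (fun x => character ξ x) z
    simp only [character_map_add, hz, mul_neg_one, integral_neg] at this
    exact self_eq_neg.mp this.symm

lemma inner_toL2_character (ξ η : Freq) :
    inner ℂ (toL2 (character ξ)) (toL2 (character η))
      = if ξ = η then (4 * Real.pi ^ 2 : ℂ) else 0 := by
  rw [toL2, toL2, ContinuousMap.inner_toLp]
  have : ∀ x, character η x * conj (character ξ x) = character (η - ξ) x := by
    intro x; rw [sub_eq_add_neg, character_add, character_neg]
  simp only [this, integral_character, sub_eq_zero, eq_comm (a := η)]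

/-- The normalised characters, an orthonormal family in `L²(𝕋²)`. -/
def unitCharacter (ξ : Freq) : L2 := ((1 / (2 * Real.pi) : ℝ) : ℂ) • toL2 (character ξ)

lemma orthonormal_unitCharacter : Orthonormal ℂ unitCharacter := by
  rw [orthonormal_iff_ite]
  intro ξ η
  rw [unitCharacter, unitCharacter, inner_smul_left, inner_smul_right, inner_toL2_character]
  split_ifs
  · rw [Complex.conj_ofReal]
    push_cast
    have : (Real.pi : ℂ) ≠ 0 := by exact_mod_cast Real.pi_ne_zero
    field_simp
    norm_num
  · simp

lemma span_unitCharacter_closure :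
    ⊤ ≤ (Submodule.span ℂ (Set.range unitCharacter)).topologicalClosure := by
  have h1 : (Submodule.span ℂ (Set.range fun ξ => toL2 (character ξ))).topologicalClosure = ⊤ := by
    simpa only [Submodule.map_span, ContinuousLinearMap.coe_coe, ← Set.range_comp,
      Function.comp_def] using!
      (ContinuousMap.toLp_denseRange ℂ volume ℂ (p := 2) (by simp)).topologicalClosure_map_submodule
        span_character_closure_eq_top
  rw [← h1]
  apply Submodule.topologicalClosure_mono
  rw [Submodule.span_le]
  rintro _ ⟨ξ, rfl⟩
  have : toL2 (character ξ) = ((2 * Real.pi : ℝ) : ℂ) • unitCharacter ξ := by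
    rw [unitCharacter, smul_smul, ← Complex.ofReal_mul, mul_one_div_cancel Real.two_pi_pos.ne',
      Complex.ofReal_one, one_smul]
  simp only [this]
  exact Submodule.smul_mem _ _ (Submodule.subset_span ⟨ξ, rfl⟩)

/-- The Fourier basis of `L²(𝕋²)`. -/
def fourierBasis : HilbertBasis Freq ℂ L2 :=
  HilbertBasis.mk orthonormal_unitCharacter span_unitCharacter_closure

lemma fourierBasis_apply (ξ : Freq) : fourierBasis ξ = unitCharacter ξ := by
  simp [fourierBasis]

/-- The (normalised) Fourier coefficients of an element of `L²(𝕋²)`. -/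
def hat (g : L2) (ξ : Freq) : ℂ := inner ℂ (unitCharacter ξ) g

lemma hat_eq_repr (g : L2) (ξ : Freq) : fourierBasis.repr g ξ = hat g ξ := by
  rw [HilbertBasis.repr_apply_apply, fourierBasis_apply, hat]

lemma hat_add (f g : L2) (ξ : Freq) : hat (f + g) ξ = hat f ξ + hat g ξ := inner_add_right _ _ _
lemma hat_smul (c : ℂ) (g : L2) (ξ : Freq) : hat (c • g) ξ = c * hat g ξ := inner_smul_right _ _ _
lemma hat_zero (ξ : Freq) : hat 0 ξ = 0 := inner_zero_right _
lemma hat_sum {ι : Type*} (s : Finset ι) (f : ι → L2) (ξ : Freq) :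
    hat (∑ i ∈ s, f i) ξ = ∑ i ∈ s, hat (f i) ξ := inner_sum _ _ _

lemma hat_ext {f g : L2} (h : ∀ ξ, hat f ξ = hat g ξ) : f = g := by
  apply fourierBasis.repr.injective
  ext ξ
  rw [hat_eq_repr, hat_eq_repr, h]

lemma hasSum_inner (f g : L2) :
    HasSum (fun ξ => conj (hat f ξ) * hat g ξ) (inner ℂ f g) := by
  have := fourierBasis.hasSum_inner_mul_inner f g
  simp only [fourierBasis_apply] at this
  simpa only [hat, inner_conj_symm] using this

lemma hasSum_norm_sq (f : L2) : HasSum (fun ξ => ‖hat f ξ‖ ^ 2) (‖f‖ ^ 2) := by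
  have h := RCLike.hasSum_re ℂ (hasSum_inner f f)
  rw [inner_self_eq_norm_sq] at h
  convert h using 2 with ξ
  rw [← Complex.normSq_eq_norm_sq, ← Complex.normSq_eq_conj_mul_self]
  simp

lemma exists_hat_eq {w : Freq → ℂ} (hw : Summable fun ξ => ‖w ξ‖ ^ 2) :
    ∃ g : L2, (∀ ξ, hat g ξ = w ξ) ∧ HasSum (fun ξ => w ξ • unitCharacter ξ) g := by
  have hm : Memℓp w 2 := memℓp_gen (by simpa using hw)
  refine ⟨fourierBasis.repr.symm ⟨w, hm⟩, fun ξ => ?_, ?_⟩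
  · rw [← hat_eq_repr, LinearIsometryEquiv.apply_symm_apply]
  · have := fourierBasis.hasSum_repr_symm ⟨w, hm⟩
    simpa only [fourierBasis_apply] using this

/-- The link between the two normalisations: `hat` pairs with unit vectors of `L²`, `fourierCoef`
gives the coefficients of the series. Their ratio `2π` accounts for the constants `1 / (2π)` in
`DeltaRel`. -/
lemma hat_toL2 (f : C(Torus, ℂ)) (ξ : Freq) :
    hat (toL2 f) ξ = (2 * Real.pi : ℝ) * fourierCoef f ξ := by
  rw [hat, unitCharacter, inner_smul_left, toL2, toL2, ContinuousMap.inner_toLp, fourierCoef,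
    Complex.conj_ofReal, ← mul_assoc, ← Complex.ofReal_mul]
  congr 2
  have := Real.pi_ne_zero
  field_simp
  norm_num

lemma hasSum_fourier {f : C(Torus, ℂ)} (h : Summable fun ξ => ‖fourierCoef f ξ‖) :
    HasSum (fun ξ => fourierCoef f ξ • character ξ) f := by
  have sum_L2 := fourierBasis.hasSum_repr (toL2 f)
  simp only [fourierBasis_apply, hat_eq_repr, hat_toL2] at sum_L2
  refine ContinuousMap.hasSum_of_hasSum_Lp (𝕜 := ℂ) (p := 2) (μ := volume) (.of_norm ?_) ?_
  · simpa only [norm_smul, norm_character_eq_one, mul_one] using h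
  · refine (sum_L2.congr_fun fun ξ => ?_ : HasSum _ (toL2 f))
    rw [unitCharacter, smul_smul, mul_right_comm, ← Complex.ofReal_mul,
      mul_one_div_cancel Real.two_pi_pos.ne', Complex.ofReal_one, one_mul, Function.comp_apply, map_smul, toL2]

lemma hasSum_fourier_apply {f : C(Torus, ℂ)} (h : Summable fun ξ => ‖fourierCoef f ξ‖)
    (x : Torus) : HasSum (fun ξ => fourierCoef f ξ * character ξ x) (f x) := by
  simpa only [map_smul] using! (ContinuousMap.evalCLM ℂ x).hasSum (hasSum_fourier h)

lemma toL2_injective : Function.Injective toL2 :=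
  ContinuousMap.toLp_injective volume

lemma eq_zero_of_fourierCoef_eq_zero {f : C(Torus, ℂ)} (h : ∀ ξ, fourierCoef f ξ = 0) : f = 0 := by
  apply toL2_injective
  apply hat_ext
  intro ξ
  rw [hat_toL2, h, hat_toL2]
  simp [fourierCoef]

/-! ### Smooth functions, Fourier multipliers and the Laplace spectrum -/

lemma isOpenQuotientMap_proj : IsOpenQuotientMap proj := by
  have h1 : IsOpenQuotientMap (fun (y : Fin 2 → ℝ) (i : Fin 2) =>
      ((y i : ℝ) : AddCircle (2 * Real.pi))) :=
    IsOpenQuotientMap.piMap fun _ => QuotientAddGroup.isOpenQuotientMap_mk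
  exact h1.comp (EuclideanSpace.equiv (Fin 2) ℝ).toHomeomorph.isOpenQuotientMap

lemma IsSmooth.continuous {f : Torus → ℂ} (hf : IsSmooth f) : Continuous f :=
  isOpenQuotientMap_proj.continuous_comp_iff.1 (ContDiff.continuous hf)

/-- A smooth function as a continuous function. -/
def IsSmooth.toC {f : Torus → ℂ} (hf : IsSmooth f) : C(Torus, ℂ) := ⟨f, hf.continuous⟩

lemma IsSmooth.differentiable {f : Torus → ℂ} (hf : IsSmooth f) :
    Differentiable ℝ fun y => f (proj y) :=
  ContDiff.differentiable hf (by simp)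

/-- The unit vectors of the plane. -/
abbrev unitVec (j : Fin 2) : EuclideanSpace ℝ (Fin 2) := EuclideanSpace.single j 1

/-- The partial derivative of a function on the torus, computed on its periodic lift. -/
def pderiv (j : Fin 2) (f : Torus → ℂ) (x : Torus) : ℂ :=
  fderiv ℝ (fun y => f (proj y)) (rep x) (unitVec j)

lemma proj_sub_rep (y : EuclideanSpace ℝ (Fin 2)) : proj (rep (proj y) - y) = 0 := by
  have h := proj_add (rep (proj y) - y) y
  rw [sub_add_cancel, proj_rep] at h
  simpa using h.symm

lemma pderiv_proj (j : Fin 2) (f : Torus → ℂ) (y : EuclideanSpace ℝ (Fin 2)) :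
    pderiv j f (proj y) = fderiv ℝ (fun y => f (proj y)) y (unitVec j) := by
  have hper : (fun z : EuclideanSpace ℝ (Fin 2) => f (proj z)) =
      fun z => f (proj (z + (rep (proj y) - y))) := by
    funext z
    rw [proj_add, proj_sub_rep, add_zero]
  unfold pderiv
  conv_rhs => rw [hper]
  rw [fderiv_comp_add_right (f := fun z => f (proj z)) (rep (proj y) - y), add_sub_cancel]

lemma IsSmooth.pderiv {f : Torus → ℂ} (hf : IsSmooth f) (j : Fin 2) : IsSmooth (pderiv j f) := by
  unfold IsSmooth
  simp only [pderiv_proj]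
  exact (ContDiff.fderiv_right (m := ∞) hf (by simp)).clm_apply contDiff_const

lemma lap_eq_pderiv {f : Torus → ℂ} (hf : IsSmooth f) (x : Torus) :
    lap f x = ∑ j, pderiv j (pderiv j f) x := by
  have hF : ContDiff ℝ ∞ fun y : EuclideanSpace ℝ (Fin 2) => f (proj y) := hf
  rw [← proj_rep x, lap_proj, InnerProductSpace.laplacian_eq_iteratedFDeriv_orthonormalBasis _
    (EuclideanSpace.basisFun (Fin 2) ℝ)]
  refine Finset.sum_congr rfl fun j _ => ?_
  rw [pderiv_proj, iteratedFDeriv_two_apply]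
  simp only [pderiv_proj]
  have hd : DifferentiableAt ℝ (fderiv ℝ fun y : EuclideanSpace ℝ (Fin 2) => f (proj y)) (rep x) :=
    (ContDiff.fderiv_right (m := ∞) hF (by simp)).differentiable (by simp) _
  rw [fderiv_clm_apply hd (by fun_prop)]
  simp

lemma IsSmooth.lap {f : Torus → ℂ} (hf : IsSmooth f) : IsSmooth (lap f) := by
  have : TwoScatterers.lap f = fun x => ∑ j, TwoScatterers.pderiv j (TwoScatterers.pderiv j f) x :=
    funext (lap_eq_pderiv hf)
  rw [this]
  exact ContDiff.sum fun j _ => (hf.pderiv j).pderiv j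

/-- The Fourier coefficient of a function on the torus. -/
def coef (f : Torus → ℂ) (ξ : Freq) : ℂ :=
  (1 / (4 * Real.pi ^ 2) : ℝ) * ∫ x : Torus, f x * conj (character ξ x)

lemma fourierCoef_eq_coef (f : C(Torus, ℂ)) (ξ : Freq) : fourierCoef f ξ = coef f ξ := rfl

lemma _root_.Continuous.integrable_torus {f : Torus → ℂ} (hf : Continuous f) : Integrable f :=
  hf.integrable_of_hasCompactSupport (HasCompactSupport.of_compactSpace f)

lemma coef_add {f g : Torus → ℂ} (hf : Continuous f) (hg : Continuous g) (ξ : Freq) :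
    coef (f + g) ξ = coef f ξ + coef g ξ := by
  simp only [coef, Pi.add_apply, add_mul]
  rw [integral_add, mul_add]
  · exact (hf.mul (by fun_prop)).integrable_torus
  · exact (hg.mul (by fun_prop)).integrable_torus

lemma coef_smul (c : ℂ) (f : Torus → ℂ) (ξ : Freq) : coef (c • f) ξ = c * coef f ξ := by
  simp only [coef, Pi.smul_apply, smul_eq_mul, mul_assoc, integral_const_mul]
  ring

lemma character_proj (ξ : Freq) (y : EuclideanSpace ℝ (Fin 2)) :
    character ξ (proj y) = Complex.exp (((ξ 0 * y 0 + ξ 1 * y 1 : ℝ) : ℂ) * Complex.I) := by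
  simp only [character_apply, proj]
  rw [fourier_coe_apply, fourier_coe_apply, ← Complex.exp_add]
  congr 1
  have : (Real.pi : ℂ) ≠ 0 := by exact_mod_cast Real.pi_ne_zero
  push_cast
  field_simp

lemma character_proj_unitVec (ξ : Freq) (j : Fin 2) (t : ℝ) :
    character ξ (proj (t • unitVec j)) = Complex.exp (t * (ξ j * Complex.I)) := by
  rw [character_proj]
  congr 1
  fin_cases j <;> simp <;> ring

/-- Translating `f` by `t` along the `j`-th axis multiplies its coefficient by `e^{i t ξ_j}`, by
invariance of the measure. Differentiating at `t = 0` under the integral replaces an integration by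
parts. -/
lemma coef_pderiv {f : Torus → ℂ} (hf : IsSmooth f) (j : Fin 2) (ξ : Freq) :
    coef (pderiv j f) ξ = ξ j * Complex.I * coef f ξ := by
  have hshift : ∀ t : ℝ, ∫ x : Torus, f (x + proj (t • unitVec j)) * conj (character ξ x)
      = Complex.exp (t * (ξ j * Complex.I)) * ∫ x, f x * conj (character ξ x) := by
    intro t
    rw [← character_proj_unitVec, ← integral_const_mul, ← integral_add_right_eq_self
      (fun x => character ξ (proj (t • unitVec j)) * (f x * conj (character ξ x)))
      (proj (t • unitVec j))]
    congr 1
    ext x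
    rw [character_map_add, map_mul]
    linear_combination (-(f (x + proj (t • unitVec j)) * conj (character ξ x))) *
      character_conj_mul ξ (proj (t • unitVec j))
  have hpc : Continuous (pderiv j f) := (hf.pderiv j).continuous
  obtain ⟨C, hC⟩ := (isCompact_range hpc).isBounded.exists_norm_le
  have hC' : ∀ x, ‖pderiv j f x‖ ≤ C := fun x => hC _ ⟨x, rfl⟩
  have hproj : ∀ t : ℝ, Continuous fun x : Torus => x + proj (t • unitVec j) := fun t => by fun_prop
  have hD := (hasDerivAt_integral_of_dominated_loc_of_deriv_le (μ := (volume : Measure Torus))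
    (F := fun (t : ℝ) (x : Torus) => f (x + proj (t • unitVec j)) * conj (character ξ x))
    (F' := fun (t : ℝ) (x : Torus) => pderiv j f (x + proj (t • unitVec j)) * conj (character ξ x))
    (x₀ := (0 : ℝ)) (s := Set.univ) (bound := fun _ => C) univ_mem
    (Eventually.of_forall fun t => ((hf.continuous.comp (hproj t)).mul
      (by fun_prop)).aestronglyMeasurable)
    (((hf.continuous.comp (hproj 0)).mul (by fun_prop)).integrable_torus)
    (((hpc.comp (hproj 0)).mul (by fun_prop)).aestronglyMeasurable)
    (Eventually.of_forall fun x t _ => by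
      rw [norm_mul, RCLike.norm_conj, norm_character, mul_one]; exact hC' _)
    (integrable_const _)
    (Eventually.of_forall fun x t _ => by
      refine HasDerivAt.mul_const ?_ _
      have hlin : HasDerivAt (fun t : ℝ => rep x + t • unitVec j) (unitVec j) t := by
        simpa using ((hasDerivAt_id t).smul_const (unitVec j)).const_add (rep x)
      have h1 := (hf.differentiable (rep x + t • unitVec j)).hasFDerivAt.comp_hasDerivAt t hlin
      rw [← pderiv_proj, proj_add, proj_rep] at h1
      refine h1.congr_of_eventuallyEq (Eventually.of_forall fun s => ?_)
      simp only [Function.comp_apply, proj_add, proj_rep])).2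
  simp only [hshift] at hD
  have hE : HasDerivAt (fun t : ℝ => Complex.exp (t * (ξ j * Complex.I)) *
      ∫ x, f x * conj (character ξ x)) (ξ j * Complex.I * ∫ x, f x * conj (character ξ x)) 0 := by
    have h2 : HasDerivAt (fun t : ℝ => (t : ℂ) * (ξ j * Complex.I)) (ξ j * Complex.I) 0 := by
      simpa using (Complex.ofRealCLM.hasDerivAt (x := 0)).mul_const (ξ j * Complex.I)
    have h3 := h2.cexp.mul_const (∫ x, f x * conj (character ξ x))
    simpa using h3
  have h := hD.unique hE
  have h0 : proj ((0 : ℝ) • unitVec j) = 0 := by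
    funext i; simp [proj]
  simp only [h0, add_zero] at h
  rw [coef, coef, h]
  ring

lemma coef_lap {f : Torus → ℂ} (hf : IsSmooth f) (ξ : Freq) :
    coef (lap f) ξ = -(normSq ξ : ℂ) * coef f ξ := by
  have h : lap f = pderiv 0 (pderiv 0 f) + pderiv 1 (pderiv 1 f) := by
    funext x
    rw [lap_eq_pderiv hf, Fin.sum_univ_two]; rfl
  rw [h, coef_add ((hf.pderiv 0).pderiv 0).continuous ((hf.pderiv 1).pderiv 1).continuous,
    coef_pderiv (hf.pderiv 0), coef_pderiv hf, coef_pderiv (hf.pderiv 1), coef_pderiv hf, normSq]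
  push_cast
  linear_combination (((ξ 0 : ℂ) ^ 2 + (ξ 1 : ℂ) ^ 2) * coef f ξ) * Complex.I_sq

lemma norm_coef_le {f : Torus → ℂ} {C : ℝ} (hC : ∀ x, ‖f x‖ ≤ C) (ξ : Freq) :
    ‖coef f ξ‖ ≤ C := by
  have h : ‖∫ x : Torus, f x * conj (character ξ x)‖ ≤ C * (4 * Real.pi ^ 2) := by
    rw [← volume_torus]
    refine norm_integral_le_of_norm_le_const (Eventually.of_forall fun x => ?_)
    rw [norm_mul, RCLike.norm_conj, norm_character, mul_one]
    exact hC x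
  have hpi : 0 < 4 * Real.pi ^ 2 := by positivity
  rw [coef, norm_mul, Complex.norm_real, Real.norm_of_nonneg (by positivity)]
  calc _ ≤ 1 / (4 * Real.pi ^ 2) * (C * (4 * Real.pi ^ 2)) := by gcongr
    _ = C := by field_simp

lemma normSq_nonneg (ξ : Freq) : 0 ≤ normSq ξ := by unfold normSq; positivity

lemma normSq_nonneg' (ξ : Freq) : (0 : ℝ) ≤ normSq ξ := by exact_mod_cast normSq_nonneg ξ

lemma summable_inv_one_add_normSq_sq :
    Summable fun ξ : Freq => 1 / (1 + (normSq ξ : ℝ)) ^ 2 := by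
  have h1 : Summable fun n : ℤ => 1 / (1 + (n : ℝ) ^ 2) := by
    have h := (Real.summable_one_div_int_pow (p := 2)).2 (by norm_num)
    have h' : Summable fun n : ℤ => (if n = 0 then (1 : ℝ) else 0) + 1 / (n : ℝ) ^ 2 :=
      (summable_of_hasFiniteSupport ((Set.finite_singleton (0 : ℤ)).subset fun n hn => by
        simpa using hn)).add h
    refine Summable.of_nonneg_of_le (fun n => by positivity) (fun n => ?_) h'
    by_cases hn : n = 0
    · simp [hn]
    · rw [if_neg hn, zero_add]
      have : (0 : ℝ) < (n : ℝ) ^ 2 := by positivity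
      gcongr
      linarith
  have h2 := (finTwoArrowEquiv ℤ).summable_iff.2
    (h1.mul_of_nonneg h1 (fun n => by positivity) (fun n => by positivity))
  refine Summable.of_nonneg_of_le (fun ξ => by positivity) (fun ξ => ?_) h2
  have h0 := normSq_nonneg' ξ
  change _ ≤ 1 / (1 + (ξ 0 : ℝ) ^ 2) * (1 / (1 + (ξ 1 : ℝ) ^ 2))
  rw [one_div_mul_one_div]
  gcongr
  simp only [normSq]
  push_cast
  nlinarith [sq_nonneg (ξ 0 : ℝ), sq_nonneg (ξ 1 : ℝ), sq_nonneg ((ξ 0 : ℝ) * ξ 1)]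

/-- The iterates of `1 - Δ`. -/
def besselIter (f : Torus → ℂ) : ℕ → Torus → ℂ
  | 0 => f
  | n + 1 => besselIter f n + (-1 : ℂ) • lap (besselIter f n)

lemma IsSmooth.besselIter {f : Torus → ℂ} (hf : IsSmooth f) :
    ∀ n, IsSmooth (besselIter f n)
  | 0 => hf
  | n + 1 => ContDiff.add (IsSmooth.besselIter hf n)
      (ContDiff.const_smul (-1 : ℂ) (IsSmooth.besselIter hf n).lap)

lemma coef_besselIter {f : Torus → ℂ} (hf : IsSmooth f) (ξ : Freq) (n : ℕ) :
    coef (besselIter f n) ξ = (1 + (normSq ξ : ℂ)) ^ n * coef f ξ := by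
  induction n with
  | zero => simp [besselIter]
  | succ n ih =>
    have hs := hf.besselIter n
    rw [besselIter, coef_add hs.continuous (hs.lap.continuous.const_smul _), coef_smul,
      coef_lap hs, ih]
    ring

/-- The weight is the multiplier of `(1 - Δ)^n`, and `(1 - Δ)^n f` is bounded, being continuous on a
compact space. -/
lemma IsSmooth.norm_coef_mul_pow_le {f : Torus → ℂ} (hf : IsSmooth f) (n : ℕ) :
    ∃ C : ℝ, ∀ ξ, (1 + (normSq ξ : ℝ)) ^ n * ‖coef f ξ‖ ≤ C := by
  obtain ⟨C, hC⟩ := (isCompact_range (hf.besselIter n).continuous).isBounded.exists_norm_le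
  refine ⟨C, fun ξ => ?_⟩
  have h := norm_coef_le (fun x => hC _ ⟨x, rfl⟩) ξ
  rw [coef_besselIter hf, norm_mul, norm_pow] at h
  have : ‖(1 + (normSq ξ : ℂ))‖ = 1 + (normSq ξ : ℝ) := by
    have h0 := normSq_nonneg' ξ
    rw [show (1 + (normSq ξ : ℂ)) = ((1 + (normSq ξ : ℝ) : ℝ) : ℂ) by push_cast; rfl,
      Complex.norm_real, Real.norm_of_nonneg (by positivity)]
  rwa [this] at h

lemma IsSmooth.summable_coef {f : Torus → ℂ} (hf : IsSmooth f) (n : ℕ) :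
    Summable fun ξ => (1 + (normSq ξ : ℝ)) ^ n * ‖coef f ξ‖ := by
  obtain ⟨C, hC⟩ := hf.norm_coef_mul_pow_le (n + 2)
  refine Summable.of_nonneg_of_le (fun ξ => ?_) (fun ξ => ?_)
    (summable_inv_one_add_normSq_sq.mul_left C)
  · have := normSq_nonneg' ξ
    positivity
  · have h0 := normSq_nonneg' ξ
    rw [mul_one_div, le_div_iff₀ (by positivity)]
    calc _ = (1 + (normSq ξ : ℝ)) ^ (n + 2) * ‖coef f ξ‖ := by ring
      _ ≤ C := hC ξ

lemma IsSmooth.hasSum_coef {f : Torus → ℂ} (hf : IsSmooth f) (x : Torus) :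
    HasSum (fun ξ => coef f ξ * character ξ x) (f x) :=
  hasSum_fourier_apply (f := hf.toC) (by simpa using! hf.summable_coef 0) x

lemma isSmooth_character (ξ : Freq) : IsSmooth (character ξ) := by
  unfold IsSmooth
  simp only [character_proj]
  have h : ContDiff ℝ ∞ fun y : EuclideanSpace ℝ (Fin 2) => ((ξ 0 * y 0 + ξ 1 * y 1 : ℝ) : ℂ) :=
    Complex.ofRealCLM.contDiff.comp
      (f := fun y : EuclideanSpace ℝ (Fin 2) => ξ 0 * y 0 + ξ 1 * y 1) (by fun_prop)
  exact (h.mul contDiff_const).cexp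

lemma coef_character (η ξ : Freq) : coef (character η) ξ = if ξ = η then 1 else 0 := by
  have : ∀ x, character η x * conj (character ξ x) = character (η - ξ) x := by
    intro x; rw [sub_eq_add_neg, character_add, character_neg]
  simp only [coef, this, integral_character, sub_eq_zero, eq_comm (a := η)]
  split_ifs
  · push_cast
    have : (Real.pi : ℂ) ≠ 0 := by exact_mod_cast Real.pi_ne_zero
    field_simp
  · simp

lemma eq_zero_of_coef_eq_zero {f : Torus → ℂ} (hf : Continuous f) (h : ∀ ξ, coef f ξ = 0) :
    f = 0 := by
  have := eq_zero_of_fourierCoef_eq_zero (f := ⟨f, hf⟩) h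
  exact congr_arg DFunLike.coe this

lemma isLaplaceEigenvalue_iff (lam : ℝ) :
    IsLaplaceEigenvalue lam ↔ ∃ ξ : Freq, (normSq ξ : ℝ) = lam := by
  constructor
  · rintro ⟨f, hf, hf0, hl⟩
    by_contra! hne
    apply hf0
    apply eq_zero_of_coef_eq_zero hf.continuous
    intro ξ
    have hl' : lap f = (-lam : ℂ) • f := by
      funext x
      rw [Pi.smul_apply, smul_eq_mul, neg_mul, ← hl, neg_neg]
    have h1 := coef_lap hf ξ
    rw [hl', coef_smul] at h1
    have h2 : ((normSq ξ : ℂ) - lam) * coef f ξ = 0 := by linear_combination h1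
    rcases mul_eq_zero.1 h2 with h3 | h3
    · exact absurd (by exact_mod_cast sub_eq_zero.1 h3) (hne ξ)
    · exact h3
  · rintro ⟨ξ, rfl⟩
    refine ⟨character ξ, isSmooth_character ξ, ?_, ?_⟩
    · intro h
      have := norm_character ξ 0
      rw [h] at this
      simp at this
    · have hc := isSmooth_character ξ
      have h0 : lap (character ξ) + (normSq ξ : ℂ) • (character ξ : Torus → ℂ) = 0 := by
        refine eq_zero_of_coef_eq_zero (hc.lap.continuous.add (hc.continuous.const_smul _))
          fun η => ?_
        rw [coef_add hc.lap.continuous (hc.continuous.const_smul _), coef_smul, coef_lap hc,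
          coef_character]
        split_ifs with h
        · rw [h]; ring
        · simp
      intro x
      have := congr_fun h0 x
      simp only [Pi.add_apply, Pi.smul_apply, smul_eq_mul, Pi.zero_apply] at this
      push_cast
      linear_combination -this

/-! ### Density of the functions supported away from the scatterers -/

instance nullSingletonClass_circle :
    NullSingletonClass (volume : Measure (AddCircle (2 * Real.pi))) where
  measure_singleton x := by
    have h := AddCircle.volume_closedBall (2 * Real.pi) (x := x) 0
    rw [Metric.closedBall_zero] at h
    rw [h]
    simp [Real.two_pi_pos.le]

instance nullSingletonClass_torus : NullSingletonClass (volume : Measure Torus) :=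
  Measure.pi_nullSingletonClass 0

lemma character_single (i : Fin 2) (z : Torus) :
    character (Pi.single i 1) z = (AddCircle.toCircle (z i) : ℂ) := by
  fin_cases i <;> simp [character_apply, fourier_apply]

lemma eq_of_character_eq {x y : Torus} (h : ∀ ξ, character ξ x = character ξ y) : x = y := by
  funext i
  have := h (Pi.single i 1)
  rw [character_single, character_single] at this
  exact AddCircle.injective_toCircle Real.two_pi_pos.ne' (Circle.ext this)

/-- A smooth nonnegative function on the torus vanishing exactly at the point `p`. -/
def bump (p y : Torus) : ℝ := ∑ i, (1 - (character (Pi.single i 1) (y - p)).re)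

lemma re_character_le_one (ξ : Freq) (y : Torus) : (character ξ y).re ≤ 1 :=
  (Complex.re_le_norm _).trans (norm_character ξ y).le

lemma bump_self (p : Torus) : bump p p = 0 := by
  simp [bump, character_apply]

lemma bump_pos {p y : Torus} (h : y ≠ p) : 0 < bump p y := by
  have hn : ∀ i ∈ Finset.univ, 0 ≤ 1 - (character (Pi.single i 1) (y - p)).re :=
    fun i _ => sub_nonneg.2 (re_character_le_one _ _)
  refine lt_of_le_of_ne (Finset.sum_nonneg hn) fun h0 => h ?_
  rw [eq_comm, bump, Finset.sum_eq_zero_iff_of_nonneg hn] at h0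
  rw [← sub_eq_zero]
  funext i
  have h1 : (character (Pi.single i 1) (y - p)).re = 1 := by linarith [h0 i (Finset.mem_univ i)]
  have h2 := norm_character (Pi.single i 1) (y - p)
  have h3 : character (Pi.single i 1) (y - p) = 1 := by
    apply Complex.ext h1
    have h4 := Complex.sq_norm (character (Pi.single i 1) (y - p))
    rw [h2, Complex.normSq_apply, h1] at h4
    have : (character (Pi.single i 1) (y - p)).im * (character (Pi.single i 1) (y - p)).im = 0 := by
      linarith
    simpa using this
  rw [character_single] at h3
  exact AddCircle.injective_toCircle Real.two_pi_pos.ne'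
    (Circle.ext (by simpa using! h3))

lemma continuous_bump (p : Torus) : Continuous (bump p) := by
  unfold bump
  refine continuous_finsetSum _ fun i _ => continuous_const.sub (Complex.continuous_re.comp ?_)
  fun_prop

lemma contDiff_bump (p : Torus) :
    ContDiff ℝ ∞ fun y : EuclideanSpace ℝ (Fin 2) => bump p (proj y) := by
  unfold bump
  refine ContDiff.sum fun i _ => ?_
  have h : ContDiff ℝ ∞ fun y : EuclideanSpace ℝ (Fin 2) =>
      character (Pi.single i 1) (proj y - p) := by
    simp only [character_map_sub]
    exact (isSmooth_character (Pi.single i 1)).mul contDiff_const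
  have h' : ContDiff ℝ ∞ fun y : EuclideanSpace ℝ (Fin 2) =>
      (character (Pi.single i 1) (proj y - p)).re := Complex.reCLM.contDiff.comp h
  exact contDiff_const.sub h'

/-- Smooth cut-off functions vanishing near the two points `x 0` and `x 1`. -/
def cutoff (x : Fin 2 → Torus) (n : ℕ) (y : Torus) : ℝ :=
  ∏ j, Real.smoothTransition (n * bump (x j) y - 1)

lemma isSmooth_cutoff_mul (x : Fin 2 → Torus) (n : ℕ) {f : Torus → ℂ} (hf : IsSmooth f) :
    IsSmooth fun y => (cutoff x n y : ℂ) * f y := by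
  unfold IsSmooth cutoff
  refine ContDiff.mul (Complex.ofRealCLM.contDiff.comp (g := fun t : ℝ => (t : ℂ)) ?_) hf
  refine contDiff_prod fun j _ => Real.smoothTransition.contDiff.comp ?_
  exact (contDiff_const.mul (contDiff_bump (x j))).sub contDiff_const

/-- The shift by `-1` in `cutoff` matters here: the `j`-th factor vanishes wherever `n * bump (x j)
< 1`, which is a whole neighbourhood of `x j` and not only the point. -/
lemma notMem_tsupport_cutoff_mul (x : Fin 2 → Torus) (n : ℕ) (f : Torus → ℂ) (j : Fin 2) :
    x j ∉ tsupport fun y => (cutoff x n y : ℂ) * f y := by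
  rw [notMem_tsupport_iff_eventuallyEq]
  have hc : Continuous fun y => n * bump (x j) y - 1 :=
    (continuous_const.mul (continuous_bump _)).sub continuous_const
  have h0 : (n * bump (x j) (x j) - 1 : ℝ) < 0 := by simp [bump_self]
  filter_upwards [hc.continuousAt.eventually (gt_mem_nhds h0)] with y hy
  have : cutoff x n y = 0 :=
    Finset.prod_eq_zero (Finset.mem_univ j) (Real.smoothTransition.zero_of_nonpos hy.le)
  simp [this]

lemma abs_cutoff_le (x : Fin 2 → Torus) (n : ℕ) (y : Torus) : |cutoff x n y| ≤ 1 := by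
  rw [cutoff, Finset.abs_prod]
  refine Finset.prod_le_one (fun _ _ => abs_nonneg _) fun j _ => ?_
  rw [abs_of_nonneg (Real.smoothTransition.nonneg _)]
  exact Real.smoothTransition.le_one _

lemma tendsto_cutoff (x : Fin 2 → Torus) {y : Torus} (hy : ∀ j, y ≠ x j) :
    Tendsto (fun n => cutoff x n y) atTop (𝓝 1) := by
  have h : ∀ j, ∀ᶠ n : ℕ in atTop, Real.smoothTransition (n * bump (x j) y - 1) = 1 := fun j => by
    filter_upwards [((tendsto_natCast_atTop_atTop (R := ℝ)).atTop_mul_const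
      (bump_pos (hy j))).eventually_ge_atTop 2] with n hn
    exact Real.smoothTransition.one_of_one_le (by linarith)
  refine tendsto_const_nhds.congr' ?_
  filter_upwards [h 0, h 1] with n h0 h1
  rw [cutoff, Fin.prod_univ_two, h0, h1, one_mul]

lemma toL2_coeFn (f : C(Torus, ℂ)) : toL2 f =ᵐ[volume] f :=
  ContinuousMap.coeFn_toLp volume f

lemma inner_toL2 (f : C(Torus, ℂ)) (h : L2) :
    inner ℂ (toL2 f) h = ∫ y, conj (f y) * h y := by
  rw [L2.inner_def]
  refine integral_congr_ae ?_
  filter_upwards [toL2_coeFn f] with y hy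
  rw [hy, RCLike.inner_apply, mul_comm]

/-- The operator `-Δ₀` is densely defined. -/
lemma eq_zero_of_inner_domain_eq_zero (x : Fin 2 → Torus) (h : L2)
    (hh : ∀ p ∈ graphZero x, inner ℂ p.1 h = 0) : h = 0 := by
  apply hat_ext
  intro ξ
  rw [hat_zero, hat, unitCharacter, inner_smul_left]
  have key : inner ℂ (toL2 (character ξ)) h = 0 := by
    have hs := fun n => isSmooth_cutoff_mul x n (isSmooth_character ξ)
    have hz : ∀ n, ∫ y, conj ((cutoff x n y : ℂ) * character ξ y) * h y = 0 := by
      intro n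
      have := hh (toL2 (hs n).toC, toL2 ⟨fun y => -lap _ y, (hs n).lap.continuous.neg⟩)
        ⟨_, hs n, notMem_tsupport_cutoff_mul x n _, toL2_coeFn _, toL2_coeFn _⟩
      rw [inner_toL2] at this
      exact this
    have hL1 : Integrable (fun y => h y) := (Lp.memLp h).integrable (by norm_num)
    -- The cut-offs tend to `1` off the two scatterers, a null set, and `|h|` dominates; it is
    -- integrable because the torus has finite measure.
    have hlim := tendsto_integral_of_dominated_convergence
      (F := fun n y => conj ((cutoff x n y : ℂ) * character ξ y) * h y)
      (f := fun y => conj (character ξ y) * h y) (fun y => ‖h y‖)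
      (fun n => (Complex.continuous_conj.comp (hs n).continuous).aestronglyMeasurable.mul
        hL1.aestronglyMeasurable)
      hL1.norm
      (fun n => Eventually.of_forall fun y => by
        rw [norm_mul, RCLike.norm_conj, norm_mul, norm_character, mul_one, Complex.norm_real,
          Real.norm_eq_abs]
        exact mul_le_of_le_one_left (norm_nonneg _) (abs_cutoff_le x n y))
      (by
        have hae : ∀ j, ∀ᵐ y : Torus, y ≠ x j := fun j => by
          simp [ae_iff]
        filter_upwards [hae 0, hae 1] with y h0 h1
        have ht := tendsto_cutoff x (y := y) (fun j => by fin_cases j <;> assumption)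
        have ht' : Tendsto (fun n => (cutoff x n y : ℂ)) atTop (𝓝 1) := by
          exact_mod_cast (Complex.continuous_ofReal.tendsto 1).comp ht
        have h3 := ((Complex.continuous_conj.tendsto _).comp
          (ht'.mul_const (character ξ y))).mul_const (h y)
        simpa using! h3)
    simp only [hz] at hlim
    rw [inner_toL2]
    exact (tendsto_nhds_unique hlim tendsto_const_nhds)
  rw [key, mul_zero]

/-- Since the domain is dense, the adjoint relation is single valued. Any explicit member of the
adjoint graph above `g` therefore computes the action on `g`. -/
lemma eq_of_mem_adjoint {x : Fin 2 → Torus} {g h h' : L2} (h1 : (g, h) ∈ (graphZero x).adjoint)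
    (h2 : (g, h') ∈ (graphZero x).adjoint) : h = h' := by
  rw [Submodule.mem_adjoint_iff] at h1 h2
  rw [← sub_eq_zero]
  refine eq_zero_of_inner_domain_eq_zero x _ fun p hp => ?_
  have e1 := h1 p.1 p.2 hp
  have e2 := h2 p.1 p.2 hp
  simp only at e1 e2
  rw [inner_sub_right]
  linear_combination e2 - e1

lemma hat_eq_coef {g : L2} {f : Torus → ℂ} (hf : Continuous f) (h : g =ᵐ[volume] f) (ξ : Freq) :
    hat g ξ = (2 * Real.pi : ℝ) * coef f ξ := by
  have : g = toL2 ⟨f, hf⟩ := by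
    apply Lp.ext
    exact h.trans (toL2_coeFn ⟨f, hf⟩).symm
  rw [this, hat_toL2]
  rfl

/-! ### Green's functions and the action of the adjoint -/

/-- The Fourier side of a point interaction: `-Δ g - h` is a combination of the two deltas. -/
def DeltaRel (x : Fin 2 → Torus) (g h : L2) (d : Fin 2 → ℂ) : Prop :=
  ∀ ξ, (normSq ξ : ℂ) * hat g ξ - hat h ξ =
    -(1 / (2 * Real.pi) : ℝ) * ∑ j, d j * conj (character ξ (x j))

/-- Test functions of `graphZero` vanish at the scatterers, so the delta terms do not see them: on
the Fourier side the defect sums to a combination of the conjugates of `ψ (x j) = 0`. -/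
lemma DeltaRel.mem_adjoint {x : Fin 2 → Torus} {g h : L2} {d : Fin 2 → ℂ}
    (hd : DeltaRel x g h d) : (g, h) ∈ (graphZero x).adjoint := by
  rw [Submodule.mem_adjoint_iff]
  rintro p q ⟨ψ, hψ, hs, hp, hq⟩
  have e1 : ∀ ξ, hat p ξ = (2 * Real.pi : ℝ) * coef ψ ξ := hat_eq_coef hψ.continuous hp
  have e2 : ∀ ξ, hat q ξ = normSq ξ * hat p ξ := fun ξ => by
    have hq' : q =ᵐ[volume] ((-1 : ℂ) • lap ψ) := by
      refine hq.trans (Eventually.of_forall fun y => ?_)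
      simp
    rw [hat_eq_coef (hψ.lap.continuous.const_smul _) hq', coef_smul, coef_lap hψ, e1]
    ring
  have hsum := (hasSum_inner q g).sub (hasSum_inner p h)
  have hz : ∀ j, ψ (x j) = 0 := fun j => image_eq_zero_of_notMem_tsupport (hs j)
  have h0 : HasSum (fun ξ => -∑ j, d j * conj (coef ψ ξ * character ξ (x j))) 0 := by
    have h1 : ∀ j, HasSum (fun ξ => d j * conj (coef ψ ξ * character ξ (x j))) 0 := fun j => by
      have h2 := ((Complex.hasSum_conj').2 (hψ.hasSum_coef (x j))).mul_left (d j)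
      rwa [hz, map_zero, mul_zero] at h2
    simp only [Fin.sum_univ_two]
    simpa using ((h1 0).add (h1 1)).neg
  refine hsum.unique (h0.congr_fun fun ξ => ?_)
  rw [e2, e1, map_mul, map_mul, Complex.conj_ofReal]
  have hk : (Real.pi : ℂ) ≠ 0 := by exact_mod_cast Real.pi_ne_zero
  have := hd ξ
  have hc : conj (normSq ξ : ℂ) = normSq ξ := by simp
  rw [hc]
  calc _ = (2 * Real.pi : ℝ) * conj (coef ψ ξ) *
        ((normSq ξ : ℂ) * hat g ξ - hat h ξ) := by ring
    _ = _ := by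
      rw [this]
      simp only [Fin.sum_univ_two, map_mul]
      push_cast
      field_simp

lemma DeltaRel.add {x : Fin 2 → Torus} {g h g' h' : L2} {d d' : Fin 2 → ℂ}
    (hd : DeltaRel x g h d) (hd' : DeltaRel x g' h' d') :
    DeltaRel x (g + g') (h + h') (d + d') := fun ξ => by
  have h1 := hd ξ
  have h2 := hd' ξ
  simp only [hat_add, Fin.sum_univ_two, Pi.add_apply] at *
  linear_combination h1 + h2

lemma finite_normSq_le (B : ℝ) : {ξ : Freq | (normSq ξ : ℝ) ≤ B}.Finite := by
  have hB : {ξ : Freq | (normSq ξ : ℝ) ≤ B} ⊆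
      Set.pi Set.univ fun _ => Set.Icc (-⌈B⌉) ⌈B⌉ := by
    intro ξ hξ i _
    have h1 : (normSq ξ : ℝ) ≤ ⌈B⌉ := le_trans hξ (Int.le_ceil B)
    have h2 : normSq ξ ≤ ⌈B⌉ := by exact_mod_cast h1
    have h3 : ξ i ^ 2 ≤ normSq ξ := by
      unfold normSq; fin_cases i <;> simp <;> positivity
    have h4 := h3.trans h2
    constructor
    · nlinarith [Int.le_self_sq (-ξ i)]
    · nlinarith [Int.le_self_sq (ξ i)]
  exact (Set.Finite.pi' fun _ => Set.finite_Icc _ _).subset fun ξ hξ i => hB hξ i (Set.mem_univ i)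

/-- The resolvent multiplier is uniformly comparable to `1 / (1 + |ξ|²)` off finitely many `ξ`. -/
lemma inv_norm_sub_le {z : ℂ} {ξ : Freq} (h : 2 * ‖z‖ + 1 ≤ normSq ξ) :
    1 / ‖(normSq ξ : ℂ) - z‖ ≤ 2 * (1 / (1 + (normSq ξ : ℝ))) := by
  have h1 : (normSq ξ : ℝ) - ‖z‖ ≤ ‖(normSq ξ : ℂ) - z‖ := by
    have := norm_sub_norm_le (normSq ξ : ℂ) z
    have h2 : ‖(normSq ξ : ℂ)‖ = normSq ξ := by
      rw [Complex.norm_intCast, abs_of_nonneg (normSq_nonneg' ξ)]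
    rwa [h2] at this
  have h2 : (1 + (normSq ξ : ℝ)) / 2 ≤ ‖(normSq ξ : ℂ) - z‖ := by linarith
  have h0 := normSq_nonneg' ξ
  calc _ ≤ 1 / ((1 + (normSq ξ : ℝ)) / 2) := by gcongr
    _ = _ := by field_simp

lemma eventually_normSq_ge (B : ℝ) : ∀ᶠ ξ : Freq in cofinite, B ≤ normSq ξ := by
  rw [Filter.eventually_cofinite]
  exact (finite_normSq_le B).subset fun ξ hξ => (not_le.1 hξ).le

lemma summable_inv_norm_sub_sq (z : ℂ) :
    Summable fun ξ : Freq => (1 / ‖(normSq ξ : ℂ) - z‖) ^ 2 := by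
  refine Summable.of_norm_bounded_eventually (summable_inv_one_add_normSq_sq.mul_left 4) ?_
  filter_upwards [eventually_normSq_ge (2 * ‖z‖ + 1)] with ξ hξ
  rw [Real.norm_of_nonneg (by positivity)]
  have := inv_norm_sub_le hξ
  calc _ ≤ (2 * (1 / (1 + (normSq ξ : ℝ)))) ^ 2 := by gcongr
    _ = _ := by
      have h0 := normSq_nonneg' ξ
      field_simp
      norm_num

lemma hat_green (z : ℂ) (y : Torus) (ξ : Freq) :
    hat (green z y) ξ =
      -(1 / (2 * Real.pi) : ℝ) * (conj (character ξ y) / ((normSq ξ : ℂ) - z)) := by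
  have hw : Summable fun ξ : Freq =>
      ‖-((1 / (2 * Real.pi) : ℝ) : ℂ) * (conj (character ξ y) / ((normSq ξ : ℂ) - z))‖ ^ 2 := by
    refine ((summable_inv_norm_sub_sq z).mul_left ((1 / (2 * Real.pi)) ^ 2)).congr fun ξ => ?_
    rw [norm_mul, norm_neg, Complex.norm_real, Real.norm_of_nonneg (by positivity), norm_div,
      RCLike.norm_conj, norm_character, mul_pow]
  obtain ⟨g, hg, hs⟩ := exists_hat_eq hw
  have : green z y = g := by
    rw [green]
    refine (hs.congr_fun fun η => ?_).tsum_eq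
    rw [unitCharacter, smul_smul]
    congr 1
    push_cast
    have hk : (Real.pi : ℂ) ≠ 0 := by exact_mod_cast Real.pi_ne_zero
    field_simp
    ring
  rw [this, hg]

lemma sub_mul_hat_green {z : ℂ} (hz : ∀ ξ : Freq, (normSq ξ : ℂ) ≠ z) (y : Torus) (ξ : Freq) :
    ((normSq ξ : ℂ) - z) * hat (green z y) ξ =
      -(1 / (2 * Real.pi) : ℝ) * conj (character ξ y) := by
  rw [hat_green]
  have := sub_ne_zero.2 (hz ξ)
  field_simp

lemma normSq_ne_I (ξ : Freq) : (normSq ξ : ℂ) ≠ Complex.I := fun h => by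
  simpa using congr_arg Complex.im h

lemma normSq_ne_neg_I (ξ : Freq) : (normSq ξ : ℂ) ≠ -Complex.I := fun h => by
  simpa using congr_arg Complex.im h

lemma hat_pairing (x : Fin 2 → Torus) (M : Matrix (Fin 2) (Fin 2) ℂ) (z : ℂ) (v : Fin 2 → ℂ)
    (ξ : Freq) : hat (pairing x M z v) ξ =
      ∑ j, Matrix.vecMul (star v) M j * hat (green z (x j)) ξ := by
  rw [pairing, hat_sum]
  simp only [hat_smul]

lemma deltaRel_pairing (x : Fin 2 → Torus) (M : Matrix (Fin 2) (Fin 2) ℂ) {z : ℂ}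
    (hz : ∀ ξ : Freq, (normSq ξ : ℂ) ≠ z) (v : Fin 2 → ℂ) :
    DeltaRel x (pairing x M z v) (z • pairing x M z v) (Matrix.vecMul (star v) M) := fun ξ => by
  rw [hat_smul, ← sub_mul, hat_pairing, Finset.mul_sum, Finset.mul_sum]
  refine Finset.sum_congr rfl fun j _ => ?_
  rw [mul_left_comm, sub_mul_hat_green hz]
  ring

lemma MemH2.exists_laplacian {f : C(Torus, ℂ)} (hf : MemH2 f) :
    ∃ F : L2, ∀ ξ, hat F ξ = normSq ξ * hat (toL2 f) ξ := by
  have : Summable fun ξ => ‖(normSq ξ : ℂ) * hat (toL2 f) ξ‖ ^ 2 := by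
    refine Summable.of_nonneg_of_le (fun ξ => by positivity) (fun ξ => ?_)
      (hf.mul_left ((2 * Real.pi) ^ 2))
    have h0 := normSq_nonneg' ξ
    rw [hat_toL2, norm_mul, norm_mul, Complex.norm_real, Complex.norm_intCast,
      Real.norm_of_nonneg Real.two_pi_pos.le, abs_of_nonneg h0, mul_pow, mul_pow,
      mul_left_comm]
    gcongr
    linarith
  obtain ⟨F, hF, -⟩ := exists_hat_eq this
  exact ⟨F, hF⟩

/-- The Sobolev embedding in dimension two, by `2uv ≤ u² + v²` with `u = (1 + |ξ|²)⁻¹`. It allows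
the point values of `f` to be read off its Fourier series. -/
lemma MemH2.summable_norm_fourierCoef {f : C(Torus, ℂ)} (hf : MemH2 f) :
    Summable fun ξ => ‖fourierCoef f ξ‖ := by
  refine Summable.of_nonneg_of_le (fun ξ => norm_nonneg _) (fun ξ => ?_)
    (summable_inv_one_add_normSq_sq.add hf)
  have h0 := normSq_nonneg' ξ
  have h1 : 1 / (1 + (normSq ξ : ℝ)) * ((1 + (normSq ξ : ℝ)) * ‖fourierCoef f ξ‖) =
      ‖fourierCoef f ξ‖ := by field_simp
  have h2 := two_mul_le_add_sq (1 / (1 + (normSq ξ : ℝ))) ((1 + (normSq ξ : ℝ)) * ‖fourierCoef f ξ‖)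
  have h3 : 0 ≤ ‖fourierCoef f ξ‖ := norm_nonneg _
  rw [mul_pow, div_pow, one_pow] at h2
  nlinarith

/-- The difference of the two sides is the series of `-conj (f y)`, since `G_z(·, y)` inverts `Δ +
z` on `δ_y`; it vanishes because `f` does. -/
lemma inner_laplacian_green {f : C(Torus, ℂ)} (hf : MemH2 f) {F : L2}
    (hF : ∀ ξ, hat F ξ = normSq ξ * hat (toL2 f) ξ) {y : Torus} (hy : f y = 0) {z : ℂ}
    (hz : ∀ ξ : Freq, (normSq ξ : ℂ) ≠ z) :
    inner ℂ F (green z y) = z * inner ℂ (toL2 f) (green z y) := by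
  have h1 := (hasSum_inner F (green z y)).sub ((hasSum_inner (toL2 f) (green z y)).mul_left z)
  have h2 : HasSum (fun ξ => -conj (fourierCoef f ξ * character ξ y)) 0 := by
    have := ((Complex.hasSum_conj').2 (hasSum_fourier_apply hf.summable_norm_fourierCoef y)).neg
    simpa [hy] using this
  refine sub_eq_zero.1 (h1.unique (h2.congr_fun fun ξ => ?_))
  have hc : conj (normSq ξ : ℂ) = normSq ξ := by simp
  rw [hF, map_mul, hc]
  calc _ = conj (hat (toL2 f) ξ) * (((normSq ξ : ℂ) - z) * hat (green z y) ξ) := by ring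
    _ = _ := by
      rw [sub_mul_hat_green hz, hat_toL2, map_mul, map_mul, Complex.conj_ofReal]
      have hk : (Real.pi : ℂ) ≠ 0 := by exact_mod_cast Real.pi_ne_zero
      push_cast
      field_simp

lemma inner_laplacian_pairing {x : Fin 2 → Torus} {f : C(Torus, ℂ)} (hf : MemH2 f) {F : L2}
    (hF : ∀ ξ, hat F ξ = normSq ξ * hat (toL2 f) ξ) (hx : ∀ j, f (x j) = 0) {z : ℂ}
    (hz : ∀ ξ : Freq, (normSq ξ : ℂ) ≠ z) (M : Matrix (Fin 2) (Fin 2) ℂ) (v : Fin 2 → ℂ) :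
    inner ℂ F (pairing x M z v) = z * inner ℂ (toL2 f) (pairing x M z v) := by
  simp only [pairing, inner_sum, inner_smul_right, Finset.mul_sum]
  refine Finset.sum_congr rfl fun j _ => ?_
  rw [inner_laplacian_green hf hF (hx j) hz]
  ring

/-! ### The Gram matrix of the Green's functions and the role of `T` -/

lemma inner_green_eq (z : ℂ) (p q : Torus) :
    HasSum (fun ξ => (1 / (2 * Real.pi) : ℝ) ^ 2 *
      (character ξ p * conj (character ξ q) / (‖(normSq ξ : ℂ) - z‖ ^ 2 : ℝ)))
      (inner ℂ (green z p) (green z q)) := by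
  refine (hasSum_inner (green z p) (green z q)).congr_fun fun ξ => ?_
  rw [hat_green, hat_green, map_mul, map_div₀, map_neg, Complex.conj_ofReal, Complex.conj_conj,
    ← Complex.normSq_eq_norm_sq, Complex.normSq_eq_conj_mul_self]
  by_cases h : (normSq ξ : ℂ) - z = 0
  · simp [h]
  have h' : conj ((normSq ξ : ℂ) - z) ≠ 0 := (map_ne_zero _).2 h
  field_simp

lemma norm_sub_I_sq (m : ℤ) : ‖(m : ℂ) - Complex.I‖ ^ 2 = (m : ℝ) ^ 2 + 1 := by
  rw [← Complex.normSq_eq_norm_sq, Complex.normSq_apply]; simp; ring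

lemma norm_add_I_sq (m : ℤ) : ‖(m : ℂ) - -Complex.I‖ ^ 2 = (m : ℝ) ^ 2 + 1 := by
  rw [← Complex.normSq_eq_norm_sq, Complex.normSq_apply]; simp; ring

/-- Inner products see `z` only through `||ξ|² - z|²`, which is `|ξ|⁴ + 1` at both `i` and `-i`.
Hence one matrix `T` orthonormalises both families. -/
lemma inner_green_neg_I (p q : Torus) :
    inner ℂ (green (-Complex.I) p) (green (-Complex.I) q) =
      inner ℂ (green Complex.I p) (green Complex.I q) := by
  refine (inner_green_eq _ p q).unique ((inner_green_eq _ p q).congr_fun fun ξ => ?_)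
  rw [norm_sub_I_sq, norm_add_I_sq]

lemma normSq_neg (ξ : Freq) : normSq (-ξ) = normSq ξ := by simp [normSq]

/-- The substitution `ξ ↦ -ξ` exchanges the two points; together with conjugate symmetry this makes
`c₂` real. -/
lemma inner_green_comm (p q : Torus) :
    inner ℂ (green Complex.I p) (green Complex.I q) =
      inner ℂ (green Complex.I q) (green Complex.I p) := by
  have h := (Equiv.neg Freq).hasSum_iff.2 (inner_green_eq Complex.I q p)
  refine (inner_green_eq _ p q).unique (h.congr_fun fun ξ => ?_)
  simp only [Function.comp_apply, Equiv.neg_apply, character_neg, normSq_neg, Complex.conj_conj]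
  ring

lemma inner_green_self (p q : Torus) :
    inner ℂ (green Complex.I p) (green Complex.I p) =
      inner ℂ (green Complex.I q) (green Complex.I q) := by
  refine (inner_green_eq _ p p).unique ((inner_green_eq _ q q).congr_fun fun ξ => ?_)
  have e : ∀ p, character ξ p * conj (character ξ p) = 1 := fun p => by
    rw [mul_comm, character_conj_mul]
  rw [e, e]

lemma inner_green (x : Fin 2 → Torus) (j l : Fin 2) :
    inner ℂ (green Complex.I (x j)) (green Complex.I (x l)) =
      ((if j = l then c₁ x else c₂ x : ℝ) : ℂ) := by
  have h1 : ∀ j, inner ℂ (green Complex.I (x j)) (green Complex.I (x j)) = (c₁ x : ℂ) := by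
    intro j
    rw [inner_green_self (x j) (x 0), inner_self_eq_norm_sq_to_K, c₁]
    simp
  have h2 : inner ℂ (green Complex.I (x 1)) (green Complex.I (x 0)) = (c₂ x : ℂ) := by
    refine (Complex.conj_eq_iff_re.1 ?_).symm
    rw [inner_conj_symm, inner_green_comm]
  fin_cases j <;> fin_cases l
  · simpa using h1 0
  · simpa [inner_green_comm (x 0) (x 1)] using h2
  · simpa using h2
  · simpa using h1 1

lemma green_I_injective {p q : Torus} {c : ℂ}
    (h : green Complex.I p = c • green Complex.I q) : c = 1 ∧ p = q := by
  have key : ∀ ξ, character ξ p = conj c * character ξ q := by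
    intro ξ
    have h1 := congr_arg (fun g => ((normSq ξ : ℂ) - Complex.I) * hat g ξ) h
    simp only [hat_smul] at h1
    rw [mul_left_comm, sub_mul_hat_green normSq_ne_I, sub_mul_hat_green normSq_ne_I] at h1
    have hk : (Real.pi : ℂ) ≠ 0 := by exact_mod_cast Real.pi_ne_zero
    have h2 : conj (character ξ p) = c * conj (character ξ q) := by
      push_cast at h1
      field_simp at h1
      linear_combination -h1
    have h3 := congr_arg conj h2
    simpa using h3
  have hc : c = 1 := by
    have h0 := key 0
    rw [character_zero, character_zero, mul_one] at h0
    simpa using (congr_arg conj h0).symm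
  exact ⟨hc, eq_of_character_eq fun ξ => by rw [key, hc]; simp⟩

/-- `c₁ + 2 s c₂ + s² c₁` is the squared norm of `G_i(·, x₁) + s G_i(·, x₂)`, nonzero because the
two functions are independent; take `s = ±1`. This makes the square roots in `T` genuine. -/
lemma c₁_add_sub_pos {x : Fin 2 → Torus} (hx : x 0 ≠ x 1) :
    0 < c₁ x + c₂ x ∧ 0 < c₁ x - c₂ x := by
  have hn : ∀ s : ℂ, green Complex.I (x 0) + s • green Complex.I (x 1) ≠ 0 := by
    intro s h
    have h1 : green Complex.I (x 0) = (-s) • green Complex.I (x 1) := by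
      rw [neg_smul]; exact eq_neg_of_add_eq_zero_left h
    exact hx (green_I_injective h1).2
  have hs : ∀ s : ℝ, 0 < c₁ x + 2 * s * c₂ x + s ^ 2 * c₁ x := by
    intro s
    have h1 : 0 < ‖green Complex.I (x 0) + (s : ℂ) • green Complex.I (x 1)‖ ^ 2 :=
      pow_pos (norm_pos_iff.2 (hn s)) 2
    have h2 : ((‖green Complex.I (x 0) + (s : ℂ) • green Complex.I (x 1)‖ ^ 2 : ℝ) : ℂ) =
        ((c₁ x + 2 * s * c₂ x + s ^ 2 * c₁ x : ℝ) : ℂ) := by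
      have h3 := inner_self_eq_norm_sq_to_K (𝕜 := ℂ)
        (green Complex.I (x 0) + (s : ℂ) • green Complex.I (x 1))
      rw [inner_add_left, inner_add_right, inner_add_right, inner_smul_left, inner_smul_right,
        inner_smul_left, inner_smul_right, inner_green, inner_green, inner_green, inner_green,
        Complex.conj_ofReal] at h3
      push_cast
      simp only [Fin.isValue, if_true, zero_ne_one, if_false, one_ne_zero] at h3
      refine h3.symm.trans ?_
      ring
    rw [Complex.ofReal_inj] at h2
    rwa [h2] at h1
  constructor
  · linarith [hs 1]
  · linarith [hs (-1)]

/-- `T` orthonormalises the Green's functions. -/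
lemma T_gram {x : Fin 2 → Torus} (hx : x 0 ≠ x 1) (k k' : Fin 2) :
    ∑ j, ∑ l, T x k j * T x k' l * ((if j = l then c₁ x else c₂ x : ℝ) : ℂ) =
      if k = k' then 1 else 0 := by
  obtain ⟨hp, hm⟩ := c₁_add_sub_pos hx
  have h1 : 0 < c₁ x := by linarith
  have hD : 0 < c₁ x ^ 2 - c₂ x ^ 2 := by nlinarith
  set D := c₁ x ^ 2 - c₂ x ^ 2 with hDdef
  set a := √(c₁ x) with ha
  set b := √D with hb
  have ha2 : a ^ 2 = c₁ x := Real.sq_sqrt h1.le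
  have hb2 : b ^ 2 = D := Real.sq_sqrt hD.le
  have ha0 : 0 < a := Real.sqrt_pos.2 h1
  have hb0 : 0 < b := Real.sqrt_pos.2 hD
  have e1 : √(c₁ x * D) = a * b := Real.sqrt_mul h1.le D
  have e2 : √(c₁ x / D) = a / b := Real.sqrt_div h1.le D
  have key : b ^ 2 = a ^ 4 - c₂ x ^ 2 := by rw [hb2, hDdef, ← ha2]; ring
  rw [T, ← hDdef, e1, e2, ← ha, ← ha2]
  fin_cases k <;> fin_cases k' <;>
    simp only [Fin.sum_univ_two, Matrix.of_apply, Matrix.cons_val', Matrix.cons_val_zero,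
      Matrix.cons_val_one, Matrix.cons_val_fin_one, Fin.isValue, Fin.zero_eta, Fin.mk_one,
      zero_ne_one, one_ne_zero, if_true, if_false] <;> norm_cast <;> field_simp
  · simp
  · ring
  · ring
  · rw [key]; ring

lemma conj_T (x : Fin 2 → Torus) (j k : Fin 2) : conj (T x j k) = T x j k := by
  fin_cases j <;> fin_cases k <;> simp [T, Complex.conj_ofReal]

/-- Orthonormality of the rows of `T 𝔾_z` combined with unitarity of `V`. Used with `V = 1` at `i`
and `V = U` at `-i`: the two singular parts of a domain element have the same inner products. -/
lemma inner_pairing {x : Fin 2 → Torus} (hx : x 0 ≠ x 1) {z : ℂ}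
    (hz : z = Complex.I ∨ z = -Complex.I) {V : Matrix (Fin 2) (Fin 2) ℂ} (hV : V * star V = 1)
    (v v' : Fin 2 → ℂ) :
    inner ℂ (pairing x (V * T x) z v) (pairing x (V * T x) z v') = ∑ k, v k * conj (v' k) := by
  have hg : ∀ j l, inner ℂ (green z (x j)) (green z (x l)) =
      ((if j = l then c₁ x else c₂ x : ℝ) : ℂ) := by
    rcases hz with rfl | rfl
    · exact inner_green x
    · intro j l; rw [inner_green_neg_I, inner_green]
  simp only [pairing, ← Matrix.vecMul_vecMul]
  set u := Matrix.vecMul (star v) V with hu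
  set u' := Matrix.vecMul (star v') V with hu'
  have h1 : inner ℂ (∑ j, Matrix.vecMul u (T x) j • green z (x j))
      (∑ j, Matrix.vecMul u' (T x) j • green z (x j)) = ∑ k, conj (u k) * u' k := by
    simp only [sum_inner, inner_sum, inner_smul_left, inner_smul_right, hg]
    have g := T_gram hx
    have g00 := g 0 0
    have g01 := g 0 1
    have g10 := g 1 0
    have g11 := g 1 1
    simp only [Fin.sum_univ_two, Fin.isValue, if_true, zero_ne_one, one_ne_zero, if_false,
      Matrix.vecMul, dotProduct, map_add, map_mul, conj_T] at *
    linear_combination (conj (u 0) * u' 0) * g00 + (conj (u 0) * u' 1) * g01 +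
      (conj (u 1) * u' 0) * g10 + (conj (u 1) * u' 1) * g11
  rw [h1]
  have h2 : ∀ i k, ∑ l, V i l * conj (V k l) = if i = k then 1 else 0 := by
    intro i k
    have := congr_fun (congr_fun hV i) k
    rw [Matrix.mul_apply, Matrix.one_apply] at this
    exact this
  have h00 := h2 0 0
  have h01 := h2 0 1
  have h10 := h2 1 0
  have h11 := h2 1 1
  simp only [hu, hu', Fin.sum_univ_two, Fin.isValue, if_true, zero_ne_one, one_ne_zero, if_false,
    Matrix.vecMul, dotProduct, map_add, map_mul, Pi.star_apply, RCLike.star_def,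
    Complex.conj_conj] at *
  linear_combination (v 0 * conj (v' 0)) * h00 + (v 1 * conj (v' 1)) * h11 +
    (v 0 * conj (v' 1)) * h10 + (v 1 * conj (v' 0)) * h01

/-! ### Eigenfunctions: delta relation, symmetry, multiplicity in gaps -/

/-- The coefficients of the delta functions in `(-Δ - λ) g` for `g` in the domain of `-Δ_U`. -/
def deltaCoef (x : Fin 2 → Torus) (U : Matrix.unitaryGroup (Fin 2) ℂ) (v : Fin 2 → ℂ) :
    Fin 2 → ℂ :=
  Matrix.vecMul (star v) (T x) + Matrix.vecMul (star v) ((U : Matrix (Fin 2) (Fin 2) ℂ) * T x)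

lemma exists_action_of_mem_domainU {x : Fin 2 → Torus} {U : Matrix.unitaryGroup (Fin 2) ℂ}
    {g : L2} (hg : g ∈ domainU x U) :
    ∃ (f : C(Torus, ℂ)) (v : Fin 2 → ℂ) (F : L2), MemH2 f ∧ (∀ j, f (x j) = 0) ∧
      (∀ ξ, hat F ξ = normSq ξ * hat (toL2 f) ξ) ∧
      g = toL2 f + pairing x (T x) Complex.I v
        + pairing x ((U : Matrix (Fin 2) (Fin 2) ℂ) * T x) (-Complex.I) v ∧
      DeltaRel x g (F + Complex.I • pairing x (T x) Complex.I v +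
        (-Complex.I) • pairing x ((U : Matrix (Fin 2) (Fin 2) ℂ) * T x) (-Complex.I) v)
        (deltaCoef x U v) := by
  obtain ⟨f, v, hf, hx, rfl⟩ := hg
  obtain ⟨F, hF⟩ := hf.exists_laplacian
  refine ⟨f, v, F, hf, hx, hF, rfl, ?_⟩
  have h0 : DeltaRel x (toL2 f) F 0 := fun ξ => by rw [hF]; simp
  have := (h0.add (deltaRel_pairing x (T x) normSq_ne_I v)).add
    (deltaRel_pairing x ((U : Matrix (Fin 2) (Fin 2) ℂ) * T x) normSq_ne_neg_I v)
  rwa [zero_add] at this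

/-- The explicit action on the decomposition of `g` and `λ g` both belong to the adjoint above `g`,
so they agree. Later estimates on eigenfunctions use only this relation and no longer `U`. -/
lemma IsEigenfunction.exists_deltaRel {x : Fin 2 → Torus} {U : Matrix.unitaryGroup (Fin 2) ℂ}
    {lam : ℝ} {g : L2} (hg : IsEigenfunction x U lam g) :
    ∃ d, DeltaRel x g ((lam : ℂ) • g) d := by
  obtain ⟨hadj, hdom⟩ := hg.2
  obtain ⟨f, v, F, hf, hx, hF, hgf, hD⟩ := exists_action_of_mem_domainU hdom
  rw [← eq_of_mem_adjoint hadj hD.mem_adjoint] at hD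
  exact ⟨_, hD⟩

lemma inner_laplacian_comm {f f' F F' : L2} (hF : ∀ ξ, hat F ξ = normSq ξ * hat f ξ)
    (hF' : ∀ ξ, hat F' ξ = normSq ξ * hat f' ξ) : inner ℂ F f' = inner ℂ f F' := by
  refine (hasSum_inner F f').unique ((hasSum_inner f F').congr_fun fun ξ => ?_)
  have hc : conj (normSq ξ : ℂ) = normSq ξ := by simp
  rw [hF, hF', map_mul, hc]
  ring

/-- The operator `-Δ_U` is symmetric: eigenfunctions with distinct eigenvalues are orthogonal. -/
lemma IsEigenfunction.inner_eq_zero {x : Fin 2 → Torus} (hx : x 0 ≠ x 1)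
    {U : Matrix.unitaryGroup (Fin 2) ℂ} {lam lam' : ℝ} {g g' : L2}
    (hg : IsEigenfunction x U lam g) (hg' : IsEigenfunction x U lam' g') (hne : lam ≠ lam') :
    inner ℂ g g' = 0 := by
  obtain ⟨hadj, hdom⟩ := hg.2
  obtain ⟨f, v, F, hf, hfx, hF, hgf, hD⟩ := exists_action_of_mem_domainU hdom
  obtain ⟨hadj', hdom'⟩ := hg'.2
  obtain ⟨f', v', F', hf', hfx', hF', hgf', hD'⟩ := exists_action_of_mem_domainU hdom'
  have h := eq_of_mem_adjoint hadj hD.mem_adjoint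
  have h' := eq_of_mem_adjoint hadj' hD'.mem_adjoint
  simp only at h h' hgf hgf'
  set p := pairing x (T x) Complex.I v with hp
  set m := pairing x ((U : Matrix (Fin 2) (Fin 2) ℂ) * T x) (-Complex.I) v with hm
  set p' := pairing x (T x) Complex.I v' with hp'
  set m' := pairing x ((U : Matrix (Fin 2) (Fin 2) ℂ) * T x) (-Complex.I) v' with hm'
  have e1 : inner ℂ F (toL2 f') = inner ℂ (toL2 f) F' := inner_laplacian_comm hF hF'
  have e2 : inner ℂ F p' = Complex.I * inner ℂ (toL2 f) p' :=
    inner_laplacian_pairing hf hF hfx normSq_ne_I _ _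
  have e3 : inner ℂ F m' = -Complex.I * inner ℂ (toL2 f) m' :=
    inner_laplacian_pairing hf hF hfx normSq_ne_neg_I _ _
  have e4 : inner ℂ p F' = -Complex.I * inner ℂ p (toL2 f') := by
    have := congr_arg conj
      (inner_laplacian_pairing hf' hF' hfx' normSq_ne_I (T x) v)
    rwa [map_mul, inner_conj_symm, inner_conj_symm, Complex.conj_I] at this
  have e5 : inner ℂ m F' = Complex.I * inner ℂ m (toL2 f') := by
    have := congr_arg conj
      (inner_laplacian_pairing hf' hF' hfx' normSq_ne_neg_I ((U : Matrix (Fin 2) (Fin 2) ℂ) * T x) v)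
    rwa [map_mul, inner_conj_symm, inner_conj_symm, map_neg, Complex.conj_I, neg_neg] at this
  -- The boundary form reduces to `-2i⟨p, p'⟩ + 2i⟨m, m'⟩`, all cross terms matching; unitarity of
  -- `U` makes it vanish.
  have e6 : inner ℂ p p' = inner ℂ m m' := by
    have q1 := inner_pairing hx (z := Complex.I) (Or.inl rfl) (V := 1) (by simp) v v'
    have q2 := inner_pairing hx (z := -Complex.I) (Or.inr rfl)
      (V := (U : Matrix (Fin 2) (Fin 2) ℂ)) (Matrix.mem_unitaryGroup_iff.1 U.2) v v'
    rw [one_mul] at q1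
    rw [hp, hp', hm, hm', q1, q2]
  have s1 : (lam : ℂ) * inner ℂ g g' = inner ℂ ((lam : ℂ) • g) g' := by
    rw [inner_smul_left, Complex.conj_ofReal]
  have s2 : (lam' : ℂ) * inner ℂ g g' = inner ℂ g ((lam' : ℂ) • g') := by
    rw [inner_smul_right]
  have s3 : inner ℂ ((lam : ℂ) • g) g' = inner ℂ g ((lam' : ℂ) • g') := by
    rw [h, h', hgf, hgf']
    simp only [inner_add_left, inner_add_right, inner_smul_left, inner_smul_right, e1, e2, e3, e4,
      e5, e6, Complex.conj_I, map_neg]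
    ring
  have s4 : ((lam : ℂ) - lam') * inner ℂ g g' = 0 := by
    rw [sub_mul, s1, s2, s3, sub_self]
  rcases mul_eq_zero.1 s4 with h5 | h5
  · exact absurd (by exact_mod_cast sub_eq_zero.1 h5) hne
  · exact h5

/-- An interval free of Laplace eigenvalues carries at most two orthonormal eigenfunctions. -/
lemma not_three_eigenvalues {x : Fin 2 → Torus} {U : Matrix.unitaryGroup (Fin 2) ℂ} {a b : ℝ}
    (hab : ∀ ξ : Freq, (normSq ξ : ℝ) ∉ Set.Ioo a b) {φ : Fin 3 → L2} (hφ : Orthonormal ℂ φ)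
    {lam : Fin 3 → ℝ} (he : ∀ i, IsEigenfunction x U (lam i) (φ i))
    (hl : ∀ i, lam i ∈ Set.Ioo a b) : False := by
  choose d hd using fun i => (he i).exists_deltaRel
  -- Three strength vectors in `ℂ²` are dependent, so some nonzero combination of the eigenfunctions
  -- has no delta singularity left.
  have hdep : ¬ LinearIndependent ℂ d := fun h => by
    have := h.fintype_card_le_finrank
    simp at this
  obtain ⟨c, hc, i₀, hi₀⟩ := Fintype.not_linearIndependent_iff.1 hdep
  -- Centre and half-length of the gap. Without singular part, `k` is `(-Δ - μ) h`, so `‖k‖ ≥ r ‖h‖`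
  -- as the Laplace spectrum stays at distance `r` from `μ`; orthonormality and `|lam i - μ| < r`
  -- give the strict opposite.
  set μ := (a + b) / 2 with hμ
  set r := (b - a) / 2 with hr
  have hrpos : 0 < r := by have := hl 0; simp only [Set.mem_Ioo] at this; linarith
  have hgap : ∀ ξ : Freq, r ≤ |(normSq ξ : ℝ) - μ| := by
    intro ξ
    have h := hab ξ
    simp only [Set.mem_Ioo, not_and_or, not_lt] at h
    rcases h with h | h
    · rw [abs_of_nonpos (by linarith)]; linarith
    · rw [abs_of_nonneg (by linarith)]; linarith
  have hlt : ∀ i, |lam i - μ| < r := by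
    intro i
    have := hl i
    simp only [Set.mem_Ioo] at this
    rw [abs_lt]; constructor <;> linarith
  set h := ∑ i, c i • φ i with hh
  set k := ∑ i, (c i * (lam i - μ)) • φ i with hk
  have hkh : ∀ ξ, hat k ξ = ((normSq ξ : ℂ) - μ) * hat h ξ := by
    intro ξ
    have hz : ∑ i, c i * (((normSq ξ : ℂ) - lam i) * hat (φ i) ξ) = 0 := by
      have h1 : ∀ i, ((normSq ξ : ℂ) - lam i) * hat (φ i) ξ =
          -(1 / (2 * Real.pi) : ℝ) * ∑ j, d i j * conj (character ξ (x j)) := fun i => by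
        rw [← hd i ξ, hat_smul]; ring
      simp only [h1, mul_left_comm (c _), ← Finset.mul_sum]
      have h2 : ∑ i, c i * ∑ j, d i j * conj (character ξ (x j)) =
          ∑ j, (∑ i, c i • d i) j * conj (character ξ (x j)) := by
        simp only [Finset.sum_apply, Pi.smul_apply, smul_eq_mul, Finset.sum_mul, Finset.mul_sum,
          mul_assoc]
        exact Finset.sum_comm
      rw [h2, hc]
      simp
    rw [hk, hh, hat_sum, hat_sum, Finset.mul_sum]
    simp only [hat_smul]
    rw [← sub_eq_zero, ← Finset.sum_sub_distrib, ← neg_eq_zero, ← hz, ← Finset.sum_neg_distrib]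
    refine Finset.sum_congr rfl fun i _ => ?_
    ring
  have n1 : ‖h‖ ^ 2 = ∑ i, ‖c i‖ ^ 2 := by
    have := hφ.inner_sum c c Finset.univ
    rw [← hh, inner_self_eq_norm_sq_to_K] at this
    have h2 : ∀ i, conj (c i) * c i = ((‖c i‖ ^ 2 : ℝ) : ℂ) := fun i => by
      rw [← Complex.normSq_eq_conj_mul_self, Complex.normSq_eq_norm_sq]
    simp only [h2] at this
    exact Complex.ofReal_injective (by push_cast at this ⊢; exact this)
  have n2 : ‖k‖ ^ 2 = ∑ i, ‖c i‖ ^ 2 * (lam i - μ) ^ 2 := by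
    have := hφ.inner_sum (fun i => c i * ((lam i : ℂ) - μ)) (fun i => c i * ((lam i : ℂ) - μ))
      Finset.univ
    rw [← hk, inner_self_eq_norm_sq_to_K] at this
    have h2 : ∀ i, conj (c i * ((lam i : ℂ) - μ)) * (c i * ((lam i : ℂ) - μ)) =
        ((‖c i‖ ^ 2 * (lam i - μ) ^ 2 : ℝ) : ℂ) := fun i => by
      rw [← Complex.normSq_eq_conj_mul_self, Complex.normSq_eq_norm_sq, norm_mul, mul_pow,
        ← Complex.ofReal_sub, Complex.norm_real, Real.norm_eq_abs, sq_abs]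
    simp only [h2] at this
    exact Complex.ofReal_injective (by push_cast at this ⊢; exact this)
  have l1 : r ^ 2 * ‖h‖ ^ 2 ≤ ‖k‖ ^ 2 := by
    refine hasSum_le (fun ξ => ?_) ((hasSum_norm_sq h).mul_left (r ^ 2)) (hasSum_norm_sq k)
    rw [hkh, norm_mul, mul_pow]
    have : ‖(normSq ξ : ℂ) - μ‖ = |(normSq ξ : ℝ) - μ| := by
      rw [← Complex.ofReal_intCast, ← Complex.ofReal_sub, Complex.norm_real, Real.norm_eq_abs]
    rw [this]
    gcongr
    exact hgap ξ
  have l2 : ‖k‖ ^ 2 < r ^ 2 * ‖h‖ ^ 2 := by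
    rw [n1, n2, Finset.mul_sum]
    refine Finset.sum_lt_sum (fun i _ => ?_) ⟨i₀, Finset.mem_univ _, ?_⟩
    · rw [mul_comm (r ^ 2)]
      have := sq_lt_sq.2 ((hlt i).trans_le (le_abs_self r))
      gcongr
    · rw [mul_comm (r ^ 2)]
      have := sq_lt_sq.2 ((hlt i₀).trans_le (le_abs_self r))
      have h3 : 0 < ‖c i₀‖ := norm_pos_iff.2 hi₀
      gcongr
  linarith

/-! ### Representations as sums of two squares, via Gaussian integers -/

lemma finite_gaussianInt_norm_le (B : ℝ) :
    {z : GaussianInt | ((Zsqrtd.norm z : ℤ) : ℝ) ≤ B}.Finite := by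
  have hinj : Function.Injective fun z : GaussianInt => (![z.re, z.im] : Freq) := by
    intro z w h
    exact Zsqrtd.ext (congr_fun h 0) (congr_fun h 1)
  refine Set.Finite.of_finite_image (f := fun z : GaussianInt => (![z.re, z.im] : Freq))
    ((finite_normSq_le B).subset ?_) hinj.injOn
  rintro _ ⟨z, hz, rfl⟩
  have : normSq ![z.re, z.im] = Zsqrtd.norm z := by
    simp [normSq, Zsqrtd.norm]; ring
  simpa [this] using hz

lemma gaussianInt_two_le_norm {p : GaussianInt} (hp : Prime p) :
    (2 : ℝ) ≤ (Zsqrtd.norm p : ℤ) := by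
  have h0 := GaussianInt.norm_nonneg p
  have h1 : Zsqrtd.norm p ≠ 0 := fun h =>
    hp.ne_zero ((GaussianInt.norm_eq_zero).1 h)
  have h2 : Zsqrtd.norm p ≠ 1 := fun h =>
    hp.not_isUnit (Zsqrtd.norm_eq_one_iff.1 (by rw [h]; rfl))
  have : 2 ≤ Zsqrtd.norm p := by lia
  exact_mod_cast this

/-- The divisor bound in the Gaussian integers. -/
lemma gaussianInt_divisor_bound {e : ℝ} (he : 0 < e) :
    ∃ C : ℝ, 0 < C ∧ ∀ a : GaussianInt, a ≠ 0 → ∃ s : Finset GaussianInt,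
      (s.card : ℝ) ≤ C * ((Zsqrtd.norm a : ℤ) : ℝ) ^ e ∧
        ∀ z, z ∣ a → ∃ y ∈ s, Associated z y := by
  classical
  -- A prime of norm `q > B` has `q^e ≥ 2`, so the `k + 1` divisors of `p^k` are at most `2^k ≤
  -- q^{ke}` at no cost. Only the finitely many primes in `S` cost the constant `c`, chosen so that
  -- `k + 1 ≤ c 2^{ke}`.
  set B : ℝ := 2 ^ (1 / e) with hB
  set S : Finset GaussianInt := (finite_gaussianInt_norm_le B).toFinset.filter Prime with hS
  set c : ℝ := 1 + 1 / (e * Real.log 2) with hc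
  have hlog : 0 < e * Real.log 2 := mul_pos he (Real.log_pos one_lt_two)
  have hc1 : 1 ≤ c := by
    have : 0 ≤ 1 / (e * Real.log 2) := by positivity
    linarith
  have hck : ∀ k : ℕ, (k + 1 : ℝ) ≤ c * 2 ^ (k * e) := by
    intro k
    have h1 : 1 + k * (e * Real.log 2) ≤ (2 : ℝ) ^ (k * e) := by
      rw [Real.rpow_def_of_pos two_pos]
      have := Real.add_one_le_exp (Real.log 2 * (k * e))
      linarith
    have h2 : (k + 1 : ℝ) ≤ c * (1 + k * (e * Real.log 2)) := by
      have h3 : c * (1 + k * (e * Real.log 2)) =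
          1 + k * (e * Real.log 2) + 1 / (e * Real.log 2) + k := by
        rw [hc]; field_simp
        ring
      rw [h3]
      have : 0 ≤ k * (e * Real.log 2) := by positivity
      have : 0 ≤ 1 / (e * Real.log 2) := by positivity
      linarith
    exact h2.trans (by gcongr)
  -- The power of `c` counts the small primes dividing `a`. This bound is multiplicative over
  -- coprime factors, hence suited to the induction; the uniform constant `c ^ S.card` would not be.
  have key : ∀ a : GaussianInt, a ≠ 0 → ∃ s : Finset GaussianInt,
      (s.card : ℝ) ≤ c ^ (S.filter (· ∣ a)).card * ((Zsqrtd.norm a : ℤ) : ℝ) ^ e ∧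
        ∀ z, z ∣ a → ∃ y ∈ s, Associated z y := by
    intro a
    induction a using UniqueFactorizationMonoid.induction_on_coprime with
    | h0 => simp
    | @h1 x hx =>
      intro _
      refine ⟨{1}, ?_, fun z hz => ⟨1, by simp, ?_⟩⟩
      · have hn : Zsqrtd.norm x = 1 := by
          have := Zsqrtd.norm_eq_one_iff.2 hx
          have h0 := GaussianInt.norm_nonneg x
          lia
        rw [hn]
        simpa using one_le_pow₀ hc1
      · exact associated_one_iff_isUnit.2 (isUnit_of_dvd_unit hz hx)
    | @hpr p k hp =>
      intro _
      refine ⟨(Finset.range (k + 1)).image (p ^ ·), ?_, fun z hz => ?_⟩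
      · have hq := gaussianInt_two_le_norm hp
        set q : ℝ := ((Zsqrtd.norm p : ℤ) : ℝ) with hqdef
        have hnorm : ((Zsqrtd.norm (p ^ k) : ℤ) : ℝ) = q ^ k := by
          have : Zsqrtd.norm (p ^ k) = Zsqrtd.norm p ^ k := map_pow Zsqrtd.normMonoidHom p k
          rw [this]; push_cast; rfl
        have hpow : (q ^ k : ℝ) ^ e = q ^ (k * e) := by
          rw [← Real.rpow_natCast, ← Real.rpow_mul (by linarith)]
        have hcard : ((((Finset.range (k + 1)).image (p ^ ·)).card : ℕ) : ℝ) ≤ k + 1 := by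
          have := Finset.card_image_le (s := Finset.range (k + 1)) (f := (p ^ ·))
          rw [Finset.card_range] at this
          exact_mod_cast this
        refine hcard.trans ?_
        rw [hnorm, hpow]
        rcases Nat.eq_zero_or_pos k with rfl | hk
        · simpa using one_le_pow₀ hc1
        by_cases hqB : q ≤ B
        · have hmem : p ∈ S.filter (· ∣ p ^ k) := by
            simp only [hS, Finset.mem_filter, Set.Finite.mem_toFinset, Set.mem_ofPred_eq]
            exact ⟨⟨hqB, hp⟩, dvd_pow_self p hk.ne'⟩
          have h1 : c ≤ c ^ (S.filter (· ∣ p ^ k)).card :=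
            le_self_pow₀ hc1 (Finset.card_ne_zero_of_mem hmem)
          calc (k + 1 : ℝ) ≤ c * 2 ^ (k * e) := hck k
            _ ≤ _ := by gcongr
        · have h2 : (2 : ℝ) ≤ q ^ e := by
            have h3 : B ^ e = 2 := by
              rw [hB, ← Real.rpow_mul two_pos.le, one_div_mul_cancel he.ne', Real.rpow_one]
            rw [← h3]
            gcongr
            exact (not_le.1 hqB).le
          have h4 : (k + 1 : ℝ) ≤ 2 ^ k := by
            exact_mod_cast Nat.lt_two_pow_self (n := k)
          have h5 : (2 : ℝ) ^ k ≤ q ^ (k * e) := by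
            rw [mul_comm, Real.rpow_mul (by linarith), Real.rpow_natCast]
            gcongr
          calc (k + 1 : ℝ) ≤ 1 * q ^ (k * e) := by linarith
            _ ≤ _ := by
              gcongr
              exact one_le_pow₀ hc1
      · obtain ⟨i, hi, hzi⟩ := (dvd_prime_pow hp k).1 hz
        exact ⟨p ^ i, Finset.mem_image_of_mem _ (by simpa using Nat.lt_succ_of_le hi), hzi⟩
    | @hcp x y hxy ihx ihy =>
      intro h0
      obtain ⟨hx0, hy0⟩ := mul_ne_zero_iff.1 h0
      obtain ⟨s, hs, hs'⟩ := ihx hx0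
      obtain ⟨t, ht, ht'⟩ := ihy hy0
      refine ⟨Finset.image₂ (· * ·) s t, ?_, fun z hz => ?_⟩
      · have h1 : ((Finset.image₂ (· * ·) s t).card : ℝ) ≤ s.card * t.card := by
          exact_mod_cast Finset.card_image₂_le _ s t
        have h2 : (S.filter (· ∣ x)).card + (S.filter (· ∣ y)).card ≤
            (S.filter (· ∣ x * y)).card := by
          rw [← Finset.card_union_of_disjoint]
          · refine Finset.card_le_card fun p hp => ?_
            simp only [Finset.mem_union, Finset.mem_filter] at hp ⊢
            rcases hp with hp | hp
            · exact ⟨hp.1, hp.2.mul_right _⟩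
            · exact ⟨hp.1, hp.2.mul_left _⟩
          · rw [Finset.disjoint_left]
            intro p hp hp'
            simp only [Finset.mem_filter, hS] at hp hp'
            exact hp.1.2.not_isUnit (hxy hp.2 hp'.2)
        have hx1 : (0 : ℝ) ≤ (Zsqrtd.norm x : ℤ) := by exact_mod_cast GaussianInt.norm_nonneg x
        have hy1 : (0 : ℝ) ≤ (Zsqrtd.norm y : ℤ) := by exact_mod_cast GaussianInt.norm_nonneg y
        rw [Zsqrtd.norm_mul, Int.cast_mul, Real.mul_rpow hx1 hy1]
        calc _ ≤ (s.card : ℝ) * t.card := h1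
          _ ≤ (c ^ (S.filter (· ∣ x)).card * ((Zsqrtd.norm x : ℤ) : ℝ) ^ e) *
              (c ^ (S.filter (· ∣ y)).card * ((Zsqrtd.norm y : ℤ) : ℝ) ^ e) := by gcongr
          _ = c ^ ((S.filter (· ∣ x)).card + (S.filter (· ∣ y)).card) *
              (((Zsqrtd.norm x : ℤ) : ℝ) ^ e * ((Zsqrtd.norm y : ℤ) : ℝ) ^ e) := by
            rw [pow_add]; ring
          _ ≤ _ := by gcongr
      · obtain ⟨z₁, z₂, h1, h2, rfl⟩ := exists_dvd_and_dvd_of_dvd_mul hz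
        obtain ⟨y₁, hy₁, e1⟩ := hs' z₁ h1
        obtain ⟨y₂, hy₂, e2⟩ := ht' z₂ h2
        exact ⟨y₁ * y₂, Finset.mem_image₂_of_mem hy₁ hy₂, e1.mul_mul e2⟩
  refine ⟨c ^ S.card, by positivity, fun a ha => ?_⟩
  obtain ⟨s, hs, hs'⟩ := key a ha
  refine ⟨s, hs.trans ?_, hs'⟩
  have hx1 : (0 : ℝ) ≤ (Zsqrtd.norm a : ℤ) := by exact_mod_cast GaussianInt.norm_nonneg a
  gcongr
  exact Finset.filter_subset _ _

/-- The number of representations of an integer as a sum of two squares is `O(n^e)`. -/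
lemma card_normSq_eq_le {e : ℝ} (he : 0 < e) :
    ∃ C : ℝ, 0 < C ∧ ∀ (m : ℤ) (F : Finset Freq), (∀ ξ ∈ F, normSq ξ = m) →
      (F.card : ℝ) ≤ C * (1 + |(m : ℝ)|) ^ e := by
  classical
  -- Half the exponent, because the divisor bound is in terms of the norm of `m`, which is `m²`. A
  -- point `ξ` with `|ξ|² = m` gives the divisor `ξ₀ + iξ₁` of `m`, determined up to a unit.
  obtain ⟨C, hC, hdiv⟩ := gaussianInt_divisor_bound (e := e / 2) (by positivity)
  set Un := (finite_gaussianInt_norm_le 1).toFinset with hUn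
  refine ⟨max 1 (C * Un.card), by positivity, fun m F hF => ?_⟩
  have hone : (1 : ℝ) ≤ (1 + |(m : ℝ)|) ^ e :=
    Real.one_le_rpow (by linarith [abs_nonneg (m : ℝ)]) he.le
  by_cases hm : m = 0
  · have : F ⊆ {0} := by
      intro ξ hξ
      have h := hF ξ hξ
      rw [hm, normSq] at h
      rw [Finset.mem_singleton]
      funext i
      fin_cases i <;> simp <;> nlinarith [sq_nonneg (ξ 0), sq_nonneg (ξ 1)]
    have h1 : (F.card : ℝ) ≤ 1 := by exact_mod_cast Finset.card_le_card this
    calc (F.card : ℝ) ≤ 1 * 1 := by linarith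
      _ ≤ _ := by gcongr; exact le_max_left _ _
  · obtain ⟨s, hs, hs'⟩ := hdiv (m : GaussianInt) (by exact_mod_cast hm)
    have hinj : Set.InjOn (fun ξ : Freq => (⟨ξ 0, ξ 1⟩ : GaussianInt)) F := by
      intro ξ _ η _ h
      funext i
      rw [Zsqrtd.ext_iff] at h
      fin_cases i
      · exact h.1
      · exact h.2
    have hsub : F.image (fun ξ : Freq => (⟨ξ 0, ξ 1⟩ : GaussianInt)) ⊆
        Finset.image₂ (· * ·) s Un := by
      intro z hz
      obtain ⟨ξ, hξ, rfl⟩ := Finset.mem_image.1 hz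
      have hnorm : Zsqrtd.norm (⟨ξ 0, ξ 1⟩ : GaussianInt) = m := by
        rw [← hF ξ hξ]; simp [normSq, Zsqrtd.norm]; ring
      have hd : (⟨ξ 0, ξ 1⟩ : GaussianInt) ∣ (m : GaussianInt) := by
        rw [← hnorm, Zsqrtd.norm_eq_mul_conj]
        exact dvd_mul_right _ _
      obtain ⟨y, hy, hzy⟩ := hs' _ hd
      obtain ⟨u, hu⟩ := hzy.symm
      refine Finset.mem_image₂.2 ⟨y, hy, u, ?_, hu⟩
      rw [hUn, Set.Finite.mem_toFinset]
      have := Zsqrtd.norm_eq_one_iff.2 u.isUnit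
      have h0 := GaussianInt.norm_nonneg (u : GaussianInt)
      have h1 : Zsqrtd.norm (u : GaussianInt) ≤ 1 := by lia
      change ((Zsqrtd.norm (u : GaussianInt) : ℤ) : ℝ) ≤ 1
      exact_mod_cast h1
    have hcard : (F.card : ℝ) ≤ s.card * Un.card := by
      rw [← Finset.card_image_of_injOn hinj]
      exact_mod_cast (Finset.card_le_card hsub).trans (Finset.card_image₂_le _ _ _)
    have hnm : (((Zsqrtd.norm (m : GaussianInt) : ℤ) : ℝ)) ^ (e / 2) ≤ (1 + |(m : ℝ)|) ^ e := by
      have h1 : ((Zsqrtd.norm (m : GaussianInt) : ℤ) : ℝ) = |(m : ℝ)| ^ (2 : ℝ) := by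
        rw [Zsqrtd.norm_intCast]
        push_cast
        rw [Real.rpow_two, sq_abs, sq]
      rw [h1, ← Real.rpow_mul (abs_nonneg _)]
      rw [show (2 : ℝ) * (e / 2) = e by ring]
      gcongr
      linarith
    calc (F.card : ℝ) ≤ s.card * Un.card := hcard
      _ ≤ (C * ((Zsqrtd.norm (m : GaussianInt) : ℤ) : ℝ) ^ (e / 2)) * Un.card := by gcongr
      _ = (C * Un.card) * ((Zsqrtd.norm (m : GaussianInt) : ℤ) : ℝ) ^ (e / 2) := by ring
      _ ≤ max 1 (C * Un.card) * (1 + |(m : ℝ)|) ^ e := by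
        have h1 : (0 : ℝ) ≤ (Zsqrtd.norm (m : GaussianInt) : ℤ) := by
          exact_mod_cast GaussianInt.norm_nonneg (m : GaussianInt)
        exact mul_le_mul (le_max_right _ _) hnm (by positivity) (by positivity)

/-- The lattice sum of `(|ξ|² - n)⁻²` away from the circle `|ξ|² = n`. -/
lemma sum_inv_sq_le {e : ℝ} (he : 0 < e) (he1 : e < 1) :
    ∃ C : ℝ, 0 < C ∧ ∀ (n : ℕ) (L : ℝ), 1 ≤ L → ∀ F : Finset Freq,
      (∀ ξ ∈ F, L ≤ |(normSq ξ : ℝ) - n|) →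
      ∑ ξ ∈ F, 1 / ((normSq ξ : ℝ) - n) ^ 2 ≤ C * (1 + (n : ℝ)) ^ e * L ^ (-(1 - e)) := by
  classical
  obtain ⟨C, hC, hr⟩ := card_normSq_eq_le (e := e / 2) (by positivity)
  have hsum : Summable fun j : ℤ => |(j : ℝ)| ^ (-(1 + e / 2)) := by
    have := (Real.summable_one_div_int_add_rpow 0 (1 + e / 2)).2 (by linarith)
    refine this.congr fun j => ?_
    rw [add_zero, Real.rpow_neg (abs_nonneg _), one_div]
  set K := ∑' j : ℤ, |(j : ℝ)| ^ (-(1 + e / 2)) with hK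
  have hK0 : 0 ≤ K := tsum_nonneg fun j => by positivity
  refine ⟨C * 2 ^ (e / 2) * (K + 1), by positivity, fun n L hL F hF => ?_⟩
  have hL0 : 0 < L := by linarith
  rw [Finset.sum_comp (fun m : ℤ => 1 / ((m : ℝ) - n) ^ 2) normSq]
  have hterm : ∀ m ∈ F.image normSq,
      (F.filter fun ξ => normSq ξ = m).card • (1 / ((m : ℝ) - n) ^ 2) ≤
      C * 2 ^ (e / 2) * (1 + (n : ℝ)) ^ e * L ^ (-(1 - e)) *
        |((m - n : ℤ) : ℝ)| ^ (-(1 + e / 2)) := by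
    intro m hm
    obtain ⟨ξ, hξ, rfl⟩ := Finset.mem_image.1 hm
    have hd := hF ξ hξ
    set m := normSq ξ
    have hcast : ((m - n : ℤ) : ℝ) = (m : ℝ) - n := by push_cast; rfl
    rw [hcast]
    set t := |(m : ℝ) - n| with ht
    have ht1 : 1 ≤ t := hL.trans hd
    have ht0 : 0 < t := by linarith
    rw [nsmul_eq_mul, ← sq_abs ((m : ℝ) - n), ← ht]
    have h1 := hr m (F.filter fun η => normSq η = m) fun η hη => (Finset.mem_filter.1 hη).2
    have h2 : 1 + |(m : ℝ)| ≤ (1 + n) * (2 * t) := by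
      have h3 : |(m : ℝ)| ≤ t + n := by
        have := abs_add_le ((m : ℝ) - n) n
        rw [sub_add_cancel, Nat.abs_cast] at this
        exact this
      have hn : (0 : ℝ) ≤ n := Nat.cast_nonneg n
      nlinarith
    have hn1 : (1 : ℝ) ≤ 1 + n := by
      have hn : (0 : ℝ) ≤ n := Nat.cast_nonneg n
      linarith
    have h4 : (1 + |(m : ℝ)|) ^ (e / 2) ≤ (1 + (n : ℝ)) ^ e * (2 ^ (e / 2) * t ^ (e / 2)) := by
      calc _ ≤ ((1 + n) * (2 * t)) ^ (e / 2) := by gcongr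
        _ = (1 + (n : ℝ)) ^ (e / 2) * (2 ^ (e / 2) * t ^ (e / 2)) := by
          rw [Real.mul_rpow (by linarith) (by linarith), Real.mul_rpow two_pos.le ht0.le]
        _ ≤ _ := by
          gcongr
          linarith
    -- The power `t^{e/2 - 2}` is split so that `t^{-(1+e/2)}` remains summable over the integers,
    -- and the rest is at most `L^{-(1-e)}`.
    have h5 : t ^ (e / 2) * (1 / t ^ 2) ≤ L ^ (-(1 - e)) * t ^ (-(1 + e / 2)) := by
      have h6 : t ^ (e / 2) * (1 / t ^ 2) = t ^ (-(1 - e)) * t ^ (-(1 + e / 2)) := by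
        rw [one_div, ← Real.rpow_natCast, ← Real.rpow_neg ht0.le, ← Real.rpow_add ht0,
          ← Real.rpow_add ht0]
        congr 1
        push_cast
        ring
      rw [h6]
      gcongr ?_ * _
      exact Real.rpow_le_rpow_of_nonpos hL0 hd (by linarith)
    calc _ ≤ (C * ((1 + (n : ℝ)) ^ e * (2 ^ (e / 2) * t ^ (e / 2)))) * (1 / t ^ 2) := by
          gcongr
          exact h1.trans (by gcongr)
      _ = C * 2 ^ (e / 2) * (1 + (n : ℝ)) ^ e * (t ^ (e / 2) * (1 / t ^ 2)) := by ring
      _ ≤ C * 2 ^ (e / 2) * (1 + (n : ℝ)) ^ e * (L ^ (-(1 - e)) * t ^ (-(1 + e / 2))) := by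
          gcongr
      _ = _ := by ring
  calc _ ≤ ∑ m ∈ F.image normSq, C * 2 ^ (e / 2) * (1 + (n : ℝ)) ^ e * L ^ (-(1 - e)) *
        |((m - n : ℤ) : ℝ)| ^ (-(1 + e / 2)) := Finset.sum_le_sum hterm
    _ = C * 2 ^ (e / 2) * (1 + (n : ℝ)) ^ e * L ^ (-(1 - e)) *
        ∑ m ∈ F.image normSq, |((m - n : ℤ) : ℝ)| ^ (-(1 + e / 2)) := by rw [Finset.mul_sum]
    _ ≤ C * 2 ^ (e / 2) * (1 + (n : ℝ)) ^ e * L ^ (-(1 - e)) * (K + 1) := by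
      gcongr
      have hs := (Equiv.subRight (n : ℤ)).summable_iff.2 hsum
      have h7 := hs.sum_le_tsum (F.image normSq)
        (fun j _ => Real.rpow_nonneg (abs_nonneg _) _)
      have h8 := (Equiv.subRight (n : ℤ)).tsum_eq fun j : ℤ => |(j : ℝ)| ^ (-(1 + e / 2))
      simp only [Equiv.subRight_apply] at h7 h8
      rw [h8] at h7
      linarith
    _ = _ := by ring

/-- The sums of two squares. -/
def IsNorm (n : ℕ) : Prop := ∃ ξ : Freq, normSq ξ = n

/-- There are at least `X^{1-e}` sums of two squares up to `X`, up to a constant. -/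
lemma card_isNorm_ge {e : ℝ} (he : 0 < e) :
    ∃ c : ℝ, 0 < c ∧ ∀ X : ℝ, 1 ≤ X →
      c * X ^ (1 - e) ≤ (Set.ncard {n : ℕ | IsNorm n ∧ (n : ℝ) ≤ X} : ℝ) := by
  classical
  obtain ⟨C, hC, hr⟩ := card_normSq_eq_le he
  refine ⟨1 / (2 * C * 2 ^ e), by positivity, fun X hX => ?_⟩
  -- The square `[0, M]²` contains at least `X / 2` lattice points, all with `|ξ|² ≤ X`; each value
  -- is taken at most `C (2X)^e` times.
  set M := ⌊√(X / 2)⌋₊ with hM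
  have hfin : {n : ℕ | IsNorm n ∧ (n : ℝ) ≤ X}.Finite :=
    (Set.finite_Iic ⌊X⌋₊).subset fun n hn => Nat.le_floor hn.2
  set B : Finset Freq := Fintype.piFinset fun _ => Finset.Icc (0 : ℤ) M with hB
  have hBcard : B.card = (M + 1) ^ 2 := by
    rw [hB, Fintype.card_piFinset]
    simp
  have hM1 : √(X / 2) < M + 1 := Nat.lt_floor_add_one _
  have hM2 : (M : ℝ) ≤ √(X / 2) := Nat.floor_le (Real.sqrt_nonneg _)
  have hsq : √(X / 2) ^ 2 = X / 2 := Real.sq_sqrt (by linarith)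
  have hmaps : ∀ ξ ∈ B, (normSq ξ).toNat ∈ hfin.toFinset := by
    intro ξ hξ
    rw [hB, Fintype.mem_piFinset] at hξ
    have h0 := hξ 0
    have h1 := hξ 1
    rw [Finset.mem_Icc] at h0 h1
    rw [Set.Finite.mem_toFinset]
    have hc : ((normSq ξ).toNat : ℤ) = normSq ξ := Int.toNat_of_nonneg (normSq_nonneg ξ)
    refine ⟨⟨ξ, hc.symm⟩, ?_⟩
    have h2 : normSq ξ ≤ 2 * (M : ℤ) ^ 2 := by
      unfold normSq
      nlinarith
    have h3 : (((normSq ξ).toNat : ℤ) : ℝ) ≤ 2 * (M : ℝ) ^ 2 := by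
      rw [hc]; exact_mod_cast h2
    have h4 : (M : ℝ) ^ 2 ≤ X / 2 := by
      rw [← hsq]; gcongr
    rw [Int.cast_natCast] at h3
    linarith
  set k := ⌊C * (2 * X) ^ e⌋₊ with hk
  have hfib : ∀ n ∈ hfin.toFinset, (B.filter fun ξ => (normSq ξ).toNat = n).card ≤ k := by
    intro n hn
    rw [Set.Finite.mem_toFinset] at hn
    refine Nat.le_floor ?_
    refine (hr n _ fun ξ hξ => ?_).trans ?_
    · rw [← (Finset.mem_filter.1 hξ).2, Int.toNat_of_nonneg (normSq_nonneg ξ)]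
    · have : |((n : ℤ) : ℝ)| = n := by simp
      rw [this]
      have := hn.2
      gcongr
      linarith
  have hcard := Finset.card_le_mul_card_image_of_maps_to hmaps k hfib
  rw [hBcard] at hcard
  have h1 : ((M : ℝ) + 1) ^ 2 ≤ k * hfin.toFinset.card := by exact_mod_cast hcard
  have hk1 : (k : ℝ) ≤ C * (2 * X) ^ e := Nat.floor_le (by positivity)
  have h2 : X / 2 ≤ ((M : ℝ) + 1) ^ 2 := by
    rw [← hsq]; gcongr
  rw [Set.ncard_eq_toFinset_card _ hfin]
  have h3 : X / 2 ≤ C * (2 * X) ^ e * hfin.toFinset.card :=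
    h2.trans (h1.trans (by gcongr))
  rw [Real.mul_rpow two_pos.le (by linarith)] at h3
  have hX0 : 0 < X := by linarith
  rw [Real.rpow_sub hX0, Real.rpow_one, div_mul_div_comm, one_mul, div_le_iff₀ (by positivity)]
  linarith

/-! ### Solving the quantisation condition by the intermediate value theorem -/

section Quantization

open scoped ComplexOrder

/-- A function with simple poles of the same sign at both ends of an interval takes all values. -/
lemma exists_eq_of_poles {a b : ℝ} (hab : a < b) {p : ℝ → ℝ} (hp : ContinuousOn p (Set.Ioo a b))
    {r r' : ℝ} (hr : 0 < r) (hr' : 0 < r')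
    (ha : Tendsto (fun t => (a - t) * p t) (𝓝[>] a) (𝓝 r))
    (hb : Tendsto (fun t => (b - t) * p t) (𝓝[<] b) (𝓝 r')) (τ : ℝ) :
    ∃ t ∈ Set.Ioo a b, p t = τ := by
  -- Here `a - t < 0`, so the positive limit of `(a - t) p t` means `p → -∞`; at the left of `b` it
  -- means `p → +∞`.
  have ha' : ∀ᶠ t in 𝓝[>] a, p t < τ := by
    have h0 : Tendsto (fun t : ℝ => (a - t) * τ) (𝓝[>] a) (𝓝 0) := by
      have : Tendsto (fun t : ℝ => (a - t) * τ) (𝓝 a) (𝓝 ((a - a) * τ)) := by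
        apply Continuous.tendsto; fun_prop
      rw [sub_self, zero_mul] at this
      exact this.mono_left nhdsWithin_le_nhds
    have h1 := (h0.sub ha).eventually (gt_mem_nhds (by linarith : (0 : ℝ) - r < 0))
    filter_upwards [h1, self_mem_nhdsWithin] with t ht hta
    have : 0 < (a - t) * (p t - τ) := by linarith
    have h2 : a - t < 0 := by simpa using hta
    nlinarith
  have hb' : ∀ᶠ t in 𝓝[<] b, τ < p t := by
    have h0 : Tendsto (fun t : ℝ => (b - t) * τ) (𝓝[<] b) (𝓝 0) := by
      have : Tendsto (fun t : ℝ => (b - t) * τ) (𝓝 b) (𝓝 ((b - b) * τ)) := by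
        apply Continuous.tendsto; fun_prop
      rw [sub_self, zero_mul] at this
      exact this.mono_left nhdsWithin_le_nhds
    have h1 := (h0.sub hb).eventually (gt_mem_nhds (by linarith : (0 : ℝ) - r' < 0))
    filter_upwards [h1, self_mem_nhdsWithin] with t ht htb
    have : 0 < (b - t) * (p t - τ) := by linarith
    have h2 : 0 < b - t := by simpa using htb
    nlinarith
  obtain ⟨s, hs, hsI⟩ := (ha'.and (Ioo_mem_nhdsGT hab)).exists
  obtain ⟨t, ht, htI⟩ := (hb'.and (Ioo_mem_nhdsLT hab)).exists
  have hconn : IsPreconnected (Set.Ioo a b) := isPreconnected_Ioo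
  obtain ⟨c, hc, hcτ⟩ := hconn.intermediate_value hsI htI hp ⟨hs.le, ht.le⟩
  exact ⟨c, hc, hcτ⟩

/-- The matrix whose kernel describes the eigenfunctions of a point interaction. -/
def quantMatrix (k : ℝ) (W A : Matrix (Fin 2) (Fin 2) ℂ) : Matrix (Fin 2) (Fin 2) ℂ :=
  A * (1 + W) - (Complex.I * k) • (1 - W)

lemma exists_smul_of_orthogonal {e y : Fin 2 → ℂ} (he : e ≠ 0)
    (h : conj (e 0) * y 0 + conj (e 1) * y 1 = 0) :
    ∃ θ : ℂ, y = θ • ![-conj (e 1), conj (e 0)] := by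
  by_cases h0 : e 0 = 0
  · have h1 : e 1 ≠ 0 := fun h1 => he (by funext i; fin_cases i <;> simpa)
    have h1' : conj (e 1) ≠ 0 := (map_ne_zero _).2 h1
    refine ⟨-y 0 / conj (e 1), ?_⟩
    have hy : y 1 = 0 := by simpa [h0, h1] using h
    funext i
    fin_cases i
    · simp; field_simp
    · simp [h0, hy]
  · have h0' : conj (e 0) ≠ 0 := (map_ne_zero _).2 h0
    refine ⟨y 1 / conj (e 0), ?_⟩
    funext i
    fin_cases i
    · simp only [Fin.zero_eta, Pi.smul_apply, Matrix.cons_val_zero, smul_eq_mul]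
      field_simp
      linear_combination h
    · simp; field_simp

/-- Existence of a zero in the non-degenerate case `det (1 + W) ≠ 0`. -/
lemma exists_kernel_of_det_ne_zero {a b : ℝ} (hab : a < b) {A : ℝ → Matrix (Fin 2) (Fin 2) ℂ}
    (hA : ∀ i j, ContinuousOn (fun t => A t i j) (Set.Ioo a b)) (hH : ∀ t, (A t).IsHermitian)
    {R R' : Matrix (Fin 2) (Fin 2) ℂ} (hR : R.PosDef) (hR' : R'.PosDef)
    (ha : ∀ i j, Tendsto (fun t : ℝ => ((a - t : ℝ) : ℂ) * A t i j) (𝓝[>] a) (𝓝 (R i j)))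
    (hb : ∀ i j, Tendsto (fun t : ℝ => ((b - t : ℝ) : ℂ) * A t i j) (𝓝[<] b) (𝓝 (R' i j)))
    (k : ℝ) {W : Matrix (Fin 2) (Fin 2) ℂ} (hW : W * star W = 1) (hdet : (1 + W).det ≠ 0) :
    ∃ t ∈ Set.Ioo a b, ∃ e : Fin 2 → ℂ, e ≠ 0 ∧ (quantMatrix k W (A t)).mulVec e = 0 := by
  have hW' : star W * W = 1 := mul_eq_one_comm.1 hW
  have hu : IsUnit (1 + W).det := isUnit_iff_ne_zero.2 hdet
  set Q := (1 + W)⁻¹ with hQ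
  have hQ1 : (1 + W) * Q = 1 := Matrix.mul_nonsing_inv _ hu
  have hQ2 : Q * (1 + W) = 1 := Matrix.nonsing_inv_mul _ hu
  -- The Cayley transform of the unitary `W`, hence Hermitian. The condition factors as `(A t - K)
  -- (1 + W)`, so it suffices to make the Hermitian matrix `A t - K` singular.
  set K := (Complex.I * k) • ((1 - W) * Q) with hK
  have hKH : star K = K := by
    have h1 : star Q * (1 + star W) = 1 := by
      have := congr_arg star hQ1
      simpa using this
    have h2 : star Q = W * Q := by
      calc star Q = star Q * ((1 + star W) * W) * Q := by
            have : (1 + star W) * W = 1 + W := by rw [add_mul, one_mul, hW', add_comm]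
            rw [this, mul_assoc, hQ1, mul_one]
        _ = star Q * (1 + star W) * W * Q := by simp only [mul_assoc]
        _ = W * Q := by rw [h1, one_mul]
    have hcomm : W * Q = Q * W := by
      have e1 : Q * (1 + W) * W * Q = W * Q := by rw [hQ2, one_mul]
      have e2 : Q * W * ((1 + W) * Q) = Q * W := by rw [hQ1, mul_one]
      rw [← e1, ← e2]
      noncomm_ring
    have h3 : star ((1 - W) * Q) = -((1 - W) * Q) := by
      rw [star_mul, star_sub, star_one, h2, hcomm]
      have : Q * W * (1 - star W) = Q * W - Q := by
        rw [mul_sub, mul_one, mul_assoc, hW, mul_one]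
      rw [this, sub_mul, one_mul, hcomm]
      abel
    rw [hK, star_smul, h3]
    simp
  set H : ℝ → Matrix (Fin 2) (Fin 2) ℂ := fun t => A t - K with hHdef
  have hHH : ∀ t i j, conj (H t i j) = H t j i := fun t i j => by
    have h1 := (hH t).apply j i
    have h2 : star (K i j) = K j i := by
      conv_rhs => rw [← hKH]
      rfl
    simp only [hHdef, Matrix.sub_apply, map_sub]
    exact congr_arg₂ _ h1 h2
  have hreal : ∀ t i, ((H t i i).re : ℂ) = H t i i := fun t i =>
    Complex.conj_eq_iff_re.1 (hHH t i i)
  have hHc : ∀ i j, ContinuousOn (fun t => H t i j) (Set.Ioo a b) := fun i j => by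
    simp only [hHdef, Matrix.sub_apply]
    exact (hA i j).sub continuousOn_const
  have limit : ∀ {c : ℝ} {s : Set ℝ} {P : Matrix (Fin 2) (Fin 2) ℂ},
      (∀ i j, Tendsto (fun t : ℝ => ((c - t : ℝ) : ℂ) * A t i j) (𝓝[s] c) (𝓝 (P i j))) →
      ∀ i j, Tendsto (fun t : ℝ => ((c - t : ℝ) : ℂ) * H t i j) (𝓝[s] c) (𝓝 (P i j)) := by
    intro c s P h i j
    have h0 : Tendsto (fun t : ℝ => ((c - t : ℝ) : ℂ) * K i j) (𝓝[s] c) (𝓝 0) := by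
      have : Tendsto (fun t : ℝ => ((c - t : ℝ) : ℂ) * K i j) (𝓝 c)
          (𝓝 (((c - c : ℝ) : ℂ) * K i j)) := by
        apply Continuous.tendsto; fun_prop
      rw [sub_self, Complex.ofReal_zero, zero_mul] at this
      exact this.mono_left nhdsWithin_le_nhds
    have := (h i j).sub h0
    simpa only [hHdef, Matrix.sub_apply, mul_sub, sub_zero] using this
  -- No monotonicity or continuity of eigenvalues is needed: where the trace vanishes, a Hermitian
  -- `2 × 2` matrix has determinant `≤ 0`, whereas near `a` it is negative definite with determinant
  -- `> 0`. The determinant vanishes in between.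
  set tr : ℝ → ℝ := fun t => (H t 0 0).re + (H t 1 1).re with htr
  have htrc : ContinuousOn tr (Set.Ioo a b) :=
    (Complex.continuous_re.comp_continuousOn (hHc 0 0)).add
      (Complex.continuous_re.comp_continuousOn (hHc 1 1))
  have htrl : ∀ {c : ℝ} {s : Set ℝ} {P : Matrix (Fin 2) (Fin 2) ℂ},
      (∀ i j, Tendsto (fun t : ℝ => ((c - t : ℝ) : ℂ) * A t i j) (𝓝[s] c) (𝓝 (P i j))) →
      Tendsto (fun t => (c - t) * tr t) (𝓝[s] c) (𝓝 ((P 0 0).re + (P 1 1).re)) := by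
    intro c s P h
    have h1 := (Complex.continuous_re.tendsto _).comp ((limit h 0 0).add (limit h 1 1))
    refine (h1.congr fun t => ?_)
    simp [htr, mul_add]
  have hpos : ∀ {P : Matrix (Fin 2) (Fin 2) ℂ}, P.PosDef → 0 < (P 0 0).re + (P 1 1).re :=
    fun h => add_pos (Complex.pos_iff.1 (h.diag_pos (i := 0))).1
      (Complex.pos_iff.1 (h.diag_pos (i := 1))).1
  obtain ⟨t₀, ht₀, htr0⟩ := exists_eq_of_poles hab htrc (hpos hR) (hpos hR') (htrl ha) (htrl hb) 0
  set D : ℝ → ℝ := fun t => ((H t).det).re with hD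
  have hDc : ContinuousOn D (Set.Ioo a b) := by
    have : ContinuousOn (fun t => (H t).det) (Set.Ioo a b) := by
      simp only [Matrix.det_fin_two]
      exact ((hHc 0 0).mul (hHc 1 1)).sub ((hHc 0 1).mul (hHc 1 0))
    exact Complex.continuous_re.comp_continuousOn this
  have hDreal : ∀ t, (D t : ℂ) = (H t).det := fun t => by
    refine Complex.conj_eq_iff_re.1 ?_
    rw [Matrix.det_fin_two, map_sub, map_mul, map_mul, hHH, hHH, hHH, hHH]
    ring
  have hD0 : D t₀ ≤ 0 := by
    have h1 : (D t₀ : ℂ) = ((H t₀ 0 0).re * (H t₀ 1 1).re - ‖H t₀ 0 1‖ ^ 2 : ℝ) := by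
      rw [hDreal, Matrix.det_fin_two, ← hreal t₀ 0, ← hreal t₀ 1, ← hHH t₀ 0 1, Complex.mul_conj,
        Complex.normSq_eq_norm_sq]
      push_cast
      rfl
    have h2 := Complex.ofReal_injective h1
    have h3 : (H t₀ 1 1).re = -(H t₀ 0 0).re := by simp only [htr] at htr0; linarith
    rw [h2, h3]
    nlinarith [sq_nonneg (H t₀ 0 0).re, sq_nonneg ‖H t₀ 0 1‖]
  have hDa : ∀ᶠ t in 𝓝[>] a, 0 < D t := by
    have h1 : Tendsto (fun t : ℝ => (((a - t : ℝ) : ℂ) ^ 2 * (H t).det).re) (𝓝[>] a)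
        (𝓝 R.det.re) := by
      refine (Complex.continuous_re.tendsto _).comp ?_
      have := ((limit ha 0 0).mul (limit ha 1 1)).sub ((limit ha 0 1).mul (limit ha 1 0))
      rw [← Matrix.det_fin_two] at this
      refine this.congr fun t => ?_
      rw [Matrix.det_fin_two]
      ring
    have h2 := h1.eventually (lt_mem_nhds (Complex.pos_iff.1 hR.det_pos).1)
    filter_upwards [h2] with t ht
    rw [← Complex.ofReal_pow, Complex.re_ofReal_mul] at ht
    exact pos_of_mul_pos_right ht (sq_nonneg _)
  obtain ⟨t₁, ht₁, ht₁I⟩ := (hDa.and (Ioo_mem_nhdsGT hab)).exists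
  obtain ⟨t, htI, ht⟩ := isPreconnected_Ioo.intermediate_value ht₀ ht₁I hDc ⟨hD0, ht₁.le⟩
  refine ⟨t, htI, ?_⟩
  have hfac : quantMatrix k W (A t) = H t * (1 + W) := by
    rw [quantMatrix, hHdef, sub_mul, hK, Matrix.smul_mul, mul_assoc, hQ2, mul_one]
  have hz : (quantMatrix k W (A t)).det = 0 := by
    rw [hfac, Matrix.det_mul, ← hDreal, ht]; simp
  obtain ⟨e, he, he'⟩ := Matrix.exists_mulVec_eq_zero_iff.2 hz
  exact ⟨e, he, he'⟩

/-- The quadratic form of a matrix. -/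
def quadForm (f : Fin 2 → ℂ) (A : Matrix (Fin 2) (Fin 2) ℂ) : ℂ :=
  ∑ i, ∑ j, conj (f i) * A i j * f j

lemma quadForm_eq (f : Fin 2 → ℂ) (A : Matrix (Fin 2) (Fin 2) ℂ) :
    quadForm f A = dotProduct (star f) (A.mulVec f) := by
  simp only [quadForm, dotProduct, Matrix.mulVec, Finset.mul_sum, Pi.star_apply, RCLike.star_def,
    mul_assoc]

/-- Existence of a zero in the degenerate case `det (1 + W) = 0`, `W ≠ -1`. -/
lemma exists_kernel_of_det_eq_zero {a b : ℝ} (hab : a < b) {A : ℝ → Matrix (Fin 2) (Fin 2) ℂ}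
    (hA : ∀ i j, ContinuousOn (fun t => A t i j) (Set.Ioo a b)) (hH : ∀ t, (A t).IsHermitian)
    {R R' : Matrix (Fin 2) (Fin 2) ℂ} (hR : R.PosDef) (hR' : R'.PosDef)
    (ha : ∀ i j, Tendsto (fun t : ℝ => ((a - t : ℝ) : ℂ) * A t i j) (𝓝[>] a) (𝓝 (R i j)))
    (hb : ∀ i j, Tendsto (fun t : ℝ => ((b - t : ℝ) : ℂ) * A t i j) (𝓝[<] b) (𝓝 (R' i j)))
    {k : ℝ} (hk : k ≠ 0) {W : Matrix (Fin 2) (Fin 2) ℂ} (hW : W * star W = 1) (hW1 : W ≠ -1)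
    (hdet : (1 + W).det = 0) :
    ∃ t ∈ Set.Ioo a b, ∃ e : Fin 2 → ℂ, e ≠ 0 ∧ (quantMatrix k W (A t)).mulVec e = 0 := by
  have hW' : star W * W = 1 := mul_eq_one_comm.1 hW
  obtain ⟨e, he, he'⟩ := Matrix.exists_mulVec_eq_zero_iff.2 hdet
  -- A vector orthogonal to the `-1`-eigenvector `e`. Since `W` is unitary it preserves `e^⊥`, so
  -- `f` is an eigenvector, with eigenvalue `θ` of modulus one.
  set f : Fin 2 → ℂ := ![-conj (e 1), conj (e 0)] with hf
  have hf0 : f 0 = -conj (e 1) := rfl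
  have hf1 : f 1 = conj (e 0) := rfl
  have hfne : f ≠ 0 := fun h => he (by
    have h0 := congr_fun h 0
    have h1 := congr_fun h 1
    rw [hf0] at h0
    rw [hf1] at h1
    funext i
    fin_cases i
    · simpa using h1
    · simpa using h0)
  have hWe : W.mulVec e = -e := by
    rw [Matrix.add_mulVec, Matrix.one_mulVec] at he'
    exact eq_neg_of_add_eq_zero_right he'
  have hWe' : (star W).mulVec e = -e := by
    have := congr_arg (star W).mulVec hWe
    rw [Matrix.mulVec_mulVec, hW', Matrix.one_mulVec, Matrix.mulVec_neg] at this
    exact (neg_eq_iff_eq_neg.2 this).symm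
  have horth : conj (e 0) * (W.mulVec f) 0 + conj (e 1) * (W.mulVec f) 1 = 0 := by
    have h0 := congr_arg conj (congr_fun hWe' 0)
    have h1 := congr_arg conj (congr_fun hWe' 1)
    simp only [Matrix.mulVec, dotProduct, Fin.sum_univ_two, Matrix.star_apply, RCLike.star_def,
      map_add, map_mul, Complex.conj_conj, Pi.neg_apply, map_neg] at h0 h1 ⊢
    rw [hf0, hf1]
    linear_combination (-conj (e 1)) * h0 + conj (e 0) * h1
  obtain ⟨θ, hθ⟩ := exists_smul_of_orthogonal he horth
  rw [← hf] at hθ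
  have hWf : (star W).mulVec (θ • f) = f := by
    rw [← hθ, Matrix.mulVec_mulVec, hW', Matrix.one_mulVec]
  have hnf : ‖f 0‖ ^ 2 + ‖f 1‖ ^ 2 ≠ 0 := fun h => hfne (by
    have h0 : ‖f 0‖ ^ 2 = 0 := by nlinarith [sq_nonneg ‖f 0‖, sq_nonneg ‖f 1‖]
    have h1 : ‖f 1‖ ^ 2 = 0 := by nlinarith [sq_nonneg ‖f 0‖, sq_nonneg ‖f 1‖]
    funext i
    fin_cases i
    · simpa using h0
    · simpa using h1)
  have hnorm : ∀ z : ℂ, conj z * z = ((‖z‖ ^ 2 : ℝ) : ℂ) := fun z => by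
    rw [← Complex.normSq_eq_conj_mul_self, Complex.normSq_eq_norm_sq]
  have hθ1 : θ * conj θ = 1 := by
    have h1 : dotProduct (star (W.mulVec f)) (W.mulVec f) = dotProduct (star f) f := by
      rw [Matrix.star_mulVec, ← Matrix.dotProduct_mulVec, Matrix.mulVec_mulVec,
        show W.conjTranspose * W = 1 from hW', Matrix.one_mulVec]
    rw [hθ] at h1
    simp only [dotProduct, Fin.sum_univ_two, Pi.star_apply, Pi.smul_apply, smul_eq_mul,
      RCLike.star_def, map_mul] at h1
    have h2 : (θ * conj θ - 1) * (((‖f 0‖ ^ 2 + ‖f 1‖ ^ 2 : ℝ)) : ℂ) = 0 := by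
      rw [Complex.ofReal_add, ← hnorm, ← hnorm]
      linear_combination h1
    rcases mul_eq_zero.1 h2 with h3 | h3
    · exact sub_eq_zero.1 h3
    · exact absurd (by exact_mod_cast h3) hnf
  -- If `θ` were `-1` as well, `W` would be `-1` on the basis `e, f`.
  have hθ2 : 1 + θ ≠ 0 := fun h => hW1 (by
    have hz : ∀ i, (1 + W) i 0 = 0 ∧ (1 + W) i 1 = 0 := by
      intro i
      have h1 := congr_fun he' i
      have h2 : ((1 + W).mulVec f) i = 0 := by
        rw [Matrix.add_mulVec, Matrix.one_mulVec, hθ, ← one_smul ℂ f, smul_smul, mul_one,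
          ← add_smul, h]
        simp
      simp only [Matrix.mulVec, dotProduct, Fin.sum_univ_two, Pi.zero_apply] at h1 h2
      rw [hf0, hf1] at h2
      have hne : conj (f 0) * f 0 + conj (f 1) * f 1 ≠ 0 := by
        rw [hnorm, hnorm]; exact_mod_cast hnf
      rw [hf0, hf1] at hne
      simp only [map_neg, Complex.conj_conj] at hne
      constructor
      · refine (mul_eq_zero.1 (?_ : (1 + W) i 0 * _ = 0)).resolve_right hne
        linear_combination conj (e 0) * h1 - e 1 * h2
      · refine (mul_eq_zero.1 (?_ : (1 + W) i 1 * _ = 0)).resolve_right hne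
        linear_combination conj (e 1) * h1 + e 0 * h2
    have : 1 + W = 0 := by
      ext i j
      fin_cases j
      · exact (hz i).1
      · exact (hz i).2
    exact eq_neg_of_add_eq_zero_right this)
  have hθ0 : θ ≠ 0 := fun h => by simp [h] at hθ1
  -- The scalar Cayley transform of `θ`, real because `|θ| = 1`. Projected to `f`, the condition
  -- becomes `⟨f, A f⟩ = τ |f|²`, a scalar equation with poles at both ends of the interval.
  set τ : ℂ := Complex.I * k * (1 - θ) / (1 + θ) with hτ
  have hτr : ((τ.re : ℝ) : ℂ) = τ := by
    refine Complex.conj_eq_iff_re.1 ?_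
    have hc : conj θ = θ⁻¹ := eq_inv_of_mul_eq_one_right hθ1
    have h2 : 1 + θ⁻¹ ≠ 0 := by
      intro h
      apply hθ2
      field_simp at h
      linear_combination h
    rw [hτ, map_div₀, map_mul, map_mul, map_sub, map_add, map_one, hc, Complex.conj_I,
      Complex.conj_ofReal, div_eq_div_iff h2 hθ2]
    field_simp
    ring
  set q : ℝ → ℝ := fun t => (quadForm f (A t)).re with hq
  have hqc : ContinuousOn q (Set.Ioo a b) := by
    refine Complex.continuous_re.comp_continuousOn ?_
    unfold quadForm
    refine continuousOn_finsetSum _ fun i _ => continuousOn_finsetSum _ fun j _ => ?_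
    exact (continuousOn_const.mul (hA i j)).mul continuousOn_const
  have hql : ∀ {c : ℝ} {s : Set ℝ} {P : Matrix (Fin 2) (Fin 2) ℂ},
      (∀ i j, Tendsto (fun t : ℝ => ((c - t : ℝ) : ℂ) * A t i j) (𝓝[s] c) (𝓝 (P i j))) →
      Tendsto (fun t => (c - t) * q t) (𝓝[s] c) (𝓝 (quadForm f P).re) := by
    intro c s P h
    have h1 : Tendsto (fun t => ∑ i, ∑ j, conj (f i) * (((c - t : ℝ) : ℂ) * A t i j) * f j)
        (𝓝[s] c) (𝓝 (quadForm f P)) :=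
      tendsto_finsetSum _ fun i _ => tendsto_finsetSum _ fun j _ =>
        ((h i j).const_mul _).mul_const _
    refine ((Complex.continuous_re.tendsto _).comp h1).congr fun t => ?_
    simp only [hq, Function.comp_apply]
    rw [← Complex.re_ofReal_mul, quadForm, Finset.mul_sum]
    simp only [Finset.mul_sum]
    congr 1
    refine Finset.sum_congr rfl fun i _ => Finset.sum_congr rfl fun j _ => ?_
    ring
  have hqpos : ∀ {P : Matrix (Fin 2) (Fin 2) ℂ}, P.PosDef → 0 < (quadForm f P).re := by
    intro P hP
    rw [quadForm_eq]
    exact hP.re_dotProduct_pos hfne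
  obtain ⟨t, htI, ht⟩ := exists_eq_of_poles hab hqc (hqpos hR) (hqpos hR') (hql ha) (hql hb)
    (τ.re * (‖f 0‖ ^ 2 + ‖f 1‖ ^ 2))
  refine ⟨t, htI, ?_⟩
  have hqr : quadForm f (A t) = τ * (conj (f 0) * f 0 + conj (f 1) * f 1) := by
    have h1 : ((quadForm f (A t)).re : ℂ) = quadForm f (A t) := by
      refine Complex.conj_eq_iff_re.1 ?_
      simp only [quadForm, map_sum, map_mul, Complex.conj_conj]
      rw [Finset.sum_comm]
      refine Finset.sum_congr rfl fun i _ => Finset.sum_congr rfl fun j _ => ?_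
      have := (hH t).apply i j
      rw [RCLike.star_def] at this
      rw [this]
      ring
    rw [← h1]
    change ((q t : ℝ) : ℂ) = _
    rw [ht, hnorm, hnorm]
    push_cast
    rw [hτr]
  set M := quantMatrix k W (A t) with hM
  have hMe : M.mulVec e = (-(2 * Complex.I * k)) • e := by
    rw [hM, quantMatrix, Matrix.sub_mulVec, ← Matrix.mulVec_mulVec, he', Matrix.mulVec_zero,
      Matrix.smul_mulVec, Matrix.sub_mulVec, Matrix.one_mulVec, hWe]
    funext i
    simp
    ring
  have hMf : M.mulVec f = (1 + θ) • (A t).mulVec f - (Complex.I * k * (1 - θ)) • f := by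
    rw [hM, quantMatrix, Matrix.sub_mulVec, ← Matrix.mulVec_mulVec, Matrix.add_mulVec,
      Matrix.one_mulVec, hθ, Matrix.smul_mulVec, Matrix.sub_mulVec, Matrix.one_mulVec, hθ]
    have : f + θ • f = (1 + θ) • f := by rw [add_smul, one_smul]
    rw [this, Matrix.mulVec_smul]
    congr 1
    funext i
    simp only [Pi.smul_apply, Pi.sub_apply, smul_eq_mul]
    ring
  -- Once the component along `f` is zero, `M f` is a multiple of `e`; as `M e = -2ik e` with `k ≠
  -- 0`, adding a multiple of `e` to `f` produces a kernel vector.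
  have hfM : conj (f 0) * (M.mulVec f) 0 + conj (f 1) * (M.mulVec f) 1 = 0 := by
    have h1 : conj (f 0) * ((A t).mulVec f) 0 + conj (f 1) * ((A t).mulVec f) 1 =
        τ * (conj (f 0) * f 0 + conj (f 1) * f 1) := by
      rw [← hqr, quadForm_eq]
      simp [dotProduct]
    rw [hMf]
    simp only [Pi.sub_apply, Pi.smul_apply, smul_eq_mul]
    have h2 : (1 + θ) * τ = Complex.I * k * (1 - θ) := by
      rw [hτ]; field_simp
    linear_combination (1 + θ) * h1 + (conj (f 0) * f 0 + conj (f 1) * f 1) * h2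
  obtain ⟨c, hc⟩ := exists_smul_of_orthogonal hfne hfM
  have hce : M.mulVec f = (-c) • e := by
    rw [hc]
    funext i
    fin_cases i <;> simp [hf0, hf1]
  have hk' : (2 * Complex.I * k : ℂ) ≠ 0 := by simp [hk]
  refine ⟨f + (-c / (2 * Complex.I * k)) • e, fun h => ?_, ?_⟩
  · have h0 := congr_fun h 0
    have h1 := congr_fun h 1
    simp only [Pi.add_apply, Pi.smul_apply, smul_eq_mul, Pi.zero_apply] at h0 h1
    have hne : conj (f 0) * f 0 + conj (f 1) * f 1 ≠ 0 := by
      rw [hnorm, hnorm]; exact_mod_cast hnf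
    apply hne
    have e0 : conj (f 0) = -e 1 := by rw [hf0]; simp
    have e1 : conj (f 1) = e 0 := by rw [hf1]; simp
    rw [e0, e1]
    linear_combination (-e 1) * h0 + e 0 * h1
  · rw [Matrix.mulVec_add, Matrix.mulVec_smul, hMe, hce, smul_smul, ← add_smul]
    have : -c + -c / (2 * Complex.I * k) * -(2 * Complex.I * k) = 0 := by
      rw [mul_neg, div_mul_cancel₀ _ hk']
      ring
    rw [this, zero_smul]

lemma exists_kernel {a b : ℝ} (hab : a < b) {A : ℝ → Matrix (Fin 2) (Fin 2) ℂ}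
    (hA : ∀ i j, ContinuousOn (fun t => A t i j) (Set.Ioo a b)) (hH : ∀ t, (A t).IsHermitian)
    {R R' : Matrix (Fin 2) (Fin 2) ℂ} (hR : R.PosDef) (hR' : R'.PosDef)
    (ha : ∀ i j, Tendsto (fun t : ℝ => ((a - t : ℝ) : ℂ) * A t i j) (𝓝[>] a) (𝓝 (R i j)))
    (hb : ∀ i j, Tendsto (fun t : ℝ => ((b - t : ℝ) : ℂ) * A t i j) (𝓝[<] b) (𝓝 (R' i j)))
    {k : ℝ} (hk : k ≠ 0) {W : Matrix (Fin 2) (Fin 2) ℂ} (hW : W * star W = 1) (hW1 : W ≠ -1) :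
    ∃ t ∈ Set.Ioo a b, ∃ e : Fin 2 → ℂ, e ≠ 0 ∧ (quantMatrix k W (A t)).mulVec e = 0 := by
  by_cases h : (1 + W).det = 0
  · exact exists_kernel_of_det_eq_zero hab hA hH hR hR' ha hb hk hW hW1 h
  · exact exists_kernel_of_det_ne_zero hab hA hH hR hR' ha hb k hW h

end Quantization

/-! ### The Herglotz matrix of the two scatterers and its residues -/

section Existence

open scoped ComplexOrder

/-- The regularised resolvent multiplier. -/
def regMult (m t : ℝ) : ℝ := 1 / (m - t) - m / (m ^ 2 + 1)

lemma regMult_eq {m t : ℝ} (h : m ≠ t) : regMult m t = (1 + m * t) / ((m - t) * (m ^ 2 + 1)) := by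
  have h1 : m - t ≠ 0 := sub_ne_zero.2 h
  have h2 : m ^ 2 + 1 ≠ 0 := by positivity
  rw [regMult]
  field_simp
  ring

/-- Subtracting `m / (m² + 1)` leaves `(1 + mt) / ((m - t)(m² + 1))`, of order `m⁻²`. This is
summable over `ℤ²`, unlike `1 / (m - t)`, and is uniform for `t` away from the spectrum. -/
lemma abs_regMult_le {m t B ρ : ℝ} (hm : 0 ≤ m) (hB : 0 ≤ B) (ht : |t| ≤ B) (hρ : 0 < ρ)
    (hmt : ρ ≤ |m - t|) :
    |regMult m t| ≤ 2 * (1 + B) * (1 + (B + 1) / ρ) * (1 / (1 + m) ^ 2) := by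
  have hne : m ≠ t := fun h => by rw [h, sub_self, abs_zero] at hmt; linarith
  have h0 : 0 < |m - t| := hρ.trans_le hmt
  have h1 : |1 + m * t| ≤ (1 + m) * (1 + B) := by
    calc |1 + m * t| ≤ |1| + |m * t| := abs_add_le _ _
      _ = 1 + m * |t| := by rw [abs_one, abs_mul, abs_of_nonneg hm]
      _ ≤ 1 + m * B := by gcongr
      _ ≤ _ := by nlinarith
  have h2 : 1 + m ≤ |m - t| * (1 + (B + 1) / ρ) := by
    have h3 : m ≤ |m - t| + B := by
      have := le_abs_self (m - t)
      have := le_abs_self t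
      linarith
    have h4 : B + 1 ≤ |m - t| * ((B + 1) / ρ) := by
      calc B + 1 = ρ * ((B + 1) / ρ) := by field_simp
        _ ≤ _ := by gcongr
    linarith
  have h5 : (1 + m) ^ 2 ≤ 2 * (m ^ 2 + 1) := by nlinarith [sq_nonneg (m - 1)]
  have h6 : 0 < m ^ 2 + 1 := by positivity
  rw [regMult_eq hne, abs_div, abs_mul, abs_of_pos h6, mul_one_div,
    div_le_div_iff₀ (by positivity) (by positivity)]
  have h7 : 0 ≤ (B + 1) / ρ := by positivity
  calc |1 + m * t| * (1 + m) ^ 2 ≤ ((1 + m) * (1 + B)) * (2 * (m ^ 2 + 1)) := by gcongr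
    _ = (1 + m) * ((1 + B) * (2 * (m ^ 2 + 1))) := by ring
    _ ≤ (|m - t| * (1 + (B + 1) / ρ)) * ((1 + B) * (2 * (m ^ 2 + 1))) := by gcongr
    _ = _ := by ring

/-- The correlation `e^{i⟨ξ, x_l - x_j⟩}` of the two scatterers at the frequency `ξ`. -/
def corr (x : Fin 2 → Torus) (l j : Fin 2) (ξ : Freq) : ℂ :=
  character ξ (x l) * conj (character ξ (x j))

lemma norm_corr (x : Fin 2 → Torus) (l j : Fin 2) (ξ : Freq) : ‖corr x l j ξ‖ = 1 := by
  rw [corr, norm_mul, RCLike.norm_conj, norm_character, norm_character, one_mul]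

lemma conj_corr (x : Fin 2 → Torus) (l j : Fin 2) (ξ : Freq) :
    conj (corr x l j ξ) = corr x j l ξ := by
  rw [corr, corr, map_mul, Complex.conj_conj, mul_comm]

/-- The matrix-valued Herglotz function of the point interaction. -/
def herglotz (x : Fin 2 → Torus) (t : ℝ) : Matrix (Fin 2) (Fin 2) ℂ :=
  Matrix.of fun l j => ∑' ξ : Freq, corr x l j ξ * (regMult (normSq ξ) t : ℂ)

lemma norm_corr_mul (x : Fin 2 → Torus) (l j : Fin 2) (ξ : Freq) (r : ℝ) :
    ‖corr x l j ξ * (r : ℂ)‖ = |r| := by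
  rw [norm_mul, norm_corr, one_mul, Complex.norm_real, Real.norm_eq_abs]

lemma exists_gap {a b : ℝ} (hab : ∀ ξ : Freq, (normSq ξ : ℝ) ∉ Set.Ioo a b) {t₀ : ℝ}
    (ht₀ : t₀ ∈ Set.Ioo a b) : ∃ ρ > 0, ∀ᶠ t in 𝓝 t₀, ∀ ξ : Freq, ρ ≤ |(normSq ξ : ℝ) - t| := by
  obtain ⟨h1, h2⟩ := ht₀
  refine ⟨min ((t₀ - a) / 2) ((b - t₀) / 2), by
    rw [gt_iff_lt, lt_min_iff]; constructor <;> linarith, ?_⟩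
  filter_upwards [Ioo_mem_nhds (show (t₀ + a) / 2 < t₀ by linarith)
    (show t₀ < (t₀ + b) / 2 by linarith)] with t ht ξ
  have h := hab ξ
  simp only [Set.mem_Ioo, not_and_or, not_lt] at h ht
  rcases h with h | h
  · refine (min_le_left _ _).trans ?_
    rw [abs_of_nonpos (by linarith)]; linarith
  · refine (min_le_right _ _).trans ?_
    rw [abs_of_nonneg (by linarith)]; linarith

lemma summable_herglotz {a b : ℝ} (hab : ∀ ξ : Freq, (normSq ξ : ℝ) ∉ Set.Ioo a b) {t : ℝ}
    (ht : t ∈ Set.Ioo a b) (x : Fin 2 → Torus) (l j : Fin 2) :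
    Summable fun ξ : Freq => corr x l j ξ * (regMult (normSq ξ) t : ℂ) := by
  obtain ⟨ρ, hρ, hev⟩ := exists_gap hab ht
  refine Summable.of_norm_bounded (summable_inv_one_add_normSq_sq.mul_left
    (2 * (1 + |t|) * (1 + (|t| + 1) / ρ))) fun ξ => ?_
  rw [norm_corr_mul]
  exact abs_regMult_le (normSq_nonneg' ξ) (abs_nonneg t) le_rfl hρ (hev.self_of_nhds ξ)

lemma continuousOn_herglotz {a b : ℝ} (hab : ∀ ξ : Freq, (normSq ξ : ℝ) ∉ Set.Ioo a b)
    (x : Fin 2 → Torus) (l j : Fin 2) :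
    ContinuousOn (fun t => herglotz x t l j) (Set.Ioo a b) := by
  intro t₀ ht₀
  refine ContinuousAt.continuousWithinAt ?_
  obtain ⟨ρ, hρ, hev⟩ := exists_gap hab ht₀
  simp only [herglotz, Matrix.of_apply]
  refine tendsto_tsum_of_dominated_convergence (summable_inv_one_add_normSq_sq.mul_left
    (2 * (1 + (|t₀| + 1)) * (1 + ((|t₀| + 1) + 1) / ρ))) (fun ξ => ?_) ?_
  · have hne : (normSq ξ : ℝ) - t₀ ≠ 0 := fun h => by
      have := hev.self_of_nhds ξ
      rw [h, abs_zero] at this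
      linarith
    have hc : ContinuousAt (fun t => regMult (normSq ξ) t) t₀ := by
      unfold regMult
      exact (continuousAt_const.div (continuousAt_const.sub continuousAt_id) hne).sub
        continuousAt_const
    exact continuousAt_const.mul (Complex.continuous_ofReal.continuousAt.comp hc)
  · have hB : ∀ᶠ t in 𝓝 t₀, |t| ≤ |t₀| + 1 :=
      (continuous_abs.tendsto t₀).eventually (ge_mem_nhds (by linarith))
    filter_upwards [hev, hB] with t ht hBt ξ
    rw [norm_corr_mul]
    exact abs_regMult_le (normSq_nonneg' ξ) (by positivity) hBt hρ (ht ξ)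

lemma isHermitian_herglotz (x : Fin 2 → Torus) (t : ℝ) : (herglotz x t).IsHermitian := by
  refine Matrix.IsHermitian.ext fun l j => ?_
  simp only [herglotz, Matrix.of_apply, RCLike.star_def]
  rw [Complex.conj_tsum]
  refine tsum_congr fun ξ => ?_
  rw [map_mul, conj_corr, Complex.conj_ofReal]

/-- The residue of the Herglotz function at an eigenvalue `n` of the Laplacian. -/
def residue (x : Fin 2 → Torus) (n : ℕ) : Matrix (Fin 2) (Fin 2) ℂ :=
  Matrix.of fun l j => ∑' ξ : Freq, if normSq ξ = n then corr x l j ξ else 0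

/-- Only frequencies on the circle `|ξ|² = n` have a pole at `n`, so only they survive
multiplication by `n - t`. Within `1/2` of `n` every other `|ξ|²` stays at distance at least `1/2`,
which gives the domination. -/
lemma tendsto_herglotz (x : Fin 2 → Torus) (n : ℕ) (l j : Fin 2) :
    Tendsto (fun t : ℝ => (((n : ℝ) - t : ℝ) : ℂ) * herglotz x t l j) (𝓝[≠] (n : ℝ))
      (𝓝 (residue x n l j)) := by
  simp only [herglotz, residue, Matrix.of_apply, ← tsum_mul_left]
  set B : ℝ := n + 1 with hB
  have hB0 : 0 ≤ B := by positivity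
  set K : ℝ := 2 * (1 + B) * (1 + (B + 1) / (1 / 2)) with hK
  have hnear : ∀ᶠ t in 𝓝[≠] (n : ℝ), |(n : ℝ) - t| ≤ 1 / 2 ∧ t ≠ n := by
    refine Filter.Eventually.and ?_ self_mem_nhdsWithin
    have h1 : Tendsto (fun t : ℝ => |(n : ℝ) - t|) (𝓝 (n : ℝ)) (𝓝 |(n : ℝ) - n|) := by
      apply Continuous.tendsto; fun_prop
    rw [sub_self, abs_zero] at h1
    exact (h1.eventually (ge_mem_nhds (by norm_num))).filter_mono nhdsWithin_le_nhds
  have hlin : Tendsto (fun t : ℝ => (n : ℝ) - t) (𝓝[≠] (n : ℝ)) (𝓝 0) := by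
    have h1 : Tendsto (fun t : ℝ => (n : ℝ) - t) (𝓝 (n : ℝ)) (𝓝 ((n : ℝ) - n)) := by
      apply Continuous.tendsto; fun_prop
    rw [sub_self] at h1
    exact h1.mono_left nhdsWithin_le_nhds
  refine tendsto_tsum_of_dominated_convergence (summable_inv_one_add_normSq_sq.mul_left
    (K + 2 * (1 + n) ^ 2)) (fun ξ => ?_) ?_
  · by_cases h : normSq ξ = n
    · rw [if_pos h]
      have h' : (normSq ξ : ℝ) = n := by rw [h]; simp
      have h1 : Tendsto (fun t : ℝ => (1 : ℝ) - ((n : ℝ) - t) * (n / ((n : ℝ) ^ 2 + 1)))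
          (𝓝[≠] (n : ℝ)) (𝓝 (1 - 0 * (n / ((n : ℝ) ^ 2 + 1)))) :=
        tendsto_const_nhds.sub (hlin.mul_const _)
      rw [zero_mul, sub_zero] at h1
      have h2 : Tendsto (fun t : ℝ => ((((n : ℝ) - t) * regMult (normSq ξ) t : ℝ) : ℂ))
          (𝓝[≠] (n : ℝ)) (𝓝 ((1 : ℝ) : ℂ)) := by
        refine (Complex.continuous_ofReal.tendsto _).comp (h1.congr' ?_)
        filter_upwards [hnear] with t ht
        have : (n : ℝ) - t ≠ 0 := sub_ne_zero.2 ht.2.symm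
        rw [regMult, h', mul_sub, mul_one_div_cancel this]
      have h3 := h2.const_mul (corr x l j ξ)
      rw [Complex.ofReal_one, mul_one] at h3
      refine h3.congr fun t => ?_
      push_cast
      ring
    · rw [if_neg h]
      have hne : (normSq ξ : ℝ) - n ≠ 0 := fun h0 => h (by
        have := sub_eq_zero.1 h0
        exact_mod_cast this)
      have hc : ContinuousAt (fun t => regMult (normSq ξ) t) (n : ℝ) := by
        unfold regMult
        exact (continuousAt_const.div (continuousAt_const.sub continuousAt_id) hne).sub
          continuousAt_const
      have h1 := hlin.mul (hc.tendsto.mono_left (nhdsWithin_le_nhds (s := {(n : ℝ)}ᶜ)))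
      rw [zero_mul] at h1
      have h2 := ((Complex.continuous_ofReal.tendsto _).comp h1).const_mul (corr x l j ξ)
      rw [Complex.ofReal_zero, mul_zero] at h2
      refine h2.congr fun t => ?_
      simp only [Function.comp_apply]
      push_cast
      ring
  · filter_upwards [hnear] with t ht ξ
    have hn0 : (0 : ℝ) ≤ n := Nat.cast_nonneg n
    rw [norm_mul, norm_corr_mul, Complex.norm_real, Real.norm_eq_abs]
    have hm0 := normSq_nonneg' ξ
    by_cases h : normSq ξ = n
    · have h' : (normSq ξ : ℝ) = n := by rw [h]; simp
      have hne : (n : ℝ) - t ≠ 0 := sub_ne_zero.2 ht.2.symm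
      rw [← abs_mul, regMult, h', mul_sub, mul_one_div_cancel hne]
      have h1 : |(n : ℝ) / ((n : ℝ) ^ 2 + 1)| ≤ 1 := by
        rw [abs_of_nonneg (by positivity), div_le_one (by positivity)]
        nlinarith [sq_nonneg ((n : ℝ) - 1)]
      have h2 : |1 - ((n : ℝ) - t) * (n / ((n : ℝ) ^ 2 + 1))| ≤ 2 := by
        calc _ ≤ |(1 : ℝ)| + |((n : ℝ) - t) * (n / ((n : ℝ) ^ 2 + 1))| := abs_sub _ _
          _ ≤ 1 + 1 / 2 * 1 := by
            rw [abs_one, abs_mul]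
            gcongr
            exact ht.1
          _ ≤ 2 := by norm_num
      refine h2.trans ?_
      have hK0 : 0 ≤ K := by positivity
      rw [mul_one_div, le_div_iff₀ (by positivity)]
      nlinarith
    · have h3 : (1 : ℝ) ≤ |(normSq ξ : ℝ) - n| := by
        have : 1 ≤ |normSq ξ - n| := Int.one_le_abs (sub_ne_zero.2 h)
        exact_mod_cast this
      have h4 : (1 / 2 : ℝ) ≤ |(normSq ξ : ℝ) - t| := by
        have := abs_sub_le (normSq ξ : ℝ) t n
        rw [abs_sub_comm t] at this
        linarith [ht.1]
      have h5 : |t| ≤ B := by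
        have := abs_sub_abs_le_abs_sub t n
        rw [abs_sub_comm t, abs_of_nonneg hn0] at this
        linarith [ht.1]
      have h6 := abs_regMult_le hm0 hB0 h5 (by norm_num : (0 : ℝ) < 1 / 2) h4
      calc _ ≤ 1 * (K * (1 / (1 + (normSq ξ : ℝ)) ^ 2)) := by
            gcongr
            exact ht.1.trans (by norm_num)
        _ ≤ _ := by
          rw [one_mul]
          gcongr
          have : (0 : ℝ) ≤ 2 * (1 + n) ^ 2 := by positivity
          linarith

/-- The circle `|ξ|² = n` sees that the two scatterers are in generic position. -/
def SeparatesScatterers (y : Torus) (n : ℕ) : Prop :=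
  ∃ ξ ξ' : Freq, normSq ξ = n ∧ normSq ξ' = n ∧ character ξ y ≠ character ξ' y

/-- The quadratic form is a sum of squares over the circle. If it vanishes at `z`, then `z 0` is
minus `z 1` times the conjugate phase of every `ξ` on the circle, and two distinct phases force `z =
0`. -/
lemma posDef_residue {x : Fin 2 → Torus} {n : ℕ} (h : SeparatesScatterers (x 1 - x 0) n) :
    (residue x n).PosDef := by
  classical
  have hfin : {ξ : Freq | normSq ξ = n}.Finite :=
    (finite_normSq_le n).subset fun ξ (hξ : normSq ξ = n) => by
      change (normSq ξ : ℝ) ≤ n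
      rw [hξ]; simp
  set F := hfin.toFinset with hF
  have hmem : ∀ ξ, ξ ∈ F ↔ normSq ξ = n := fun ξ => by rw [hF, Set.Finite.mem_toFinset]; rfl
  have hres : ∀ l j, residue x n l j = ∑ ξ ∈ F, corr x l j ξ := by
    intro l j
    rw [residue, Matrix.of_apply, tsum_eq_sum (s := F) fun ξ hξ => if_neg (mt (hmem ξ).2 hξ)]
    exact Finset.sum_congr rfl fun ξ hξ => if_pos ((hmem ξ).1 hξ)
  refine Matrix.PosDef.of_dotProduct_mulVec_pos ?_ fun z hz => ?_
  · refine Matrix.IsHermitian.ext fun l j => ?_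
    rw [hres, hres, RCLike.star_def, map_sum]
    exact Finset.sum_congr rfl fun ξ _ => conj_corr x j l ξ
  · have hform : dotProduct (star z) ((residue x n).mulVec z) =
        ((∑ ξ ∈ F, ‖∑ j, conj (character ξ (x j)) * z j‖ ^ 2 : ℝ) : ℂ) := by
      push_cast
      simp only [Fin.sum_univ_two, dotProduct, Matrix.mulVec, Pi.star_apply, RCLike.star_def,
        hres, Finset.sum_mul, Finset.mul_sum, ← Finset.sum_add_distrib]
      refine Finset.sum_congr rfl fun ξ _ => ?_
      rw [← Complex.ofReal_pow, ← Complex.normSq_eq_norm_sq, Complex.normSq_eq_conj_mul_self]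
      simp only [corr, map_add, map_mul, Complex.conj_conj]
      ring
    rw [hform, Complex.pos_iff]
    refine ⟨?_, (Complex.ofReal_im _).symm⟩
    rw [Complex.ofReal_re]
    have hnn : ∀ ξ ∈ F, 0 ≤ ‖∑ j, conj (character ξ (x j)) * z j‖ ^ 2 := fun ξ _ => sq_nonneg _
    refine lt_of_le_of_ne (Finset.sum_nonneg hnn) fun h0 => hz ?_
    rw [eq_comm, Finset.sum_eq_zero_iff_of_nonneg hnn] at h0
    have hrel : ∀ ξ ∈ F, z 0 = -(conj (character ξ (x 1 - x 0)) * z 1) := fun ξ hξ => by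
      have h1 := h0 ξ hξ
      rw [pow_eq_zero_iff two_ne_zero, norm_eq_zero, Fin.sum_univ_two] at h1
      rw [character_map_sub, map_mul, Complex.conj_conj]
      linear_combination character ξ (x 0) * h1 - z 0 * character_conj_mul ξ (x 0)
    obtain ⟨ξ, ξ', h1, h2, hne⟩ := h
    have e1 := hrel ξ ((hmem ξ).2 h1)
    have e2 := hrel ξ' ((hmem ξ').2 h2)
    have h3 : (conj (character ξ (x 1 - x 0)) - conj (character ξ' (x 1 - x 0))) * z 1 = 0 := by
      linear_combination e1 - e2
    have hz1 : z 1 = 0 := by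
      refine (mul_eq_zero.1 h3).resolve_left fun h4 => hne ?_
      exact (starRingEnd ℂ).injective (sub_eq_zero.1 h4)
    have hz0 : z 0 = 0 := by rw [e1, hz1]; simp
    funext i
    fin_cases i
    · exact hz0
    · exact hz1

lemma det_T_ne_zero {x : Fin 2 → Torus} (hx : x 0 ≠ x 1) : (T x).det ≠ 0 := by
  obtain ⟨hp, hm⟩ := c₁_add_sub_pos hx
  have h1 : 0 < c₁ x := by linarith
  have hD : 0 < c₁ x ^ 2 - c₂ x ^ 2 := by nlinarith
  rw [T, Matrix.det_fin_two_of, zero_mul, sub_zero, ← Complex.ofReal_mul]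
  have : (0 : ℝ) < 1 / √(c₁ x) * √(c₁ x / (c₁ x ^ 2 - c₂ x ^ 2)) := by positivity
  exact_mod_cast this.ne'

lemma T_conjTranspose (x : Fin 2 → Torus) : (T x).conjTranspose = (T x).transpose := by
  ext i j
  rw [Matrix.conjTranspose_apply, Matrix.transpose_apply, RCLike.star_def, conj_T]

/-- The quantisation condition has a solution between two consecutive generic eigenvalues. -/
lemma exists_quantisation {x : Fin 2 → Torus} (hx : x 0 ≠ x 1) {n n' : ℕ} (hnn : n < n')
    (hgap : ∀ ξ : Freq, (normSq ξ : ℝ) ∉ Set.Ioo (n : ℝ) n')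
    (hn : SeparatesScatterers (x 1 - x 0) n) (hn' : SeparatesScatterers (x 1 - x 0) n')
    {W : Matrix (Fin 2) (Fin 2) ℂ} (hW : W * star W = 1) (hW1 : W ≠ -1) :
    ∃ t ∈ Set.Ioo (n : ℝ) n', ∃ e : Fin 2 → ℂ, e ≠ 0 ∧
      (quantMatrix (4 * Real.pi ^ 2) W (T x * herglotz x t * (T x).transpose)).mulVec e = 0 := by
  have hent : ∀ (S : Matrix (Fin 2) (Fin 2) ℂ) i j, (T x * S * (T x).transpose) i j =
      ∑ k, ∑ l, T x i l * S l k * T x j k := by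
    intro S i j
    simp only [Matrix.mul_apply, Matrix.transpose_apply, Finset.sum_mul]
  have hinj : Function.Injective (T x).vecMul := by
    refine Matrix.vecMul_injective_of_isUnit ?_
    rw [Matrix.isUnit_iff_isUnit_det]
    exact isUnit_iff_ne_zero.2 (det_T_ne_zero hx)
  have hpos : ∀ {m : ℕ}, SeparatesScatterers (x 1 - x 0) m →
      (T x * residue x m * (T x).transpose).PosDef := fun h => by
    rw [← T_conjTranspose]
    exact (posDef_residue h).mul_mul_conjTranspose_same hinj
  have hlim : ∀ (m : ℕ) i j, Tendsto (fun t : ℝ => (((m : ℝ) - t : ℝ) : ℂ) *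
      (T x * herglotz x t * (T x).transpose) i j) (𝓝[≠] (m : ℝ))
      (𝓝 ((T x * residue x m * (T x).transpose) i j)) := by
    intro m i j
    simp only [hent, Finset.mul_sum]
    refine tendsto_finsetSum _ fun k _ => tendsto_finsetSum _ fun l _ => ?_
    refine (((tendsto_herglotz x m l k).const_mul (T x i l)).mul_const (T x j k)).congr fun t => ?_
    ring
  refine exists_kernel (by exact_mod_cast hnn) (fun i j => ?_) (fun t => ?_) (hpos hn) (hpos hn')
    (fun i j => (hlim n i j).mono_left (nhdsWithin_mono _ fun t ht => ne_of_gt ht))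
    (fun i j => (hlim n' i j).mono_left (nhdsWithin_mono _ fun t ht => ne_of_lt ht))
    (by positivity) hW hW1
  · simp only [hent]
    refine continuousOn_finsetSum _ fun k _ => continuousOn_finsetSum _ fun l _ => ?_
    exact (continuousOn_const.mul (continuousOn_herglotz hgap x l k)).mul continuousOn_const
  · rw [← T_conjTranspose]
    exact Matrix.isHermitian_mul_mul_conjTranspose _ (isHermitian_herglotz x t)

/-- Synthesis of a continuous function from summable Fourier coefficients. -/
lemma exists_fourierCoef_eq {w : Freq → ℂ} (hw : Summable fun ξ => ‖w ξ‖) :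
    ∃ f : C(Torus, ℂ), (∀ ξ, fourierCoef f ξ = w ξ) ∧
      ∀ y, HasSum (fun ξ => w ξ * character ξ y) (f y) := by
  have hs : Summable fun ξ => w ξ • character ξ := by
    refine Summable.of_norm ?_
    simpa only [norm_smul, norm_character_eq_one, mul_one] using hw
  obtain ⟨f, hf⟩ := hs
  refine ⟨f, fun ξ => ?_, fun y => ?_⟩
  · have h1 : HasSum (fun η => toL2 (w η • character η)) (toL2 f) :=
      (ContinuousMap.toLp (E := ℂ) 2 (volume : Measure Torus) ℂ).hasSum hf
    have h2 : HasSum (fun η => inner ℂ (unitCharacter ξ) (toL2 (w η • character η)))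
        (inner ℂ (unitCharacter ξ) (toL2 f)) := (innerSL ℂ (unitCharacter ξ)).hasSum h1
    have h3 : ∀ η, inner ℂ (unitCharacter ξ) (toL2 (w η • character η)) =
        (if η = ξ then (2 * Real.pi : ℝ) * w ξ else 0 : ℂ) := fun η => by
      change hat (toL2 (w η • character η)) ξ = _
      rw [hat_toL2, fourierCoef_eq_coef, ContinuousMap.coe_smul, coef_smul, coef_character]
      simp only [eq_comm (a := ξ)]
      split_ifs with h
      · rw [h, mul_one]
      · simp
    simp only [h3] at h2
    have h4 := h2.unique (hasSum_ite_eq ξ _)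
    change hat (toL2 f) ξ = _ at h4
    rw [hat_toL2] at h4
    refine mul_left_cancel₀ ?_ h4
    exact_mod_cast Real.two_pi_pos.ne'
  · simpa using! (ContinuousMap.evalCLM ℂ y).hasSum hf

/-- The left side is what remains of the eigenfunction with strengths `a + b` after its singular
parts at `i` and `-i` are removed. The right side shows the decay that puts this remainder in `H²`,
and splits its values at the scatterers into a Herglotz and a Gram term. -/
lemma multiplier_identity {m t : ℝ} (h : m ≠ t) (a b : ℂ) :
    (a + b) / ((m : ℂ) - t) - a / (m - Complex.I) - b / (m - -Complex.I) =
      (a + b) * (regMult m t : ℂ) - Complex.I * (a - b) * ((1 / (m ^ 2 + 1) : ℝ) : ℂ) := by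
  have h1 : (m : ℂ) - t ≠ 0 := by exact_mod_cast sub_ne_zero.2 h
  have h2 : (m : ℂ) - Complex.I ≠ 0 := fun h => by simpa using congr_arg Complex.im h
  have h3 : (m : ℂ) - -Complex.I ≠ 0 := fun h => by simpa using congr_arg Complex.im h
  have h4 : (m : ℂ) ^ 2 + 1 = (m - Complex.I) * (m - -Complex.I) := by
    linear_combination Complex.I_sq
  rw [regMult]
  push_cast
  rw [h4]
  field_simp
  ring

end Existence

/-! ### Existence of perturbed eigenvalues between separating circles -/

lemma hasSum_gram (x : Fin 2 → Torus) (l j : Fin 2) :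
    HasSum (fun ξ : Freq => corr x l j ξ * ((1 / ((normSq ξ : ℝ) ^ 2 + 1) : ℝ) : ℂ))
      ((4 * Real.pi ^ 2 : ℝ) * ((if l = j then c₁ x else c₂ x : ℝ) : ℂ)) := by
  have h := (inner_green_eq Complex.I (x l) (x j)).mul_left ((4 * Real.pi ^ 2 : ℝ) : ℂ)
  rw [inner_green] at h
  refine h.congr_fun fun ξ => ?_
  rw [norm_sub_I_sq, corr]
  have hk : (Real.pi : ℂ) ≠ 0 := by exact_mod_cast Real.pi_ne_zero
  have h1 : ((normSq ξ : ℂ) ^ 2 + 1) ≠ 0 := by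
    have : (normSq ξ : ℝ) ^ 2 + 1 ≠ 0 := by positivity
    exact_mod_cast this
  push_cast
  field_simp
  norm_num

lemma delta_independent {x : Fin 2 → Torus} (hx : x 0 ≠ x 1) {d : Fin 2 → ℂ}
    (h : ∀ ξ, ∑ j, d j * conj (character ξ (x j)) = 0) : d = 0 := by
  simp only [Fin.sum_univ_two] at h
  have h0 : d 0 + d 1 = 0 := by simpa [character_zero] using h 0
  have h1 : d 0 = 0 := by
    by_contra hd
    refine hx (eq_of_character_eq fun ξ => (starRingEnd ℂ).injective ?_)
    have h2 : d 0 * (conj (character ξ (x 0)) - conj (character ξ (x 1))) = 0 := by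
      linear_combination h ξ - conj (character ξ (x 1)) * h0
    exact sub_eq_zero.1 ((mul_eq_zero.1 h2).resolve_left hd)
  have h2 : d 1 = 0 := by rw [h1, zero_add] at h0; exact h0
  funext i
  fin_cases i
  · exact h1
  · exact h2

/-- With `a = e T` and `b = e U T`, the regular part of the candidate vanishes at the scatterers iff
`S (a + b) = 4π² i P (a - b)`, where `S` is the Herglotz matrix and `P` the Gram matrix. As `T P Tᵗ
= 1`, multiplying by `T` turns this into the kernel equation solved by `exists_quantisation`. -/
lemma exists_perturbedEigenfunction {x : Fin 2 → Torus} (hx : x 0 ≠ x 1)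
    {U : Matrix.unitaryGroup (Fin 2) ℂ} (hU : (U : Matrix (Fin 2) (Fin 2) ℂ) ≠ -1) {n n' : ℕ}
    (hnn : n < n') (hgap : ∀ ξ : Freq, (normSq ξ : ℝ) ∉ Set.Ioo (n : ℝ) n')
    (hn : SeparatesScatterers (x 1 - x 0) n) (hn' : SeparatesScatterers (x 1 - x 0) n') :
    ∃ t ∈ Set.Ioo (n : ℝ) n', ∃ g, IsPerturbedEigenfunction x U t g := by
  set V : Matrix (Fin 2) (Fin 2) ℂ := (U : Matrix (Fin 2) (Fin 2) ℂ) with hV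
  -- The domain uses row vectors `v* U T`, the quantisation matrix acts on columns; transposing
  -- exchanges `e U` with `W e`.
  set W := V.transpose with hWdef
  have hVV : star V * V = 1 := Matrix.mem_unitaryGroup_iff'.1 U.2
  have hW : W * star W = 1 := by
    have : star W = (star V).transpose := by
      ext i j; simp [hWdef, Matrix.star_apply]
    rw [this, hWdef, ← Matrix.transpose_mul, hVV, Matrix.transpose_one]
  have hW1 : W ≠ -1 := fun h => hU (by
    have := congr_arg Matrix.transpose h
    rwa [hWdef, Matrix.transpose_transpose, Matrix.transpose_neg, Matrix.transpose_one] at this)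
  obtain ⟨t, ht, e, he, hker⟩ := exists_quantisation hx hnn hgap hn hn' hW hW1
  refine ⟨t, ht, ?_⟩
  have hne : ∀ ξ : Freq, (normSq ξ : ℝ) ≠ t := fun ξ h => hgap ξ (h ▸ ht)
  set v := star e with hv
  have hsv : star v = e := star_star e
  set a := Matrix.vecMul e (T x) with ha
  set b := Matrix.vecMul e (V * T x) with hb
  set S := herglotz x t with hS
  set P : Matrix (Fin 2) (Fin 2) ℂ :=
    Matrix.of fun l j => ((if l = j then c₁ x else c₂ x : ℝ) : ℂ) with hP
  have hTPT : T x * P * (T x).transpose = 1 := by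
    ext k k'
    have h := T_gram hx k k'
    rw [Matrix.one_apply, ← h]
    simp only [Matrix.mul_apply, Matrix.transpose_apply, hP, Matrix.of_apply, Finset.sum_mul]
    rw [Finset.sum_comm]
    exact Finset.sum_congr rfl fun i _ => Finset.sum_congr rfl fun j _ => by ring
  have ha' : a = (T x).transpose.mulVec e := by rw [ha, Matrix.mulVec_transpose]
  have hb' : b = (T x).transpose.mulVec (W.mulVec e) := by
    rw [hb, Matrix.mulVec_mulVec, hWdef, ← Matrix.transpose_mul, Matrix.mulVec_transpose]
  have hTinj : Function.Injective (T x).mulVec := by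
    refine Matrix.mulVec_injective_of_isUnit ?_
    rw [Matrix.isUnit_iff_isUnit_det]
    exact isUnit_iff_ne_zero.2 (det_T_ne_zero hx)
  have hTtinj : Function.Injective (T x).transpose.mulVec := by
    refine Matrix.mulVec_injective_of_isUnit ?_
    rw [Matrix.isUnit_iff_isUnit_det, Matrix.det_transpose]
    exact isUnit_iff_ne_zero.2 (det_T_ne_zero hx)
  set k : ℝ := 4 * Real.pi ^ 2 with hk
  have hkpos : 0 < k := by positivity
  have hker' : (T x).mulVec (S.mulVec (a + b)) = (Complex.I * k) • (e - W.mulVec e) := by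
    have h1 := hker
    rw [quantMatrix, Matrix.sub_mulVec, sub_eq_zero] at h1
    rw [Matrix.smul_mulVec, Matrix.sub_mulVec, Matrix.one_mulVec] at h1
    rw [← h1, ha', hb', ← Matrix.mulVec_add]
    rw [← Matrix.mulVec_mulVec, ← Matrix.mulVec_mulVec, ← Matrix.mulVec_mulVec, Matrix.add_mulVec,
      Matrix.one_mulVec]
  have hquant : S.mulVec (a + b) = (Complex.I * k) • P.mulVec (a - b) := by
    apply hTinj
    rw [hker', Matrix.mulVec_smul, ha', hb', ← Matrix.mulVec_sub, Matrix.mulVec_mulVec,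
      Matrix.mulVec_mulVec, hTPT, Matrix.one_mulVec]
  obtain ⟨ρ, hρ, hev⟩ := exists_gap hgap ht
  have hρ' := hev.self_of_nhds
  set K : ℝ := 2 * (1 + |t|) * (1 + (|t| + 1) / ρ) with hK
  have hreg : ∀ ξ : Freq, |regMult (normSq ξ) t| ≤ K * (1 / (1 + (normSq ξ : ℝ)) ^ 2) := fun ξ =>
    abs_regMult_le (normSq_nonneg' ξ) (abs_nonneg t) le_rfl hρ (hρ' ξ)
  have hmult : ∀ ξ : Freq, 1 / ((normSq ξ : ℝ) ^ 2 + 1) ≤ 2 * (1 / (1 + (normSq ξ : ℝ)) ^ 2) :=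
    fun ξ => by
      have h0 := normSq_nonneg' ξ
      rw [mul_one_div, div_le_div_iff₀ (by positivity) (by positivity)]
      nlinarith [sq_nonneg ((normSq ξ : ℝ) - 1)]
  set w : Freq → ℂ := fun ξ => -(1 / k : ℝ) * ∑ j, conj (character ξ (x j)) *
    ((a j + b j) * (regMult (normSq ξ) t : ℂ) -
      Complex.I * (a j - b j) * ((1 / ((normSq ξ : ℝ) ^ 2 + 1) : ℝ) : ℂ)) with hw
  set K' : ℝ := 1 / k * ∑ j, (‖a j + b j‖ * K + ‖a j - b j‖ * 2) with hK'
  have hwb : ∀ ξ, ‖w ξ‖ ≤ K' * (1 / (1 + (normSq ξ : ℝ)) ^ 2) := by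
    intro ξ
    simp only [hw, hK']
    rw [norm_mul, norm_neg, Complex.norm_real, Real.norm_of_nonneg (by positivity), mul_assoc,
      Finset.sum_mul]
    gcongr
    refine (norm_sum_le _ _).trans (Finset.sum_le_sum fun j _ => ?_)
    rw [norm_mul, RCLike.norm_conj, norm_character, one_mul]
    refine (norm_sub_le _ _).trans ?_
    rw [norm_mul, norm_mul, norm_mul, Complex.norm_I, one_mul, Complex.norm_real,
      Complex.norm_real, Real.norm_eq_abs, Real.norm_of_nonneg (by positivity)]
    calc _ ≤ ‖a j + b j‖ * (K * (1 / (1 + (normSq ξ : ℝ)) ^ 2)) +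
          ‖a j - b j‖ * (2 * (1 / (1 + (normSq ξ : ℝ)) ^ 2)) :=
          add_le_add (mul_le_mul_of_nonneg_left (hreg ξ) (norm_nonneg _))
            (mul_le_mul_of_nonneg_left (hmult ξ) (norm_nonneg _))
      _ = _ := by ring
  have hws : Summable fun ξ => ‖w ξ‖ :=
    Summable.of_nonneg_of_le (fun ξ => norm_nonneg _) hwb
      (summable_inv_one_add_normSq_sq.mul_left K')
  obtain ⟨f, hfc, hfx⟩ := exists_fourierCoef_eq hws
  have hH2 : MemH2 f := by
    refine Summable.of_nonneg_of_le (fun ξ => by positivity) (fun ξ => ?_)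
      (summable_inv_one_add_normSq_sq.mul_left (K' ^ 2))
    have h0 := normSq_nonneg' ξ
    rw [hfc]
    calc (1 + (normSq ξ : ℝ)) ^ 2 * ‖w ξ‖ ^ 2
        ≤ (1 + (normSq ξ : ℝ)) ^ 2 * (K' * (1 / (1 + (normSq ξ : ℝ)) ^ 2)) ^ 2 := by
          gcongr
          exact hwb ξ
      _ = K' ^ 2 * (1 / (1 + (normSq ξ : ℝ)) ^ 2) := by field_simp
  have hf0 : ∀ l, f (x l) = 0 := by
    intro l
    have hSl : ∀ j, HasSum (fun ξ : Freq => corr x l j ξ * (regMult (normSq ξ) t : ℂ)) (S l j) :=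
      fun j => (summable_herglotz hgap ht x l j).hasSum
    have h1 : HasSum (fun ξ => w ξ * character ξ (x l))
        (-(1 / k : ℝ) * ∑ j, ((a j + b j) * S l j -
          Complex.I * (a j - b j) * ((k : ℝ) * P l j))) := by
      have h2 : HasSum (fun ξ => -((1 / k : ℝ) : ℂ) * ∑ j, ((a j + b j) *
          (corr x l j ξ * (regMult (normSq ξ) t : ℂ)) - Complex.I * (a j - b j) *
          (corr x l j ξ * ((1 / ((normSq ξ : ℝ) ^ 2 + 1) : ℝ) : ℂ))))
          (-(1 / k : ℝ) * ∑ j, ((a j + b j) * S l j -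
            Complex.I * (a j - b j) * ((k : ℝ) * P l j))) := by
        refine HasSum.mul_left _ (hasSum_sum fun j _ => ?_)
        exact ((hSl j).mul_left _).sub ((hasSum_gram x l j).mul_left _)
      refine h2.congr_fun fun ξ => ?_
      simp only [hw, corr, Fin.sum_univ_two]
      ring
    rw [(hfx (x l)).unique h1]
    have h3 := congr_fun hquant l
    simp only [Matrix.mulVec, dotProduct, Pi.add_apply, Pi.sub_apply, Pi.smul_apply, smul_eq_mul,
      Fin.sum_univ_two] at h3
    simp only [Fin.sum_univ_two]
    linear_combination (-((1 / k : ℝ) : ℂ)) * h3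
  set g := toL2 f + pairing x (T x) Complex.I v + pairing x (V * T x) (-Complex.I) v with hg
  have hghat : ∀ ξ, hat g ξ =
      -(1 / (2 * Real.pi) : ℝ) * ∑ j, (a j + b j) / ((normSq ξ : ℂ) - t) *
        conj (character ξ (x j)) := by
    intro ξ
    rw [hg, hat_add, hat_add, hat_toL2, hat_pairing, hat_pairing, hsv, hfc]
    simp only [hat_green, hw, Fin.sum_univ_two]
    have hid := fun j => multiplier_identity (hne ξ) (a j) (b j)
    simp only [Complex.ofReal_intCast] at hid
    rw [← hid 0, ← hid 1, hk]
    have hpi : (Real.pi : ℂ) ≠ 0 := by exact_mod_cast Real.pi_ne_zero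
    have h1 : (((2 * Real.pi : ℝ) : ℂ)) * (-((1 / (4 * Real.pi ^ 2) : ℝ) : ℂ)) =
        -((1 / (2 * Real.pi) : ℝ) : ℂ) := by
      push_cast
      field_simp
      norm_num
    rw [← mul_assoc, h1]
    ring
  have hrel : DeltaRel x g ((t : ℂ) • g) (a + b) := by
    intro ξ
    have h1 : (normSq ξ : ℂ) - t ≠ 0 := by
      have := sub_ne_zero.2 (hne ξ)
      exact_mod_cast this
    rw [hat_smul, ← sub_mul, hghat, mul_left_comm, Finset.mul_sum]
    congr 1
    refine Finset.sum_congr rfl fun j _ => ?_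
    rw [Pi.add_apply]
    field_simp
  refine ⟨g, ⟨?_, hrel.mem_adjoint, f, v, hH2, hf0, hg⟩, ?_⟩
  · intro hg0
    have hd : a + b = 0 := by
      refine delta_independent hx fun ξ => ?_
      have h1 := hrel ξ
      rw [hg0, smul_zero, hat_zero, mul_zero, sub_zero] at h1
      have hpi : -((1 / (2 * Real.pi) : ℝ) : ℂ) ≠ 0 := by
        rw [neg_ne_zero]
        exact_mod_cast (one_div_pos.2 Real.two_pi_pos).ne'
      exact (mul_eq_zero.1 h1.symm).resolve_left hpi
    -- If `g = 0`, independence of the deltas gives `a + b = 0`, that is `W e = -e`. The kernel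
    -- equation then reads `0 = 2ik e`, against `e ≠ 0`.
    have h1 : W.mulVec e = -e := by
      rw [ha', hb', ← Matrix.mulVec_add] at hd
      have h2 : e + W.mulVec e = 0 := hTtinj (by rw [hd, Matrix.mulVec_zero])
      exact eq_neg_of_add_eq_zero_right h2
    rw [hd, Matrix.mulVec_zero, Matrix.mulVec_zero, h1, sub_neg_eq_add, ← two_smul ℂ e,
      smul_smul] at hker'
    refine he ((smul_eq_zero.1 hker'.symm).resolve_left ?_)
    have : (k : ℂ) ≠ 0 := by exact_mod_cast hkpos.ne'
    simp [this]
  · rw [isLaplaceEigenvalue_iff]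
    rintro ⟨ξ, hξ⟩
    exact hne ξ hξ

/-! ### Counting exceptional sums of two squares -/

/-- The integers of absolute value at most `B`. -/
def intBox (B : ℝ) : Finset ℤ := Finset.Icc (-⌊B⌋) ⌊B⌋

lemma mem_intBox {B : ℝ} {a : ℤ} : a ∈ intBox B ↔ |(a : ℝ)| ≤ B := by
  rw [intBox, Finset.mem_Icc, abs_le, Int.le_floor, neg_le, Int.le_floor, Int.cast_neg, neg_le]

lemma card_intBox_le {B : ℝ} (hB : 0 ≤ B) : ((intBox B).card : ℝ) ≤ 2 * B + 1 := by
  have h0 : 0 ≤ ⌊B⌋ := Int.floor_nonneg.2 hB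
  have h1 : ((intBox B).card : ℤ) = 2 * ⌊B⌋ + 1 := by
    rw [intBox, Int.card_Icc, Int.toNat_of_nonneg (by lia)]; ring
  have h2 : ((intBox B).card : ℝ) = 2 * ⌊B⌋ + 1 := by exact_mod_cast h1
  rw [h2]
  have := Int.floor_le B
  linarith

/-- A separated set in an interval has few elements. -/
lemma card_le_of_separated {ι : Type*} (F : Finset ι) (g : ι → ℝ) {R h : ℝ} (hR : 0 ≤ R)
    (hh : 0 < h) (hF : ∀ a ∈ F, 0 ≤ g a ∧ g a ≤ R)
    (hsep : ∀ a ∈ F, ∀ b ∈ F, a ≠ b → h ≤ |g a - g b|) : (F.card : ℝ) ≤ R / h + 1 := by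
  have hcard : F.card ≤ (Finset.range (⌊R / h⌋₊ + 1)).card := by
    refine Finset.card_le_card_of_injOn (fun a => ⌊g a / h⌋₊) (fun a ha => ?_)
      (fun a ha b hb hab => ?_)
    · rw [Finset.coe_range, Set.mem_Iio, Nat.lt_succ_iff]
      have := (hF a ha).2
      exact Nat.floor_mono (div_le_div_of_nonneg_right this hh.le)
    · by_contra hne
      have h1 := hsep a ha b hb hne
      have ha0 : 0 ≤ g a / h := div_nonneg (hF a ha).1 hh.le
      have hb0 : 0 ≤ g b / h := div_nonneg (hF b hb).1 hh.le
      have e1 := Nat.floor_le ha0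
      have e2 := Nat.lt_floor_add_one (g a / h)
      have e3 := Nat.floor_le hb0
      have e4 := Nat.lt_floor_add_one (g b / h)
      have hab' : (⌊g a / h⌋₊ : ℝ) = ⌊g b / h⌋₊ := by exact_mod_cast hab
      have h2 : |g a / h - g b / h| < 1 := by
        rw [abs_lt]; constructor <;> linarith
      rw [← sub_div, abs_div, abs_of_pos hh, div_lt_one hh] at h2
      linarith
  rw [Finset.card_range] at hcard
  have h1 : (⌊R / h⌋₊ : ℝ) ≤ R / h := Nat.floor_le (by positivity)
  calc (F.card : ℝ) ≤ ((⌊R / h⌋₊ + 1 : ℕ) : ℝ) := by exact_mod_cast hcard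
    _ ≤ _ := by push_cast; linarith

/-- `a` times the vector `α / π` is close to the integer lattice. -/
def SmallPhase (α : EuclideanSpace ℝ (Fin 2)) (δ : ℝ) (a : ℤ) : Prop :=
  ∀ j, ‖Complex.exp (Complex.I * (2 * a * α j : ℝ)) - 1‖ ≤ δ

lemma SmallPhase.sub {α : EuclideanSpace ℝ (Fin 2)} {δ : ℝ} {a b : ℤ} (ha : SmallPhase α δ a)
    (hb : SmallPhase α δ b) : SmallPhase α (2 * δ) (a - b) := by
  intro j
  have h1 : Complex.exp (Complex.I * (2 * (a - b : ℤ) * α j : ℝ)) *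
      Complex.exp (Complex.I * (2 * b * α j : ℝ)) = Complex.exp (Complex.I * (2 * a * α j : ℝ)) := by
    rw [← Complex.exp_add]
    congr 1
    push_cast
    ring
  have h2 : ‖Complex.exp (Complex.I * (2 * b * α j : ℝ))‖ = 1 := Complex.norm_exp_I_mul_ofReal _
  calc _ = ‖(Complex.exp (Complex.I * (2 * (a - b : ℤ) * α j : ℝ)) - 1) *
        Complex.exp (Complex.I * (2 * b * α j : ℝ))‖ := by rw [norm_mul, h2, mul_one]
    _ = ‖(Complex.exp (Complex.I * (2 * a * α j : ℝ)) - 1) -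
        (Complex.exp (Complex.I * (2 * b * α j : ℝ)) - 1)‖ := by
      rw [sub_mul, one_mul, h1, sub_sub_sub_cancel_right]
    _ ≤ _ := (norm_sub_le _ _).trans (by linarith [ha j, hb j])

lemma SmallPhase.neg {α : EuclideanSpace ℝ (Fin 2)} {δ : ℝ} {a : ℤ} (ha : SmallPhase α δ a) :
    SmallPhase α δ (-a) := by
  intro j
  have h1 : Complex.exp (Complex.I * (2 * (-a : ℤ) * α j : ℝ)) =
      conj (Complex.exp (Complex.I * (2 * a * α j : ℝ))) := by
    rw [← Complex.exp_conj, map_mul, Complex.conj_I, Complex.conj_ofReal]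
    congr 1
    push_cast
    ring
  have h2 : conj (Complex.exp (Complex.I * (2 * a * α j : ℝ))) - 1 =
      conj (Complex.exp (Complex.I * (2 * a * α j : ℝ)) - 1) := by simp
  rw [h1, h2, RCLike.norm_conj]
  exact ha j

/-- `|e^{2it} - 1| = 2 |sin t|`, and Jordan's inequality bounds `|sin t|` below by twice the
distance of `t / π` to the integers. -/
lemma abs_sub_round_le {t δ : ℝ} (h : ‖Complex.exp (Complex.I * (2 * t : ℝ)) - 1‖ ≤ δ) :
    |t / Real.pi - round (t / Real.pi)| ≤ δ := by
  have hπ := Real.pi_pos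
  rw [Complex.norm_exp_I_mul_ofReal_sub_one, Real.norm_eq_abs, abs_mul, abs_two,
    mul_div_cancel_left₀ t two_ne_zero] at h
  set p := round (t / Real.pi) with hp
  set r := t / Real.pi - p with hr
  have hr2 : |r| ≤ 1 / 2 := abs_sub_round _
  have ht : t = Real.pi * r + p * Real.pi := by rw [hr]; field_simp; ring
  have h1 : |Real.sin t| = Real.sin (Real.pi * |r|) := by
    have h2 : |Real.sin t| = |Real.sin (Real.pi * r)| := by
      rw [ht, Real.sin_add_int_mul_pi, abs_mul, abs_zpow, abs_neg, abs_one, one_zpow, one_mul]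
    have h3 : 0 ≤ Real.sin (Real.pi * |r|) :=
      Real.sin_nonneg_of_nonneg_of_le_pi (by positivity) (by nlinarith)
    rw [h2]
    rcases abs_cases r with ⟨h4, _⟩ | ⟨h4, _⟩
    · rw [h4] at h3 ⊢; exact abs_of_nonneg h3
    · rw [h4, mul_neg, Real.sin_neg] at h3 ⊢; exact abs_of_nonpos (by linarith)
  have h4 := Real.mul_le_sin (x := Real.pi * |r|) (by positivity) (by nlinarith)
  have h5 : 2 / Real.pi * (Real.pi * |r|) = 2 * |r| := by field_simp
  rw [h5, ← h1] at h4
  have := abs_nonneg r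
  linarith

/-- For a Diophantine vector, close returns need long times. -/
lemma Diophantine.exists_return_bound {α : EuclideanSpace ℝ (Fin 2)}
    (hD : Diophantine fun i => α i / Real.pi) :
    ∃ (c : ℝ) (K : ℕ), 0 < c ∧ 1 ≤ K ∧ ∀ (δ : ℝ) (a : ℤ), a ≠ 0 → SmallPhase α δ a →
      c ≤ δ * |(a : ℝ)| ^ K := by
  obtain ⟨κ, C, hC, hκ⟩ := hD
  -- A natural exponent above `κ`; the `+ 1` keeps it positive even for `κ ≤ 0`, so that `1 / K`
  -- makes sense later.
  refine ⟨C, ⌈κ⌉₊ + 1, hC, by lia, fun δ => ?_⟩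
  have key : ∀ a : ℤ, 0 < a → SmallPhase α δ a → C ≤ δ * |(a : ℝ)| ^ (⌈κ⌉₊ + 1) := by
    intro a ha hs
    have ha1 : (1 : ℝ) ≤ a := by exact_mod_cast ha
    have ha0 : (0 : ℝ) < a := by linarith
    have hr : ∀ j, |a * α j / Real.pi - round (a * α j / Real.pi)| ≤ δ := fun j =>
      abs_sub_round_le (by simpa [mul_assoc] using hs j)
    have h1 := hκ (fun j => round (a * α j / Real.pi)) a ha
    have h2 : ∀ j, |α j / Real.pi - round (a * α j / Real.pi) / a| ≤ δ / a := by
      intro j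
      have : α j / Real.pi - round (a * α j / Real.pi) / a =
          (a * α j / Real.pi - round (a * α j / Real.pi)) / a := by field_simp
      rw [this, abs_div, abs_of_pos ha0]
      gcongr
      exact hr j
    have h3 : C / (a : ℝ) ^ κ < δ / a := h1.trans_le (max_le (h2 0) (h2 1))
    have hδ : 0 ≤ δ := (abs_nonneg _).trans (hr 0)
    rw [div_lt_iff₀ (by positivity)] at h3
    rw [abs_of_pos ha0]
    refine h3.le.trans ?_
    have h4 : (a : ℝ) ^ κ ≤ (a : ℝ) ^ (⌈κ⌉₊ + 1) := by
      rw [← Real.rpow_natCast]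
      refine Real.rpow_le_rpow_of_exponent_le ha1 ?_
      push_cast
      linarith [Nat.le_ceil κ]
    have h5 : δ / a ≤ δ := div_le_self hδ ha1
    gcongr
  intro a ha hs
  rcases lt_or_gt_of_ne ha with h | h
  · have := key (-a) (by lia) hs.neg
    rwa [Int.cast_neg, abs_neg] at this
  · exact key a h hs

/-- The circle `|ξ|² = n` carries two frequencies separating the scatterers quantitatively. -/
def SepBy (y : Torus) (n : ℕ) (δ : ℝ) : Prop :=
  ∃ ξ ξ' : Freq, normSq ξ = n ∧ normSq ξ' = n ∧ δ < ‖character ξ y - character ξ' y‖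

lemma SepBy.separatesScatterers {y : Torus} {n : ℕ} {δ : ℝ} (hδ : 0 ≤ δ) (h : SepBy y n δ) :
    SeparatesScatterers y n := by
  obtain ⟨ξ, ξ', h1, h2, h3⟩ := h
  refine ⟨ξ, ξ', h1, h2, fun h => ?_⟩
  rw [h, sub_self, norm_zero] at h3
  linarith

lemma norm_exp_mul_I_sub (s t : ℝ) :
    ‖Complex.exp ((s : ℂ) * Complex.I) - Complex.exp ((t : ℂ) * Complex.I)‖ =
      ‖Complex.exp (Complex.I * (s - t : ℝ)) - 1‖ := by
  have h1 : Complex.exp ((s : ℂ) * Complex.I) - Complex.exp ((t : ℂ) * Complex.I) =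
      Complex.exp (Complex.I * (t : ℝ)) * (Complex.exp (Complex.I * (s - t : ℝ)) - 1) := by
    rw [mul_sub, ← Complex.exp_add, mul_one]
    congr 2
    · push_cast; ring
    · ring
  rw [h1, norm_mul, Complex.norm_exp_I_mul_ofReal, one_mul]

/-- The circle is invariant under sign changes and the swap of coordinates. Comparing `(ξ₀, ξ₁)`
with `(-ξ₀, ξ₁)` gives the phase `2 ξ₀ α₀`, and `(ξ₁, ξ₀)` with `(ξ₁, -ξ₀)` gives `2 ξ₀ α₁`. The
factor `2` is why `α / π` is the relevant vector. -/
lemma smallPhase_of_not_sepBy {α : EuclideanSpace ℝ (Fin 2)} {n : ℕ} {δ : ℝ}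
    (h : ¬ SepBy (proj α) n δ) {ξ : Freq} (hξ : normSq ξ = n) : SmallPhase α δ (ξ 0) := by
  intro j
  by_contra hlt
  rw [not_le] at hlt
  refine h ?_
  fin_cases j
  · refine ⟨ξ, ![-ξ 0, ξ 1], hξ, by simpa [normSq] using hξ, ?_⟩
    rw [character_proj, character_proj, norm_exp_mul_I_sub]
    refine hlt.trans_eq (congrArg (fun t : ℝ => ‖Complex.exp (Complex.I * t) - 1‖) ?_)
    simp
    ring
  · refine ⟨![ξ 1, ξ 0], ![ξ 1, -ξ 0], by rw [← hξ]; simp [normSq, add_comm],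
      by rw [← hξ]; simp [normSq, add_comm], ?_⟩
    rw [character_proj, character_proj, norm_exp_mul_I_sub]
    refine hlt.trans_eq (congrArg (fun t : ℝ => ‖Complex.exp (Complex.I * t) - 1‖) ?_)
    simp
    ring

/-- Few circles fail to separate the scatterers. -/
lemma card_not_sepBy_le {α : EuclideanSpace ℝ (Fin 2)}
    (hD : Diophantine fun i => α i / Real.pi) :
    ∃ (C : ℝ) (K : ℕ), 0 < C ∧ 1 ≤ K ∧ ∀ (δ X : ℝ), 0 < δ → 0 ≤ X → ∀ F : Finset ℕ,
      (∀ n ∈ F, IsNorm n ∧ (n : ℝ) ≤ X ∧ ¬ SepBy (proj α) n δ) →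
      (F.card : ℝ) ≤ (C * √X * δ ^ (1 / (K : ℝ)) + 1) * (2 * √X + 1) := by
  classical
  obtain ⟨c, K, hc, hK, hret⟩ := hD.exists_return_bound
  have hK0 : (0 : ℝ) < K := by exact_mod_cast hK
  refine ⟨2 * (2 / c) ^ (1 / (K : ℝ)), K, by positivity, hK, fun δ X hδ hX F hF => ?_⟩
  -- The possible first coordinates. A difference of two of them has phase at most `2δ`, so the
  -- return bound separates them by `(c / 2δ)^{1/K}`. The second coordinate is left free, and both
  -- coordinates determine `n`.
  set A := (intBox √X).filter (SmallPhase α δ) with hA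
  have hAcard : (A.card : ℝ) ≤ 2 * (2 / c) ^ (1 / (K : ℝ)) * √X * δ ^ (1 / (K : ℝ)) + 1 := by
    set h : ℝ := (c / (2 * δ)) ^ (1 / (K : ℝ)) with hh
    have hh0 : 0 < h := by positivity
    have h1 := card_le_of_separated A (fun a : ℤ => (a : ℝ) + √X) (R := 2 * √X) (h := h)
      (by positivity) hh0 (fun a ha => ?_) (fun a ha b hb hab => ?_)
    · refine h1.trans_eq ?_
      have h2 : 1 / h = (2 / c) ^ (1 / (K : ℝ)) * δ ^ (1 / (K : ℝ)) := by
        rw [hh, ← Real.mul_rpow (by positivity) hδ.le, one_div, ← Real.inv_rpow (by positivity)]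
        congr 1
        field_simp
      rw [div_eq_mul_one_div, h2]
      ring
    · have := abs_le.1 (mem_intBox.1 (Finset.mem_filter.1 ha).1)
      constructor <;> linarith
    · have h2 := hret (2 * δ) (a - b) (sub_ne_zero.2 hab)
        ((Finset.mem_filter.1 ha).2.sub (Finset.mem_filter.1 hb).2)
      rw [add_sub_add_right_eq_sub, ← Int.cast_sub]
      have h3 : c / (2 * δ) ≤ |((a - b : ℤ) : ℝ)| ^ K := by
        rw [div_le_iff₀ (by positivity)]; linarith
      calc h ≤ (|((a - b : ℤ) : ℝ)| ^ K) ^ (1 / (K : ℝ)) := by rw [hh]; gcongr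
        _ = |((a - b : ℤ) : ℝ)| := by
          rw [one_div, Real.pow_rpow_inv_natCast (abs_nonneg _) (by lia)]
  have hcard : F.card ≤ (A ×ˢ intBox √X).card := by
    choose! ξ hξ using fun n (hn : n ∈ F) => (hF n hn).1
    refine Finset.card_le_card_of_injOn (fun n => (ξ n 0, ξ n 1)) (fun n hn => ?_)
      (fun n hn m hm hnm => ?_)
    · have hn' := hF n hn
      have hle : (normSq (ξ n) : ℝ) ≤ X := by rw [hξ n hn]; simpa using hn'.2.1
      have habs : ∀ i, |((ξ n i : ℤ) : ℝ)| ≤ √X := fun i => by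
        refine Real.abs_le_sqrt (le_trans ?_ hle)
        have : (ξ n i) ^ 2 ≤ normSq (ξ n) := by
          unfold normSq; fin_cases i <;> simp <;> positivity
        exact_mod_cast this
      simp only [Finset.coe_product, Set.mem_prod, Finset.mem_coe, hA, Finset.mem_filter]
      exact ⟨⟨mem_intBox.2 (habs 0), smallPhase_of_not_sepBy hn'.2.2 (hξ n hn)⟩,
        mem_intBox.2 (habs 1)⟩
    · simp only [Prod.mk.injEq] at hnm
      have h1 := hξ n hn
      have h2 := hξ m hm
      rw [normSq, hnm.1, hnm.2, ← normSq, h2] at h1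
      exact_mod_cast h1.symm
  rw [Finset.card_product] at hcard
  calc (F.card : ℝ) ≤ A.card * (intBox √X).card := by exact_mod_cast hcard
    _ ≤ _ := by
      gcongr
      exact card_intBox_le (Real.sqrt_nonneg X)

/-- The sums of two squares that are followed by a long gap are few. -/
lemma card_gap_le {h X : ℝ} (hh : 0 < h) (hX : 0 ≤ X) (F : Finset ℕ)
    (hF : ∀ n ∈ F, IsNorm n ∧ (n : ℝ) ≤ X ∧
      ∀ n', IsNorm n' → n < n' → (n : ℝ) + h < n') : (F.card : ℝ) ≤ X / h + 1 := by
  refine card_le_of_separated F (fun n : ℕ => (n : ℝ)) hX hh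
    (fun n hn => ⟨Nat.cast_nonneg n, (hF n hn).2.1⟩) (fun a ha b hb hab => ?_)
  rcases lt_or_gt_of_ne hab with hlt | hlt
  · have := (hF a ha).2.2 b (hF b hb).1 hlt
    rw [abs_sub_comm]
    exact (by linarith : h ≤ (b : ℝ) - a).trans (le_abs_self _)
  · have := (hF b hb).2.2 a (hF a ha).1 hlt
    exact (by linarith : h ≤ (a : ℝ) - b).trans (le_abs_self _)

/-- Two nearby lattice points close to the circle `|ξ|² = n`. -/
def ClosePair (n : ℕ) (Z L : ℝ) : Prop :=
  ∃ ξ ζ : Freq, ζ ≠ 0 ∧ (normSq ζ : ℝ) ≤ Z ^ 2 ∧ |(normSq ξ : ℝ) - n| ≤ L ∧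
    |(normSq (ξ + ζ) : ℝ) - n| ≤ L

lemma abs_le_of_normSq_le {ξ : Freq} {B : ℝ} (h : (normSq ξ : ℝ) ≤ B) (i : Fin 2) :
    |((ξ i : ℤ) : ℝ)| ≤ √B := by
  refine Real.abs_le_sqrt (le_trans ?_ h)
  have : (ξ i) ^ 2 ≤ normSq ξ := by
    unfold normSq; fin_cases i <;> simp <;> positivity
  exact_mod_cast this

/-- For fixed `ζ`, the quantity `|ξ + ζ|² - |ξ|²` is affine in `ξ`, so it and one suitable
coordinate determine `ξ`; then `n - |ξ|²` determines `n`. The five factors count `ζ`, that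
coordinate and the two small integers. -/
lemma card_closePair_le {Z L X : ℝ} (hZ : 0 ≤ Z) (hL : 0 ≤ L) (F : Finset ℕ)
    (hF : ∀ n ∈ F, (n : ℝ) ≤ X ∧ ClosePair n Z L) :
    (F.card : ℝ) ≤ (2 * Z + 1) * (2 * Z + 1) * (2 * √(X + L) + 1) * (2 * (2 * L) + 1) *
      (2 * L + 1) := by
  classical
  choose! ξ ζ hζ0 hζ hξ hξζ using fun n (hn : n ∈ F) => (hF n hn).2
  -- The recorded coordinate is chosen so that the other one has a nonzero coefficient in `ζ` and
  -- can be solved for.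
  set u : ℕ → ℤ := fun n => if ζ n 0 ≠ 0 then ξ n 1 else ξ n 0 with hu
  set k : ℕ → ℤ := fun n => normSq (ξ n + ζ n) - normSq (ξ n) with hk
  set B := intBox Z ×ˢ intBox Z ×ˢ intBox √(X + L) ×ˢ intBox (2 * L) ×ˢ intBox L with hB
  have hcard : F.card ≤ B.card := by
    refine Finset.card_le_card_of_injOn
      (fun n => (ζ n 0, ζ n 1, u n, k n, (n : ℤ) - normSq (ξ n))) (fun n hn => ?_)
      (fun n hn m hm hnm => ?_)
    · simp only [hB, Finset.coe_product, Set.mem_prod, Finset.mem_coe, mem_intBox]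
      have hz := hζ n hn
      have hz' : ∀ i, |((ζ n i : ℤ) : ℝ)| ≤ Z := fun i => by
        simpa [Real.sqrt_sq hZ] using abs_le_of_normSq_le hz i
      have hx : (normSq (ξ n) : ℝ) ≤ X + L := by
        have := (abs_le.1 (hξ n hn)).2
        linarith [(hF n hn).1]
      refine ⟨hz' 0, hz' 1, ?_, ?_, ?_⟩
      · simp only [hu]
        split_ifs
        · exact abs_le_of_normSq_le hx 1
        · exact abs_le_of_normSq_le hx 0
      · have h1 := abs_le.1 (hξ n hn)
        have h2 := abs_le.1 (hξζ n hn)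
        simp only [hk]
        push_cast
        rw [abs_le]
        constructor <;> linarith
      · push_cast
        rw [abs_sub_comm]
        exact hξ n hn
    · simp only [Prod.mk.injEq, hu, hk] at hnm
      obtain ⟨h0, h1, h2, h3, h4⟩ := hnm
      have hne : ζ m 0 ≠ 0 ∨ ζ m 1 ≠ 0 := by
        by_contra! hc
        exact hζ0 m hm (by funext i; fin_cases i; exacts [hc.1, hc.2])
      rw [h0] at h2
      have hlin : ζ m 0 * (ξ n 0 - ξ m 0) + ζ m 1 * (ξ n 1 - ξ m 1) = 0 := by
        simp only [normSq, Pi.add_apply, h0, h1] at h3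
        linarith
      have hx : ξ n 0 = ξ m 0 ∧ ξ n 1 = ξ m 1 := by
        by_cases hz : ζ m 0 = 0
        · have hz1 := hne.resolve_left (by simpa using hz)
          simp only [hz, ne_eq, not_true_eq_false, if_false, zero_mul, zero_add] at h2 hlin
          exact ⟨h2, sub_eq_zero.1 ((mul_eq_zero.1 hlin).resolve_left hz1)⟩
        · simp only [ne_eq, hz, not_false_eq_true, if_true] at h2
          rw [h2, sub_self, mul_zero, add_zero] at hlin
          exact ⟨sub_eq_zero.1 ((mul_eq_zero.1 hlin).resolve_left hz), h2⟩
      have : normSq (ξ n) = normSq (ξ m) := by rw [normSq, hx.1, hx.2, normSq]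
      rw [this] at h4
      exact_mod_cast sub_left_injective h4
  have hBc : (B.card : ℝ) = (intBox Z).card * ((intBox Z).card * ((intBox √(X + L)).card *
      ((intBox (2 * L)).card * (intBox L).card))) := by
    rw [hB]
    simp only [Finset.card_product]
    push_cast
    ring
  calc (F.card : ℝ) ≤ B.card := by exact_mod_cast hcard
    _ ≤ (2 * Z + 1) * ((2 * Z + 1) * ((2 * √(X + L) + 1) * ((2 * (2 * L) + 1) *
      (2 * L + 1)))) := by
      rw [hBc]
      have e1 := card_intBox_le hZ
      have e2 := card_intBox_le (Real.sqrt_nonneg (X + L))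
      have e3 := card_intBox_le (by positivity : 0 ≤ 2 * L)
      have e4 := card_intBox_le hL
      gcongr
    _ = _ := by ring

/-- A sum of two squares whose neighbourhood is exceptional: it is followed by a long gap, or its
circle does not separate the scatterers, or there is a close pair of frequencies near it. -/
def Exceptional (y : Torus) (s : ℝ) (n : ℕ) : Prop :=
  (∀ n', IsNorm n' → n < n' → (n : ℝ) + (n : ℝ) ^ s < n') ∨ ¬ SepBy y n ((n : ℝ) ^ (-s)) ∨
    ClosePair n ((n : ℝ) ^ s) ((n : ℝ) ^ (1 / 4 - 2 * s))

lemma SepBy.mono {y : Torus} {n : ℕ} {δ δ' : ℝ} (h : SepBy y n δ') (hδ : δ ≤ δ') :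
    SepBy y n δ := by
  obtain ⟨ξ, ξ', h1, h2, h3⟩ := h
  exact ⟨ξ, ξ', h1, h2, hδ.trans_lt h3⟩

lemma ClosePair.mono {n : ℕ} {Z L Z' L' : ℝ} (h : ClosePair n Z L) (hZ0 : 0 ≤ Z) (hZ : Z ≤ Z')
    (hL : L ≤ L') : ClosePair n Z' L' := by
  obtain ⟨ξ, ζ, h1, h2, h3, h4⟩ := h
  exact ⟨ξ, ζ, h1, h2.trans (by gcongr), h3.trans hL, h4.trans hL⟩

lemma card_le_of_le_sqrt {X : ℝ} (F : Finset ℕ) (hF : ∀ n ∈ F, (n : ℝ) ≤ √X) :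
    (F.card : ℝ) ≤ √X + 1 := by
  have h := card_le_of_separated F (fun n : ℕ => (n : ℝ)) (Real.sqrt_nonneg X) one_pos
    (fun n hn => ⟨Nat.cast_nonneg n, hF n hn⟩) (fun a _ b _ hab => ?_)
  · simpa using h
  · have h1 : (a : ℤ) - b ≠ 0 := sub_ne_zero.2 (by exact_mod_cast hab)
    have h2 := Int.one_le_abs h1
    exact_mod_cast h2

lemma rpow_half_le {X s n : ℝ} (hX : 0 ≤ X) (hs : 0 ≤ s) (hn : √X ≤ n) : X ^ (s / 2) ≤ n ^ s := by
  calc X ^ (s / 2) = (√X) ^ s := by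
        rw [Real.sqrt_eq_rpow, ← Real.rpow_mul hX]; congr 1; ring
    _ ≤ _ := by gcongr

/-- The exceptional sums of two squares are sparse. -/
lemma card_exceptional_le {α : EuclideanSpace ℝ (Fin 2)}
    (hD : Diophantine fun i => α i / Real.pi) {s : ℝ} (hs : 0 < s) (hs1 : s ≤ 1 / 100) :
    ∃ C η : ℝ, 0 < C ∧ 0 < η ∧ η < 1 ∧ ∀ X : ℝ, 1 ≤ X → ∀ F : Finset ℕ,
      (∀ n ∈ F, IsNorm n ∧ (n : ℝ) ≤ X ∧ Exceptional (proj α) s n) →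
      (F.card : ℝ) ≤ C * X ^ (1 - η) := by
  classical
  obtain ⟨C, K, hC, hK, hsep⟩ := card_not_sepBy_le hD
  have hK1 : (1 : ℝ) ≤ K := by exact_mod_cast hK
  have hK0 : (0 : ℝ) < K := by linarith
  -- The saving in the second class: there `δ = X^{-s/2}` enters through `δ^{1/K}`. The other
  -- classes save more.
  set η := s / (2 * K) with hη
  have hη0 : 0 < η := by positivity
  have hηs : η ≤ s / 2 := by
    rw [hη]
    gcongr
    linarith
  refine ⟨2 + 2 + (C + 1) * 3 + 675, η, by positivity, hη0, by linarith, fun X hX F hF => ?_⟩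
  have hX0 : 0 < X := by linarith
  have hpow : ∀ t : ℝ, 0 ≤ t → 1 ≤ X ^ t := fun t ht => Real.one_le_rpow hX ht
  have hmono : ∀ t : ℝ, t ≤ 1 - η → X ^ t ≤ X ^ (1 - η) := fun t ht =>
    Real.rpow_le_rpow_of_exponent_le hX ht
  have hsq : √X = X ^ (1 / 2 : ℝ) := Real.sqrt_eq_rpow X
  have hsq1 : 1 ≤ √X := Real.one_le_sqrt.2 hX
  -- The range below `√X` is discarded, so that `n^s ≥ X^{s/2}` turns the `n`-dependent thresholds
  -- of the first two classes into ones depending on `X`.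
  set F0 := F.filter fun n : ℕ => (n : ℝ) ≤ √X with hF0
  set F1 := F.filter fun n : ℕ => √X ≤ (n : ℝ) ∧
    ∀ n', IsNorm n' → n < n' → (n : ℝ) + (n : ℝ) ^ s < n' with hF1
  set F2 := F.filter fun n : ℕ => √X ≤ (n : ℝ) ∧ ¬ SepBy (proj α) n ((n : ℝ) ^ (-s)) with hF2
  set F3 := F.filter fun n : ℕ => √X ≤ (n : ℝ) ∧
    ClosePair n ((n : ℝ) ^ s) ((n : ℝ) ^ (1 / 4 - 2 * s)) with hF3
  have hsub : F ⊆ F0 ∪ F1 ∪ F2 ∪ F3 := fun n hn => by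
    have h := (hF n hn).2.2
    simp only [Finset.mem_union, hF0, hF1, hF2, hF3, Finset.mem_filter, hn, true_and]
    rcases le_total (n : ℝ) √X with h0 | h0
    · exact Or.inl (Or.inl (Or.inl h0))
    · rcases h with h | h | h
      · exact Or.inl (Or.inl (Or.inr ⟨h0, h⟩))
      · exact Or.inl (Or.inr ⟨h0, h⟩)
      · exact Or.inr ⟨h0, h⟩
  have hc : (F.card : ℝ) ≤ F0.card + F1.card + F2.card + F3.card := by
    have h1 := Finset.card_le_card hsub
    have h2 := Finset.card_union_le (F0 ∪ F1 ∪ F2) F3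
    have h3 := Finset.card_union_le (F0 ∪ F1) F2
    have h4 := Finset.card_union_le F0 F1
    have : F.card ≤ F0.card + F1.card + F2.card + F3.card := by lia
    exact_mod_cast this
  have h0 : (F0.card : ℝ) ≤ 2 * X ^ (1 - η) := by
    have h1 := card_le_of_le_sqrt F0 (X := X) (fun n hn => (Finset.mem_filter.1 hn).2)
    have h2 := hmono (1 / 2) (by linarith)
    rw [← hsq] at h2
    linarith
  have h1 : (F1.card : ℝ) ≤ 2 * X ^ (1 - η) := by
    have h1 := card_gap_le (h := X ^ (s / 2)) (by positivity) hX0.le F1 (fun n hn => by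
      have hn' := Finset.mem_filter.1 hn
      refine ⟨(hF n hn'.1).1, (hF n hn'.1).2.1, fun n' h h' => ?_⟩
      have := hn'.2.2 n' h h'
      have := rpow_half_le hX0.le hs.le hn'.2.1
      linarith)
    have h2 : X / X ^ (s / 2) = X ^ (1 - s / 2) := by rw [Real.rpow_sub hX0, Real.rpow_one]
    rw [h2] at h1
    have h3 := hmono (1 - s / 2) (by linarith)
    have h4 := hpow (1 - η) (by linarith)
    linarith
  have h2 : (F2.card : ℝ) ≤ (C + 1) * 3 * X ^ (1 - η) := by
    have h1 := hsep (X ^ (-(s / 2))) X (by positivity) hX0.le F2 (fun n hn => by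
      have hn' := Finset.mem_filter.1 hn
      refine ⟨(hF n hn'.1).1, (hF n hn'.1).2.1, fun h => hn'.2.2 (h.mono ?_)⟩
      rw [Real.rpow_neg hX0.le, Real.rpow_neg (Nat.cast_nonneg n)]
      have := rpow_half_le hX0.le hs.le hn'.2.1
      gcongr)
    have h2 : √X * (X ^ (-(s / 2))) ^ (1 / (K : ℝ)) = X ^ (1 / 2 - η) := by
      rw [hsq, ← Real.rpow_mul hX0.le, ← Real.rpow_add hX0]
      congr 1
      rw [hη]
      field_simp
      ring
    rw [mul_assoc C, h2] at h1
    have h3 := hpow (1 / 2 - η) (by linarith)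
    calc (F2.card : ℝ) ≤ _ := h1
      _ ≤ (C * X ^ (1 / 2 - η) + X ^ (1 / 2 - η)) * (2 * √X + √X) := by gcongr
      _ = (C + 1) * 3 * (X ^ (1 / 2 - η) * X ^ (1 / 2 : ℝ)) := by rw [hsq]; ring
      _ = _ := by rw [← Real.rpow_add hX0]; congr 2; ring
  have h3 : (F3.card : ℝ) ≤ 675 * X ^ (1 - η) := by
    set Z := X ^ s with hZ
    set L := X ^ (1 / 4 - 2 * s) with hL
    have hZ1 : 1 ≤ Z := hpow s hs.le
    have hL1 : 1 ≤ L := hpow _ (by linarith)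
    have hLX : L ≤ X := by
      conv_rhs => rw [← Real.rpow_one X]
      exact Real.rpow_le_rpow_of_exponent_le hX (by linarith)
    have hsqrt : √(X + L) ≤ 2 * √X := by
      rw [← Real.sqrt_sq (by positivity : 0 ≤ 2 * √X)]
      refine Real.sqrt_le_sqrt ?_
      rw [mul_pow, Real.sq_sqrt hX0.le]
      linarith
    have h1 := card_closePair_le (Z := Z) (L := L) (X := X) (by positivity) (by positivity) F3
      (fun n hn => by
        have hn' := Finset.mem_filter.1 hn
        have hnX := (hF n hn'.1).2.1
        have h1 : (n : ℝ) ^ (1 / 4 - 2 * s) ≤ L :=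
          Real.rpow_le_rpow (Nat.cast_nonneg n) hnX (by linarith)
        exact ⟨hnX, hn'.2.2.mono (by positivity) (by rw [hZ]; gcongr) h1⟩)
    calc (F3.card : ℝ) ≤ _ := h1
      _ ≤ (2 * Z + Z) * (2 * Z + Z) * (2 * (2 * √X) + √X) * (2 * (2 * L) + L) * (2 * L + L) := by
        gcongr
      _ = 675 * (Z * Z * √X * L * L) := by ring
      -- The exponents are `2s + 1/2 + 2 (1/4 - 2s)`: the width `n^{1/4 - 2s}` is chosen to land
      -- just below `1`.
      _ = 675 * X ^ (1 - 2 * s) := by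
        rw [hZ, hL, hsq]
        simp only [← Real.rpow_add hX0]
        congr 2
        ring
      _ ≤ _ := by
        gcongr
        linarith
  linarith

/-! ### Equidistribution from the concentration of frequencies -/

lemma memLp_character_mul (ζ : Freq) (g : L2) :
    MemLp (fun y => character ζ y * g y) 2 (volume : Measure Torus) := by
  refine (Lp.memLp g).mono ?_ (ae_of_all _ fun y => ?_)
  · exact (character ζ).continuous.aestronglyMeasurable.mul (Lp.aestronglyMeasurable g)
  · rw [norm_mul, norm_character, one_mul]

/-- Multiplication by a character on `L²(𝕋²)`. -/
def charMul (ζ : Freq) (g : L2) : L2 := (memLp_character_mul ζ g).toLp _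

lemma charMul_coeFn (ζ : Freq) (g : L2) : charMul ζ g =ᵐ[volume] fun y => character ζ y * g y :=
  MemLp.coeFn_toLp _

lemma hat_eq_integral (g : L2) (ξ : Freq) :
    hat g ξ = ((1 / (2 * Real.pi) : ℝ) : ℂ) * ∫ y, conj (character ξ y) * g y := by
  rw [hat, unitCharacter, inner_smul_left, inner_toL2, Complex.conj_ofReal]

lemma hat_charMul (ζ : Freq) (g : L2) (ξ : Freq) : hat (charMul ζ g) ξ = hat g (ξ - ζ) := by
  rw [hat_eq_integral, hat_eq_integral]
  congr 1
  refine integral_congr_ae ?_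
  filter_upwards [charMul_coeFn ζ g] with y hy
  rw [hy, ← mul_assoc, sub_eq_add_neg, character_add, character_neg, map_mul, Complex.conj_conj]

lemma charMul_add (ζ : Freq) (f g : L2) : charMul ζ (f + g) = charMul ζ f + charMul ζ g :=
  hat_ext fun ξ => by simp only [hat_charMul, hat_add]

lemma norm_charMul (ζ : Freq) (g : L2) : ‖charMul ζ g‖ = ‖g‖ := by
  have h1 := hasSum_norm_sq (charMul ζ g)
  simp only [hat_charMul] at h1
  have h2 := (Equiv.subRight ζ).hasSum_iff.2 (hasSum_norm_sq g)
  exact (sq_eq_sq₀ (norm_nonneg _) (norm_nonneg _)).1 (h1.unique h2)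

lemma integral_character_mul_norm_sq (ζ : Freq) (g : L2) :
    ∫ y, character ζ y * ((‖g y‖ ^ 2 : ℝ) : ℂ) = inner ℂ g (charMul ζ g) := by
  rw [L2.inner_def]
  refine integral_congr_ae ?_
  filter_upwards [charMul_coeFn ζ g] with y hy
  rw [hy, RCLike.inner_apply, mul_assoc, Complex.mul_conj, Complex.normSq_eq_norm_sq]

lemma integrable_norm_sq (g : L2) : Integrable (fun y => ‖g y‖ ^ 2) (volume : Measure Torus) :=
  (memLp_two_iff_integrable_sq_norm (Lp.aestronglyMeasurable g)).1 (Lp.memLp g)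

lemma integral_norm_sq (g : L2) : ∫ y, ‖g y‖ ^ 2 = ‖g‖ ^ 2 := by
  have h := integral_character_mul_norm_sq 0 g
  have h0 : charMul 0 g = g := hat_ext fun ξ => by rw [hat_charMul, sub_zero]
  simp only [character_zero, one_mul, h0] at h
  rw [integral_complex_ofReal, inner_self_eq_norm_sq_to_K] at h
  exact Complex.ofReal_injective (h.trans (by simp))

/-- If no two frequencies differing by `ζ` carry the bulk of `g`, then the corresponding Fourier
coefficient of `|g|²` is small. -/
lemma norm_inner_charMul_le {g : L2} (hg : ‖g‖ = 1) {ζ : Freq} {near : Freq → Prop} {τ : ℝ}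
    (hpair : ∀ ξ, near ξ → ¬ near (ξ - ζ))
    (hfar : ∀ F : Finset Freq, (∀ ξ ∈ F, ¬ near ξ) → ∑ ξ ∈ F, ‖hat g ξ‖ ^ 2 ≤ τ) :
    ‖(inner ℂ g (charMul ζ g) : ℂ)‖ ≤ 2 * √τ := by
  classical
  have hsum := (hasSum_norm_sq g).summable
  obtain ⟨u, hu, -⟩ := exists_hat_eq (w := fun ξ => if near ξ then hat g ξ else 0)
    (hsum.of_nonneg_of_le (fun ξ => by positivity) fun ξ => by split_ifs <;> simp)
  obtain ⟨v, hv, -⟩ := exists_hat_eq (w := fun ξ => if near ξ then 0 else hat g ξ)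
    (hsum.of_nonneg_of_le (fun ξ => by positivity) fun ξ => by split_ifs <;> simp)
  have huv : g = u + v := hat_ext fun ξ => by rw [hat_add, hu, hv]; split_ifs <;> simp
  have hu1 : ‖u‖ ≤ 1 := by
    rw [← hg, ← sq_le_sq₀ (norm_nonneg _) (norm_nonneg _)]
    refine hasSum_le (fun ξ => ?_) (hasSum_norm_sq u) (hasSum_norm_sq g)
    rw [hu]; split_ifs <;> simp
  have hv1 : ‖v‖ ≤ √τ := by
    refine Real.le_sqrt_of_sq_le (hasSum_le_of_sum_le (hasSum_norm_sq v) fun F => ?_)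
    refine le_trans (le_of_eq ?_) (hfar (F.filter fun ξ => ¬ near ξ)
      fun ξ hξ => (Finset.mem_filter.1 hξ).2)
    rw [Finset.sum_filter]
    refine Finset.sum_congr rfl fun ξ _ => ?_
    rw [hv]; split_ifs <;> simp
  -- The near part `u` and its translate by `ζ` have disjoint frequency supports. Each remaining
  -- term contains the far part `v`, of norm at most `√τ`.
  have h0 : (inner ℂ u (charMul ζ u) : ℂ) = 0 := by
    refine (hasSum_inner u (charMul ζ u)).unique ?_
    convert hasSum_zero using 2 with ξ
    rw [hat_charMul, hu, hu]
    by_cases h : near ξ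
    · rw [if_neg (hpair ξ h), mul_zero]
    · rw [if_neg h, map_zero, zero_mul]
  have hexp : (inner ℂ g (charMul ζ g) : ℂ) =
      inner ℂ u (charMul ζ v) + inner ℂ v (charMul ζ g) := by
    conv_lhs => rw [huv]
    rw [inner_add_left, ← huv]
    congr 1
    conv_lhs => rw [huv]
    rw [charMul_add, inner_add_right, h0, zero_add]
  rw [hexp]
  refine (norm_add_le _ _).trans ?_
  have e1 := norm_inner_le_norm (𝕜 := ℂ) u (charMul ζ v)
  have e2 := norm_inner_le_norm (𝕜 := ℂ) v (charMul ζ g)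
  rw [norm_charMul] at e1 e2
  rw [hg, mul_one] at e2
  have e3 : ‖u‖ * ‖v‖ ≤ 1 * √τ := by gcongr
  linarith

/-- Observables test `|g|²` through its Fourier coefficients. -/
lemma norm_integral_sub_le {a : Torus → ℂ} (ha : IsSmooth a) {g : L2} (hg : ‖g‖ = 1) {Z b : ℝ}
    (hZ : 0 < Z) (hb : 0 ≤ b) (N : ℕ)
    (h : ∀ ζ : Freq, ζ ≠ 0 → (normSq ζ : ℝ) ≤ Z ^ 2 → ‖(inner ℂ g (charMul ζ g) : ℂ)‖ ≤ b) :
    ‖(∫ y, a y * ((‖g y‖ ^ 2 : ℝ) : ℂ)) - (1 / (4 * Real.pi ^ 2) : ℝ) * ∫ y, a y‖ ≤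
      (b + (Z ^ (2 * N))⁻¹) * ∑' ξ, (1 + (normSq ξ : ℝ)) ^ N * ‖coef a ξ‖ := by
  have hi : Integrable (fun y => ((‖g y‖ ^ 2 : ℝ) : ℂ)) := (integrable_norm_sq g).ofReal
  have hint : ∀ ζ : Freq, Integrable fun y =>
      coef a ζ * (character ζ y * ((‖g y‖ ^ 2 : ℝ) : ℂ)) := fun ζ => by
    refine Integrable.const_mul ?_ _
    refine hi.mono ((character ζ).continuous.aestronglyMeasurable.mul hi.aestronglyMeasurable)
      (ae_of_all _ fun y => ?_)
    rw [norm_mul, norm_character, one_mul]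
  have hnorm : ∀ ζ : Freq, ∫ y, ‖coef a ζ * (character ζ y * ((‖g y‖ ^ 2 : ℝ) : ℂ))‖ =
      ‖coef a ζ‖ := fun ζ => by
    have : ∀ y, ‖coef a ζ * (character ζ y * ((‖g y‖ ^ 2 : ℝ) : ℂ))‖ = ‖coef a ζ‖ * ‖g y‖ ^ 2 := by
      intro y
      rw [norm_mul, norm_mul, norm_character, one_mul, Complex.norm_real, Real.norm_of_nonneg
        (by positivity)]
    simp only [this]
    rw [integral_const_mul, integral_norm_sq, hg]
    simp
  have h1 : HasSum (fun ζ => coef a ζ * inner ℂ g (charMul ζ g))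
      (∫ y, a y * ((‖g y‖ ^ 2 : ℝ) : ℂ)) := by
    have := hasSum_integral_of_summable_integral_norm hint (by
      simp only [hnorm]; simpa using! ha.summable_coef 0)
    simp only [integral_const_mul, integral_character_mul_norm_sq] at this
    have hy : ∀ y, ∑' ζ, coef a ζ * (character ζ y * ((‖g y‖ ^ 2 : ℝ) : ℂ)) =
        a y * ((‖g y‖ ^ 2 : ℝ) : ℂ) := fun y => by
      rw [← ((ha.hasSum_coef y).mul_right _).tsum_eq]
      simp only [mul_assoc]
    simp only [hy] at this
    exact this
  have h2 : HasSum (fun ζ : Freq => if ζ = 0 then coef a 0 else 0)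
      (((1 / (4 * Real.pi ^ 2) : ℝ) : ℂ) * ∫ y, a y) := by
    have h3 : ((1 / (4 * Real.pi ^ 2) : ℝ) : ℂ) * ∫ y, a y = coef a 0 := by
      simp [coef, character_zero]
    rw [h3]
    exact hasSum_ite_eq 0 _
  have h3 := h1.sub h2
  rw [← h3.tsum_eq, ← tsum_mul_left]
  have hsum := (ha.summable_coef N).mul_left (b + (Z ^ (2 * N))⁻¹)
  refine tsum_of_norm_bounded hsum.hasSum fun ζ => ?_
  have hn0 := normSq_nonneg' ζ
  have hpow : 1 ≤ (1 + (normSq ζ : ℝ)) ^ N := one_le_pow₀ (by linarith)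
  have hZN : 0 < (Z ^ (2 * N))⁻¹ := by positivity
  by_cases hζ : ζ = 0
  · subst hζ
    have h0 : charMul 0 g = g := hat_ext fun ξ => by rw [hat_charMul, sub_zero]
    rw [if_pos rfl, h0, inner_self_eq_norm_sq_to_K, hg]
    simp only [RCLike.ofReal_one, one_pow, mul_one, sub_self, norm_zero]
    positivity
  · rw [if_neg hζ, sub_zero, norm_mul]
    -- For `|ζ| > Z` the trivial bound `1` is paid for by the weight, since `(1 + |ζ|²)^N ≥ Z^{2N}`.
    have key : ‖(inner ℂ g (charMul ζ g) : ℂ)‖ ≤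
        (b + (Z ^ (2 * N))⁻¹) * (1 + (normSq ζ : ℝ)) ^ N := by
      by_cases hs : (normSq ζ : ℝ) ≤ Z ^ 2
      · refine (h ζ hζ hs).trans ?_
        nlinarith [mul_le_mul_of_nonneg_left hpow (add_nonneg hb hZN.le)]
      · have e1 := norm_inner_le_norm (𝕜 := ℂ) g (charMul ζ g)
        rw [norm_charMul, hg, mul_one] at e1
        have e2 : Z ^ (2 * N) ≤ (1 + (normSq ζ : ℝ)) ^ N := by
          rw [pow_mul]
          gcongr
          linarith
        have e3 : 1 ≤ (Z ^ (2 * N))⁻¹ * (1 + (normSq ζ : ℝ)) ^ N := by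
          rw [inv_mul_eq_div, one_le_div (by positivity)]
          exact e2
        have e4 : 0 ≤ b * (1 + (normSq ζ : ℝ)) ^ N := by positivity
        linarith
    calc _ ≤ ‖coef a ζ‖ * ((b + (Z ^ (2 * N))⁻¹) * (1 + (normSq ζ : ℝ)) ^ N) := by gcongr
      _ = _ := by ring

lemma norm_hat_le (g : L2) (ξ : Freq) : ‖hat g ξ‖ ≤ ‖g‖ := by
  rw [← sq_le_sq₀ (norm_nonneg _) (norm_nonneg _)]
  exact le_hasSum (hasSum_norm_sq g) ξ fun _ _ => by positivity

lemma DeltaRel.norm_eq {x : Fin 2 → Torus} {g : L2} {lam : ℝ} {d : Fin 2 → ℂ}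
    (hd : DeltaRel x g ((lam : ℂ) • g) d) (ξ : Freq) :
    ‖d 0 * conj (character ξ (x 0)) + d 1 * conj (character ξ (x 1))‖ =
      2 * Real.pi * (|(normSq ξ : ℝ) - lam| * ‖hat g ξ‖) := by
  have h := hd ξ
  rw [hat_smul, Fin.sum_univ_two, ← sub_mul] at h
  have h' := congrArg norm h
  have e1 : ‖((normSq ξ : ℂ) - lam)‖ = |(normSq ξ : ℝ) - lam| := by
    rw [← Real.norm_eq_abs, ← Complex.norm_real]
    push_cast
    rfl
  rw [norm_mul, norm_mul, norm_neg, e1, Complex.norm_real,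
    Real.norm_of_nonneg (by have := Real.pi_pos; positivity)] at h'
  rw [h']
  have := Real.pi_pos
  field_simp

/-- A separating circle near the eigenvalue controls the strengths of the singularities. -/
lemma DeltaRel.norm_coeff_le {x : Fin 2 → Torus} {g : L2} {lam : ℝ} {d : Fin 2 → ℂ}
    (hd : DeltaRel x g ((lam : ℂ) • g) d) (hg : ‖g‖ = 1) {n : ℕ} {δ h : ℝ} (hδ : 0 < δ)
    (hsep : SepBy (x 1 - x 0) n δ) (hn : |(n : ℝ) - lam| ≤ h) :
    δ * (‖d 0‖ + ‖d 1‖) ≤ 12 * Real.pi * h := by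
  obtain ⟨ξ, ξ', hξ, hξ', hlt⟩ := hsep
  have hπ := Real.pi_pos
  -- Normalisation alone gives `|ĝ(ξ)| ≤ 1`, so on the circle the delta combination is at most `2π
  -- |n - λ|`.
  have hbound : ∀ ξ : Freq, normSq ξ = n →
      ‖d 0 + d 1 * conj (character ξ (x 1 - x 0))‖ ≤ 2 * Real.pi * h := by
    intro ξ hξ
    have h1 := hd.norm_eq ξ
    have h2 : d 0 + d 1 * conj (character ξ (x 1 - x 0)) =
        character ξ (x 0) *
          (d 0 * conj (character ξ (x 0)) + d 1 * conj (character ξ (x 1))) := by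
      have := character_conj_mul ξ (x 0)
      rw [character_map_sub, map_mul, Complex.conj_conj]
      linear_combination -(d 0) * this
    rw [h2, norm_mul, norm_character, one_mul, h1, hξ, Int.cast_natCast]
    have h3 := norm_hat_le g ξ
    rw [hg] at h3
    have h4 : |(n : ℝ) - lam| * ‖hat g ξ‖ ≤ h * 1 :=
      mul_le_mul hn h3 (norm_nonneg _) ((abs_nonneg _).trans hn)
    nlinarith
  have b1 := hbound ξ hξ
  have b2 := hbound ξ' hξ'
  -- Subtracting the bounds at the two separating frequencies eliminates `d 0` and leaves `d 1`
  -- times a phase difference larger than `δ`.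
  have h1 : ‖d 1‖ * δ ≤ 4 * Real.pi * h := by
    have e1 : d 1 * conj (character ξ (x 1 - x 0) - character ξ' (x 1 - x 0)) =
        (d 0 + d 1 * conj (character ξ (x 1 - x 0))) -
          (d 0 + d 1 * conj (character ξ' (x 1 - x 0))) := by
      rw [map_sub]; ring
    have e2 : ‖d 1‖ * ‖character ξ (x 1 - x 0) - character ξ' (x 1 - x 0)‖ ≤
        2 * Real.pi * h + 2 * Real.pi * h := by
      rw [← RCLike.norm_conj (character ξ (x 1 - x 0) - character ξ' (x 1 - x 0)), ← norm_mul, e1]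
      exact (norm_sub_le _ _).trans (add_le_add b1 b2)
    nlinarith [norm_nonneg (d 1)]
  have hδ2 : δ ≤ 2 := by
    have := norm_sub_le (character ξ (x 1 - x 0)) (character ξ' (x 1 - x 0))
    rw [norm_character, norm_character] at this
    linarith
  have h0 : ‖d 0‖ ≤ 2 * Real.pi * h + ‖d 1‖ := by
    have e1 : d 0 = (d 0 + d 1 * conj (character ξ (x 1 - x 0))) -
        d 1 * conj (character ξ (x 1 - x 0)) := by ring
    rw [e1]
    refine (norm_sub_le _ _).trans (add_le_add b1 (le_of_eq ?_))
    rw [norm_mul, RCLike.norm_conj, norm_character, mul_one]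
  have hh : 0 ≤ h := (abs_nonneg _).trans hn
  have h3 : 0 ≤ Real.pi * h := by positivity
  nlinarith

/-- Far from the eigenvalue there is little mass. -/
lemma DeltaRel.norm_hat_sq_le {x : Fin 2 → Torus} {g : L2} {lam : ℝ} {d : Fin 2 → ℂ}
    (hd : DeltaRel x g ((lam : ℂ) • g) d) (hg : ‖g‖ = 1) {n : ℕ} {δ h : ℝ} (hδ : 0 < δ)
    (hsep : SepBy (x 1 - x 0) n δ) (hn : |(n : ℝ) - lam| ≤ h) {ξ : Freq}
    (hξ : 2 * h < |(normSq ξ : ℝ) - n|) :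
    ‖hat g ξ‖ ^ 2 ≤ (12 * h / δ) ^ 2 * (1 / ((normSq ξ : ℝ) - n) ^ 2) := by
  have hπ := Real.pi_pos
  have hh : 0 ≤ h := (abs_nonneg _).trans hn
  have h1 := hd.norm_coeff_le hg hδ hsep hn
  have h2 := hd.norm_eq ξ
  have h3 : ‖d 0 * conj (character ξ (x 0)) + d 1 * conj (character ξ (x 1))‖ ≤ ‖d 0‖ + ‖d 1‖ := by
    refine (norm_add_le _ _).trans (le_of_eq ?_)
    simp only [norm_mul, RCLike.norm_conj, norm_character, mul_one]
  rw [h2] at h3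
  -- Because `|n - λ| ≤ h` is less than half of `||ξ|² - n|`, the denominator may be recentred at
  -- the integer `n`.
  have h4 : |(normSq ξ : ℝ) - n| ≤ 2 * |(normSq ξ : ℝ) - lam| := by
    have := abs_sub_le (normSq ξ : ℝ) lam n
    rw [abs_sub_comm lam] at this
    linarith
  have hm : 0 < |(normSq ξ : ℝ) - n| := by linarith
  have h5 : δ * (|(normSq ξ : ℝ) - n| * ‖hat g ξ‖) ≤ 12 * h := by
    have h6 : |(normSq ξ : ℝ) - n| * ‖hat g ξ‖ ≤ 2 * |(normSq ξ : ℝ) - lam| * ‖hat g ξ‖ := by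
      gcongr
    have h7 : Real.pi * (δ * (|(normSq ξ : ℝ) - n| * ‖hat g ξ‖)) ≤ Real.pi * (12 * h) := by
      calc Real.pi * (δ * (|(normSq ξ : ℝ) - n| * ‖hat g ξ‖))
          ≤ Real.pi * (δ * (2 * |(normSq ξ : ℝ) - lam| * ‖hat g ξ‖)) := by gcongr
        _ = δ * (2 * Real.pi * (|(normSq ξ : ℝ) - lam| * ‖hat g ξ‖)) := by ring
        _ ≤ δ * (‖d 0‖ + ‖d 1‖) := by gcongr
        _ ≤ _ := h1.trans_eq (by ring)
    exact le_of_mul_le_mul_left h7 hπ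
  have h8 : ‖hat g ξ‖ ≤ 12 * h / δ * (1 / |(normSq ξ : ℝ) - n|) := by
    rw [div_mul_div_comm, mul_one, le_div_iff₀ (by positivity)]
    linarith
  calc ‖hat g ξ‖ ^ 2 ≤ (12 * h / δ * (1 / |(normSq ξ : ℝ) - n|)) ^ 2 := by gcongr
    _ = _ := by rw [mul_pow, div_pow 1, sq_abs, one_pow]

/-- Equidistribution with a rate, for the eigenvalues that follow a non-exceptional sum of two
squares. -/
lemma exists_equidistribution_bound {s : ℝ} (hs : 0 < s) (hs1 : s ≤ 1 / 100) {a : Torus → ℂ}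
    (ha : IsSmooth a) :
    ∃ C : ℝ, 0 ≤ C ∧ ∀ (x : Fin 2 → Torus) (U : Matrix.unitaryGroup (Fin 2) ℂ) (lam : ℝ) (g : L2)
      (n : ℕ), IsEigenfunction x U lam g → ‖g‖ = 1 → 32 ≤ n → |(n : ℝ) - lam| ≤ (n : ℝ) ^ s →
      ¬ Exceptional (x 1 - x 0) s n →
      ‖(∫ y, a y * ((‖g y‖ ^ 2 : ℝ) : ℂ)) - (1 / (4 * Real.pi ^ 2) : ℝ) * ∫ y, a y‖ ≤
        C * (n : ℝ) ^ (-1 / 8 + 4 * s) := by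
  obtain ⟨C, hC, htail⟩ := sum_inv_sq_le hs (by linarith)
  -- With `N s ≥ 1` and `Z = n^s`, the truncation error `Z^{-2N}` is at most `n^{-2}`.
  obtain ⟨N, hN⟩ := exists_nat_ge (1 / s)
  have hN' : 1 ≤ N * s := by rwa [div_le_iff₀ hs] at hN
  set S := ∑' ξ, (1 + (normSq ξ : ℝ)) ^ N * ‖coef a ξ‖ with hS
  have hS0 : 0 ≤ S := tsum_nonneg fun ξ => by have := normSq_nonneg' ξ; positivity
  refine ⟨(2 * √(288 * C) + 1) * S, by positivity, fun x U lam g n he hg hn hlam hex => ?_⟩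
  obtain ⟨d, hd⟩ := he.exists_deltaRel
  simp only [Exceptional, not_or, not_not] at hex
  obtain ⟨-, hsep, hpair⟩ := hex
  have hn32 : (32 : ℝ) ≤ n := by exact_mod_cast hn
  have hn1 : (1 : ℝ) ≤ n := by linarith
  have hn0 : (0 : ℝ) < n := by linarith
  set L := (n : ℝ) ^ (1 / 4 - 2 * s) with hL
  have hL1 : 1 ≤ L := Real.one_le_rpow hn1 (by linarith)
  have h2L : 2 * (n : ℝ) ^ s ≤ L := by
    -- The threshold `32 = 2⁵` enters here: `n^{1/5} ≥ 2`, and `1/5 + s ≤ 1/4 - 2s` for `s ≤ 1/100`.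
    have h2 : (2 : ℝ) ≤ (n : ℝ) ^ (1 / 5 : ℝ) := by
      calc (2 : ℝ) = (32 : ℝ) ^ (1 / 5 : ℝ) := by
            rw [show (32 : ℝ) = 2 ^ (5 : ℝ) by norm_num, ← Real.rpow_mul (by norm_num)]
            norm_num
        _ ≤ _ := by gcongr
    calc 2 * (n : ℝ) ^ s ≤ (n : ℝ) ^ (1 / 5 : ℝ) * (n : ℝ) ^ s := by gcongr
      _ = (n : ℝ) ^ (1 / 5 + s) := by rw [← Real.rpow_add hn0]
      _ ≤ L := Real.rpow_le_rpow_of_exponent_le hn1 (by linarith)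
  -- `288 = 12² · 2`. The exponent collects `4s` from the squared strengths, `s` from the divisor
  -- bound and `-(1/4 - 2s)(1 - s)` from `L`, rounded up.
  set τ := 288 * C * (n : ℝ) ^ (-1 / 4 + 8 * s) with hτ
  have hfar : ∀ F : Finset Freq, (∀ ξ ∈ F, ¬ |(normSq ξ : ℝ) - n| ≤ L) →
      ∑ ξ ∈ F, ‖hat g ξ‖ ^ 2 ≤ τ := by
    intro F hF
    have hF' : ∀ ξ ∈ F, L < |(normSq ξ : ℝ) - n| := fun ξ hξ => not_le.1 (hF ξ hξ)
    have h1 := htail n L hL1 F fun ξ hξ => (hF' ξ hξ).le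
    calc ∑ ξ ∈ F, ‖hat g ξ‖ ^ 2
        ≤ ∑ ξ ∈ F, (12 * (n : ℝ) ^ s / (n : ℝ) ^ (-s)) ^ 2 * (1 / ((normSq ξ : ℝ) - n) ^ 2) :=
          Finset.sum_le_sum fun ξ hξ =>
            hd.norm_hat_sq_le hg (by positivity) hsep hlam (h2L.trans_lt (hF' ξ hξ))
      _ = (12 * (n : ℝ) ^ s / (n : ℝ) ^ (-s)) ^ 2 * ∑ ξ ∈ F, 1 / ((normSq ξ : ℝ) - n) ^ 2 := by
          rw [Finset.mul_sum]
      _ ≤ (12 * (n : ℝ) ^ s / (n : ℝ) ^ (-s)) ^ 2 *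
          (C * (2 * (n : ℝ) ^ s) * L ^ (-(1 - s))) := by
          refine mul_le_mul_of_nonneg_left (h1.trans ?_) (by positivity)
          have h2 : (1 + (n : ℝ)) ^ s ≤ 2 * (n : ℝ) ^ s := by
            calc (1 + (n : ℝ)) ^ s ≤ (2 * (n : ℝ)) ^ s := by gcongr; linarith
              _ = 2 ^ s * (n : ℝ) ^ s := Real.mul_rpow (by norm_num) hn0.le
              _ ≤ 2 ^ (1 : ℝ) * (n : ℝ) ^ s := by gcongr <;> linarith
              _ = _ := by rw [Real.rpow_one]
          gcongr
      _ = 288 * C * (n : ℝ) ^ (4 * s + s - (1 / 4 - 2 * s) * (1 - s)) := by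
          have e1 : (n : ℝ) ^ s / (n : ℝ) ^ (-s) = (n : ℝ) ^ (2 * s) := by
            rw [← Real.rpow_sub hn0]; congr 1; ring
          have e2 : L ^ (-(1 - s)) = (n : ℝ) ^ (-((1 / 4 - 2 * s) * (1 - s))) := by
            rw [hL, ← Real.rpow_mul hn0.le]; congr 1; ring
          have e3 : (n : ℝ) ^ (4 * s + s - (1 / 4 - 2 * s) * (1 - s)) =
              (n : ℝ) ^ (2 * s) * (n : ℝ) ^ (2 * s) * (n : ℝ) ^ s *
                (n : ℝ) ^ (-((1 / 4 - 2 * s) * (1 - s))) := by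
            simp only [← Real.rpow_add hn0]; congr 1; ring
          rw [mul_div_assoc, e1, e2, e3]
          ring
      _ ≤ τ := by
          have : (n : ℝ) ^ (4 * s + s - (1 / 4 - 2 * s) * (1 - s)) ≤ (n : ℝ) ^ (-1 / 4 + 8 * s) :=
            Real.rpow_le_rpow_of_exponent_le hn1 (by nlinarith)
          rw [hτ]
          gcongr
  have hsq : √τ = √(288 * C) * (n : ℝ) ^ (-1 / 8 + 4 * s) := by
    rw [hτ, Real.sqrt_mul (by positivity), Real.sqrt_eq_rpow ((n : ℝ) ^ (-1 / 4 + 8 * s)),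
      ← Real.rpow_mul hn0.le]
    congr 2
    ring
  have hmain := norm_integral_sub_le ha hg (Z := (n : ℝ) ^ s) (b := 2 * √τ) (by positivity)
    (by positivity) N fun ζ hζ hζn =>
      norm_inner_charMul_le hg (near := fun ξ => |(normSq ξ : ℝ) - n| ≤ L) (fun ξ h1 h2 =>
        hpair ⟨ξ - ζ, ζ, hζ, hζn, h2, by rwa [sub_add_cancel]⟩) hfar
  refine hmain.trans ?_
  have hZ : (((n : ℝ) ^ s) ^ (2 * N))⁻¹ ≤ (n : ℝ) ^ (-1 / 8 + 4 * s) := by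
    rw [← Real.rpow_natCast, ← Real.rpow_mul hn0.le, ← Real.rpow_neg hn0.le]
    refine Real.rpow_le_rpow_of_exponent_le hn1 ?_
    push_cast
    linarith
  rw [hsq]
  calc _ ≤ (2 * (√(288 * C) * (n : ℝ) ^ (-1 / 8 + 4 * s)) + (n : ℝ) ^ (-1 / 8 + 4 * s)) * S := by
        gcongr
    _ = _ := by ring

/-! ### Neighbouring sums of two squares -/

lemma isNorm_zero : IsNorm 0 := ⟨0, by simp [normSq]⟩

lemma isNorm_sq (m : ℕ) : IsNorm (m ^ 2) := ⟨![m, 0], by simp [normSq]⟩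

/-- The next sum of two squares. -/
def nextNorm (n : ℕ) : ℕ := sInf {m | IsNorm m ∧ n < m}

lemma nextNorm_mem (n : ℕ) : IsNorm (nextNorm n) ∧ n < nextNorm n :=
  Nat.sInf_mem (s := {m | IsNorm m ∧ n < m}) ⟨(n + 1) ^ 2, isNorm_sq _, by nlinarith⟩

lemma nextNorm_le {n m : ℕ} (hm : IsNorm m) (h : n < m) : nextNorm n ≤ m := Nat.sInf_le ⟨hm, h⟩

lemma nextNorm_injOn : Set.InjOn nextNorm {n | IsNorm n} := by
  intro n hn m hm h
  by_contra hne
  rcases lt_or_gt_of_ne hne with h1 | h1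
  · have := nextNorm_le hm h1
    have := (nextNorm_mem m).2
    lia
  · have := nextNorm_le hn h1
    have := (nextNorm_mem n).2
    lia

lemma normSq_notMem_Ioo (n : ℕ) (ξ : Freq) : (normSq ξ : ℝ) ∉ Set.Ioo (n : ℝ) (nextNorm n) := by
  rintro ⟨h1, h2⟩
  obtain ⟨m, hm⟩ := Int.eq_ofNat_of_zero_le (normSq_nonneg ξ)
  rw [hm, Int.cast_natCast, Nat.cast_lt] at h1 h2
  exact absurd (nextNorm_le ⟨ξ, hm⟩ h1) (not_le.2 h2)

/-- The last sum of two squares before `t`. -/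
def prevNorm (t : ℝ) : ℕ := sSup {m | IsNorm m ∧ (m : ℝ) < t}

lemma bddAbove_norms (t : ℝ) : BddAbove {m : ℕ | IsNorm m ∧ (m : ℝ) < t} :=
  ⟨⌈t⌉₊, fun _ hm => by exact_mod_cast hm.2.le.trans (Nat.le_ceil t)⟩

lemma prevNorm_mem {t : ℝ} (ht : 0 < t) : IsNorm (prevNorm t) ∧ (prevNorm t : ℝ) < t :=
  Nat.sSup_mem (s := {m : ℕ | IsNorm m ∧ (m : ℝ) < t}) ⟨0, isNorm_zero, by simpa using ht⟩
    (bddAbove_norms t)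

lemma le_prevNorm {t : ℝ} {m : ℕ} (hm : IsNorm m) (h : (m : ℝ) < t) : m ≤ prevNorm t :=
  le_csSup (bddAbove_norms t) ⟨hm, h⟩

lemma isLaplaceEigenvalue_of_isNorm {n : ℕ} (hn : IsNorm n) : IsLaplaceEigenvalue n := by
  obtain ⟨ξ, hξ⟩ := hn
  exact (isLaplaceEigenvalue_iff _).2 ⟨ξ, by rw [hξ]; simp⟩

lemma mem_Ioo_prevNorm {t : ℝ} (ht : 0 < t) (h : ¬ IsLaplaceEigenvalue t) :
    t ∈ Set.Ioo (prevNorm t : ℝ) (nextNorm (prevNorm t)) := by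
  refine ⟨(prevNorm_mem ht).2, ?_⟩
  by_contra hle
  have hmem := nextNorm_mem (prevNorm t)
  rcases (not_lt.1 hle).lt_or_eq with h1 | h1
  · have := le_prevNorm hmem.1 h1
    lia
  · exact h (h1 ▸ isLaplaceEigenvalue_of_isNorm hmem.1)

lemma prevNorm_eq {n : ℕ} (hn : IsNorm n) {t : ℝ} (ht : t ∈ Set.Ioo (n : ℝ) (nextNorm n)) :
    prevNorm t = n := by
  have h0 : 0 < t := (Nat.cast_nonneg n).trans_lt ht.1
  refine le_antisymm ?_ (le_prevNorm hn ht.1)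
  by_contra hlt
  have h1 := nextNorm_le (prevNorm_mem h0).1 (not_le.1 hlt)
  have h2 : ((prevNorm t : ℕ) : ℝ) < nextNorm n := (prevNorm_mem h0).2.trans ht.2
  rw [Nat.cast_lt] at h2
  lia

lemma finite_norms (X : ℝ) : {n : ℕ | IsNorm n ∧ (n : ℝ) ≤ X}.Finite :=
  (Set.finite_Iic ⌊X⌋₊).subset fun _ hn => Nat.le_floor hn.2

/-! ### Eigenvalue counting per spectral gap -/

section Basis

variable {x : Fin 2 → Torus} {U : Matrix.unitaryGroup (Fin 2) ℂ} {φ : ℕ → L2} {lam : ℕ → ℝ}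

/-- Every perturbed eigenvalue occurs in a perturbed basis. -/
lemma IsPerturbedBasis.exists_eq (hφ : IsPerturbedBasis x U φ lam) (hx : x 0 ≠ x 1) {t : ℝ} {g : L2}
    (hg : IsPerturbedEigenfunction x U t g) : ∃ k, lam k = t := by
  by_contra! hne
  -- An eigenfunction whose eigenvalue is missed is orthogonal to the whole basis by symmetry, yet
  -- lies in its closed span, hence would be zero.
  have h1 : g ∈ (Submodule.span ℂ (Set.range φ))ᗮ := by
    rw [Submodule.mem_orthogonal]
    intro u hu
    induction hu using Submodule.span_induction with
    | mem u hu =>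
      obtain ⟨k, rfl⟩ := hu
      exact (hφ.eigenfunction k).1.inner_eq_zero hx hg.1 (hne k)
    | zero => exact inner_zero_left _
    | add u v _ _ hu hv => rw [inner_add_left, hu, hv, add_zero]
    | smul c u _ hu => rw [inner_smul_left, hu, mul_zero]
  rw [← Submodule.orthogonal_closure, hφ.span_eq] at h1
  have h2 : g ∈ perturbedSubspace x U :=
    Submodule.le_topologicalClosure _ (Submodule.subset_span ⟨t, hg⟩)
  exact hg.1.1 (inner_self_eq_zero.1 ((Submodule.mem_orthogonal _ _).1 h1 g h2))

lemma IsPerturbedBasis.card_le_two (hφ : IsPerturbedBasis x U φ lam) {a b : ℝ}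
    (hab : ∀ ξ : Freq, (normSq ξ : ℝ) ∉ Set.Ioo a b) (F : Finset ℕ)
    (hF : ∀ k ∈ F, lam k ∈ Set.Ioo a b) : F.card ≤ 2 := by
  by_contra hlt
  obtain ⟨i, j, k, hi, hj, hk, hij, hik, hjk⟩ := Finset.two_lt_card_iff.1 (not_le.1 hlt)
  have hinj : Function.Injective ![i, j, k] := by
    intro p q
    fin_cases p <;> fin_cases q <;> simp [hij, hik, hjk, hij.symm, hik.symm, hjk.symm]
  refine not_three_eigenvalues hab (hφ.orthonormal.comp _ hinj) (lam := lam ∘ ![i, j, k])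
    (fun p => (hφ.eigenfunction _).1) (fun p => ?_)
  fin_cases p
  exacts [hF i hi, hF j hj, hF k hk]

/-- The half-line below `0` is a gap of the Laplace spectrum, and the value `0` is excluded because
it is itself a Laplace eigenvalue. -/
lemma IsPerturbedBasis.card_nonpos_le (hφ : IsPerturbedBasis x U φ lam) (F : Finset ℕ)
    (hF : ∀ k ∈ F, lam k ≤ 0) : F.card ≤ 2 := by
  obtain ⟨a, ha⟩ := (F.finite_toSet.image lam).bddBelow
  refine hφ.card_le_two (a := a - 1) (b := 0)
    (fun ξ h => absurd h.2 (not_lt.2 (normSq_nonneg' ξ))) F fun k hk => ?_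
  refine ⟨?_, (hF k hk).lt_of_ne fun h => (hφ.eigenfunction k).2 ?_⟩
  · have := ha ⟨k, hk, rfl⟩
    linarith
  · rw [h]
    simpa using isLaplaceEigenvalue_of_isNorm isNorm_zero

lemma IsPerturbedBasis.card_le_image (hφ : IsPerturbedBasis x U φ lam) (F : Finset ℕ)
    (hF : ∀ k ∈ F, 0 < lam k) : F.card ≤ 2 * (F.image fun k => prevNorm (lam k)).card := by
  refine Finset.card_le_mul_card_image F 2 fun n _ => ?_
  refine hφ.card_le_two (normSq_notMem_Ioo n) _ fun k hk => ?_
  obtain ⟨hkF, rfl⟩ := Finset.mem_filter.1 hk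
  exact mem_Ioo_prevNorm (hF k hkF) (hφ.eigenfunction k).2

lemma IsPerturbedBasis.finite_le (hφ : IsPerturbedBasis x U φ lam) (X : ℝ) :
    {k | lam k ≤ X}.Finite := by
  classical
  by_contra hinf
  set M := (finite_norms X).toFinset.card with hM
  -- One more than the allowed total: two nonpositive eigenvalues and two for each of the `M` gaps.
  obtain ⟨F, hF, hcard⟩ := Set.Infinite.exists_subset_card_eq hinf (2 * M + 3)
  have h1 := hφ.card_nonpos_le (F.filter fun k => lam k ≤ 0) fun k hk => (Finset.mem_filter.1 hk).2
  have h2 := hφ.card_le_image (F.filter fun k => ¬ lam k ≤ 0)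
    fun k hk => not_le.1 (Finset.mem_filter.1 hk).2
  have h3 : ((F.filter fun k => ¬ lam k ≤ 0).image fun k => prevNorm (lam k)).card ≤ M := by
    refine Finset.card_le_card fun n hn => ?_
    obtain ⟨k, hk, rfl⟩ := Finset.mem_image.1 hn
    obtain ⟨hk, h0⟩ := Finset.mem_filter.1 hk
    have := prevNorm_mem (not_le.1 h0)
    have hX : lam k ≤ X := hF hk
    exact (finite_norms X).mem_toFinset.2 ⟨this.1, this.2.le.trans hX⟩
  have h4 := Finset.card_filter_add_card_filter_not (s := F) fun k => lam k ≤ 0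
  lia

end Basis

/-! ### Subsequences of density one -/

/-- A subset whose complement is negligible can be enumerated by a subsequence of density one. -/
lemma exists_densityOne {lam : ℕ → ℝ} (hfin : ∀ X, {k | lam k ≤ X}.Finite) (S : Set ℕ)
    (hN : Tendsto (fun X : ℝ => (Set.ncard {k | lam k ≤ X} : ℝ)) atTop atTop)
    (hS : Tendsto (fun X : ℝ => (Set.ncard {k | lam k ≤ X ∧ k ∉ S} : ℝ) /
      (Set.ncard {k | lam k ≤ X} : ℝ)) atTop (𝓝 0)) :
    ∃ k : ℕ → ℕ, StrictMono k ∧ DensityOne lam k ∧ ∀ j, k j ∈ S := by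
  have hsplit : ∀ X, (Set.ncard {k | lam k ≤ X ∧ k ∈ S} : ℝ) +
      (Set.ncard {k | lam k ≤ X ∧ k ∉ S} : ℝ) = (Set.ncard {k | lam k ≤ X} : ℝ) := by
    intro X
    have h := Set.ncard_inter_add_ncard_sdiff_eq_ncard {k | lam k ≤ X} S (hfin X)
    exact_mod_cast h
  have hratio : Tendsto (fun X : ℝ => (Set.ncard {k | lam k ≤ X ∧ k ∈ S} : ℝ) /
      (Set.ncard {k | lam k ≤ X} : ℝ)) atTop (𝓝 1) := by
    have h1 : Tendsto (fun X : ℝ => 1 - (Set.ncard {k | lam k ≤ X ∧ k ∉ S} : ℝ) /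
      (Set.ncard {k | lam k ≤ X} : ℝ)) atTop (𝓝 (1 - 0)) := tendsto_const_nhds.sub hS
    rw [sub_zero] at h1
    refine h1.congr' ?_
    filter_upwards [hN.eventually_gt_atTop 0] with X hX
    rw [← hsplit X] at hX ⊢
    field_simp
    ring
  -- A finite `S` would have density zero. Infinitude makes `Nat.nth` a strictly increasing
  -- enumeration of `S`, so the counts agree exactly.
  have hinf : S.Infinite := by
    intro hf
    have h2 : Tendsto (fun X : ℝ => (Set.ncard {k | lam k ≤ X ∧ k ∈ S} : ℝ) /
        (Set.ncard {k | lam k ≤ X} : ℝ)) atTop (𝓝 0) := by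
      refine squeeze_zero (fun X => by positivity) (fun X => ?_)
        (tendsto_const_nhds (x := (S.ncard : ℝ)).div_atTop hN)
      gcongr
      exact fun k hk => hk.2
    exact zero_ne_one (tendsto_nhds_unique h2 hratio)
  refine ⟨Nat.nth (· ∈ S), Nat.nth_strictMono hinf, ?_, fun j => Nat.nth_mem_of_infinite hinf j⟩
  refine hratio.congr fun X => ?_
  congr 2
  have himg : {k | lam k ≤ X ∧ k ∈ S} =
      Nat.nth (· ∈ S) '' {j | lam (Nat.nth (· ∈ S) j) ≤ X} := by
    ext k
    constructor
    · rintro ⟨h1, h2⟩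
      have : k ∈ Set.range (Nat.nth (· ∈ S)) := by
        rw [Nat.range_nth_of_infinite (p := (· ∈ S)) hinf]; exact h2
      obtain ⟨j, rfl⟩ := this
      exact ⟨j, h1, rfl⟩
    · rintro ⟨j, hj, rfl⟩
      exact ⟨hj, Nat.nth_mem_of_infinite hinf j⟩
  rw [himg, Set.ncard_image_of_injective _ (Nat.nth_injective (p := (· ∈ S)) hinf)]

/-- The error `X^{1-η}` is smaller than the main term by `X^{-η/2}`, so eventually half of the main
term absorbs it. -/
lemma tendsto_atTop_of_rpow_le {N : ℝ → ℝ} {c D η : ℝ} (hc : 0 < c) (hη : 0 < η) (hη1 : η < 1)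
    (h : ∀ X, 1 ≤ X → c * X ^ (1 - η / 2) ≤ N X + D * X ^ (1 - η)) :
    ∀ᶠ X in atTop, c / 2 * X ^ (1 - η / 2) ≤ N X := by
  have h0 : Tendsto (fun X : ℝ => D * X ^ (-(η / 2))) atTop (𝓝 (D * 0)) :=
    (tendsto_rpow_neg_atTop (by positivity)).const_mul D
  rw [mul_zero] at h0
  filter_upwards [h0.eventually_lt_const (show 0 < c / 2 by positivity), eventually_ge_atTop 1]
    with X hX hX1
  have hX0 : 0 < X := by linarith
  have h2 := h X hX1
  have h3 : X ^ (1 - η) = X ^ (-(η / 2)) * X ^ (1 - η / 2) := by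
    rw [← Real.rpow_add hX0]; congr 1; ring
  have h4 : 0 ≤ X ^ (1 - η / 2) := by positivity
  rw [h3] at h2
  nlinarith

section Basis

variable {x : Fin 2 → Torus} {U : Matrix.unitaryGroup (Fin 2) ℂ} {φ : ℕ → L2} {lam : ℕ → ℝ}

/-- The indices whose eigenvalue lies just after a large non-exceptional sum of two squares. -/
def regularIndices (y : Torus) (s : ℝ) (lam : ℕ → ℝ) : Set ℕ :=
  {k | 0 < lam k ∧ 32 ≤ prevNorm (lam k) ∧ ¬ Exceptional y s (prevNorm (lam k))}

/-- `66 = 2 + 2 · 32` counts the nonpositive eigenvalues and those preceded by a sum of two squares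
below `32`; all others follow an exceptional one, at most two for each. -/
lemma IsPerturbedBasis.ncard_irregular_le (hφ : IsPerturbedBasis x U φ lam) {y : Torus}
    {s C η : ℝ} (hη1 : η < 1)
    (hex : ∀ X : ℝ, 1 ≤ X → ∀ F : Finset ℕ,
      (∀ n ∈ F, IsNorm n ∧ (n : ℝ) ≤ X ∧ Exceptional y s n) → (F.card : ℝ) ≤ C * X ^ (1 - η))
    {X : ℝ} (hX : 1 ≤ X) :
    (Set.ncard {k | lam k ≤ X ∧ k ∉ regularIndices y s lam} : ℝ) ≤ (66 + 2 * C) * X ^ (1 - η) := by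
  classical
  have hfin : {k | lam k ≤ X ∧ k ∉ regularIndices y s lam}.Finite :=
    (hφ.finite_le X).subset fun k hk => hk.1
  rw [Set.ncard_eq_toFinset_card _ hfin]
  set F := hfin.toFinset with hF
  have h1 := hφ.card_nonpos_le (F.filter fun k => lam k ≤ 0) fun k hk => (Finset.mem_filter.1 hk).2
  have h2 := hφ.card_le_image (F.filter fun k => ¬ lam k ≤ 0)
    fun k hk => not_le.1 (Finset.mem_filter.1 hk).2
  set G := (F.filter fun k => ¬ lam k ≤ 0).image fun k => prevNorm (lam k) with hG
  have hGmem : ∀ n ∈ G, IsNorm n ∧ (n : ℝ) ≤ X ∧ (32 ≤ n → Exceptional y s n) := by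
    intro n hn
    obtain ⟨k, hk, rfl⟩ := Finset.mem_image.1 hn
    obtain ⟨hk, h0⟩ := Finset.mem_filter.1 hk
    obtain ⟨hkX, hkS⟩ := hfin.mem_toFinset.1 hk
    have := prevNorm_mem (not_le.1 h0)
    refine ⟨this.1, this.2.le.trans hkX, fun h32 => ?_⟩
    by_contra hne
    exact hkS ⟨not_le.1 h0, h32, hne⟩
  have h3 : (G.filter fun n => n < 32).card ≤ 32 := by
    refine (Finset.card_le_card fun n hn => ?_).trans_eq (Finset.card_range 32)
    exact Finset.mem_range.2 (Finset.mem_filter.1 hn).2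
  have h4 := hex X hX (G.filter fun n => ¬ n < 32) fun n hn => by
    obtain ⟨hn, h32⟩ := Finset.mem_filter.1 hn
    obtain ⟨e1, e2, e3⟩ := hGmem n hn
    exact ⟨e1, e2, e3 (not_lt.1 h32)⟩
  have h5 := Finset.card_filter_add_card_filter_not (s := F) fun k => lam k ≤ 0
  have h6 := Finset.card_filter_add_card_filter_not (s := G) fun n => n < 32
  have h7 : F.card ≤ 66 + 2 * (G.filter fun n => ¬ n < 32).card := by lia
  have h8 : (F.card : ℝ) ≤ 66 + 2 * ((G.filter fun n => ¬ n < 32).card : ℝ) := by exact_mod_cast h7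
  have h9 : 1 ≤ X ^ (1 - η) := Real.one_le_rpow hX (by linarith)
  linarith

/-- Each `n` either starts a gap containing some `lam k`, from which `prevNorm` recovers it, or is
exceptional, or has an exceptional successor, or is the last one up to `X`. The two exceptional
cases give `2 * C`. -/
lemma IsPerturbedBasis.ncard_norms_le (hφ : IsPerturbedBasis x U φ lam) (hx : x 0 ≠ x 1)
    (hU : (U : Matrix (Fin 2) (Fin 2) ℂ) ≠ -1) {s C η : ℝ} (hη1 : η < 1)
    (hex : ∀ X : ℝ, 1 ≤ X → ∀ F : Finset ℕ,
      (∀ n ∈ F, IsNorm n ∧ (n : ℝ) ≤ X ∧ Exceptional (x 1 - x 0) s n) →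
        (F.card : ℝ) ≤ C * X ^ (1 - η))
    {X : ℝ} (hX : 1 ≤ X) :
    (Set.ncard {n : ℕ | IsNorm n ∧ (n : ℝ) ≤ X} : ℝ) ≤
      (Set.ncard {k | lam k ≤ X} : ℝ) + (1 + 2 * C) * X ^ (1 - η) := by
  classical
  have hfin := finite_norms X
  rw [Set.ncard_eq_toFinset_card _ hfin, Set.ncard_eq_toFinset_card _ (hφ.finite_le X)]
  set A := hfin.toFinset with hA
  have hAm : ∀ {n}, n ∈ A ↔ IsNorm n ∧ (n : ℝ) ≤ X := fun {n} => hfin.mem_toFinset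
  set K := (hφ.finite_le X).toFinset with hK
  set E := Exceptional (x 1 - x 0) s with hE
  set A1 := A.filter E with hA1
  set A2 := A.filter fun n => nextNorm n ∈ A ∧ E (nextNorm n) with hA2
  set A3 := A.filter fun n => nextNorm n ∉ A with hA3
  have hsub : A ⊆ K.image (fun k => prevNorm (lam k)) ∪ A1 ∪ A2 ∪ A3 := by
    intro n hn
    by_cases h1 : E n
    · simp [hA1, hn, h1]
    by_cases h3 : nextNorm n ∈ A
    swap
    · simp [hA3, hn, h3]
    by_cases h2 : E (nextNorm n)
    · simp [hA2, hn, h3, h2]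
    have hsep : ∀ m, ¬ E m → SeparatesScatterers (x 1 - x 0) m := fun m hm => by
      simp only [hE, Exceptional, not_or, not_not] at hm
      exact hm.2.1.separatesScatterers (by positivity)
    have hnext := nextNorm_mem n
    obtain ⟨t, ht, g, hg⟩ := exists_perturbedEigenfunction hx hU hnext.2 (normSq_notMem_Ioo n)
      (hsep n h1) (hsep _ h2)
    obtain ⟨k, rfl⟩ := hφ.exists_eq hx hg
    have hkK : k ∈ K := (hφ.finite_le X).mem_toFinset.2 (ht.2.le.trans (hAm.1 h3).2)
    simp only [Finset.mem_union, Finset.mem_image]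
    exact Or.inl (Or.inl (Or.inl ⟨k, hkK, prevNorm_eq (hAm.1 hn).1 ht⟩))
  have b0 : (K.image fun k => prevNorm (lam k)).card ≤ K.card := Finset.card_image_le
  have b1 := hex X hX A1 fun n hn => by
    obtain ⟨hn, h⟩ := Finset.mem_filter.1 hn
    exact ⟨(hAm.1 hn).1, (hAm.1 hn).2, h⟩
  have hinj : Set.InjOn nextNorm A2 := fun n hn m hm h =>
    nextNorm_injOn (hAm.1 (Finset.mem_filter.1 hn).1).1 (hAm.1 (Finset.mem_filter.1 hm).1).1 h
  have b2 := hex X hX (A2.image nextNorm) fun n hn => by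
    obtain ⟨m, hm, rfl⟩ := Finset.mem_image.1 hn
    obtain ⟨hm, h, h'⟩ := Finset.mem_filter.1 hm
    exact ⟨(hAm.1 h).1, (hAm.1 h).2, h'⟩
  rw [Finset.card_image_of_injOn hinj] at b2
  have b3 : A3.card ≤ 1 := by
    refine Finset.card_le_one.2 fun n hn m hm => ?_
    obtain ⟨hn, hn'⟩ := Finset.mem_filter.1 hn
    obtain ⟨hm, hm'⟩ := Finset.mem_filter.1 hm
    have key : ∀ p q, p ∈ A → q ∈ A → nextNorm p ∉ A → ¬ p < q := fun p q hp hq hp' hlt => by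
      refine hp' (hAm.2 ⟨(nextNorm_mem p).1, le_trans ?_ (hAm.1 hq).2⟩)
      exact_mod_cast nextNorm_le (hAm.1 hq).1 hlt
    have := key n m hn hm hn'
    have := key m n hm hn hm'
    lia
  have hcard : A.card ≤ K.card + A1.card + A2.card + A3.card := by
    have e1 := Finset.card_le_card hsub
    have e2 := Finset.card_union_le (K.image (fun k => prevNorm (lam k)) ∪ A1 ∪ A2) A3
    have e3 := Finset.card_union_le (K.image (fun k => prevNorm (lam k)) ∪ A1) A2
    have e4 := Finset.card_union_le (K.image fun k => prevNorm (lam k)) A1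
    lia
  have hcard' : (A.card : ℝ) ≤ K.card + A1.card + A2.card + 1 := by
    have : A.card ≤ K.card + A1.card + A2.card + 1 := by lia
    exact_mod_cast this
  have h9 : 1 ≤ X ^ (1 - η) := Real.one_le_rpow hX (by linarith)
  linarith

/-- The regular indices can be enumerated with density one. -/
lemma IsPerturbedBasis.exists_regular_subsequence (hφ : IsPerturbedBasis x U φ lam)
    (hx : x 0 ≠ x 1) (hU : (U : Matrix (Fin 2) (Fin 2) ℂ) ≠ -1)
    {α : EuclideanSpace ℝ (Fin 2)} (hα : proj α = x 1 - x 0)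
    (hD : Diophantine fun i => α i / Real.pi) {s : ℝ} (hs : 0 < s) (hs1 : s ≤ 1 / 100) :
    ∃ k : ℕ → ℕ, StrictMono k ∧ DensityOne lam k ∧ ∀ j, k j ∈ regularIndices (x 1 - x 0) s lam := by
  obtain ⟨C, η, hC, hη, hη1, hex⟩ := card_exceptional_le hD hs hs1
  rw [hα] at hex
  -- The exponent `η / 2` makes the lower bound beat the exceptional count: the irregular proportion
  -- is `O(X^{-η/2})`.
  obtain ⟨c, hc, hnorm⟩ := card_isNorm_ge (e := η / 2) (by positivity)
  have hlow := tendsto_atTop_of_rpow_le (N := fun X => (Set.ncard {k | lam k ≤ X} : ℝ))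
    (D := 1 + 2 * C) hc hη hη1
    fun X hX => (hnorm X hX).trans (hφ.ncard_norms_le hx hU hη1 hex hX)
  refine exists_densityOne hφ.finite_le _ ?_ ?_
  · exact tendsto_atTop_mono' _ hlow
      ((tendsto_rpow_atTop (by linarith)).const_mul_atTop (by positivity))
  · have h0 : Tendsto (fun X : ℝ => (66 + 2 * C) / (c / 2) * X ^ (-(η / 2))) atTop
        (𝓝 ((66 + 2 * C) / (c / 2) * 0)) := (tendsto_rpow_neg_atTop (by positivity)).const_mul _
    rw [mul_zero] at h0
    refine squeeze_zero' (Eventually.of_forall fun X => by positivity) ?_ h0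
    filter_upwards [hlow, eventually_ge_atTop 1] with X h1 hX
    have hX0 : 0 < X := by linarith
    have h2 := hφ.ncard_irregular_le hη1 hex hX
    calc _ ≤ (66 + 2 * C) * X ^ (1 - η) / (c / 2 * X ^ (1 - η / 2)) := by gcongr
      _ = _ := by
        have h3 : X ^ (1 - η) = X ^ (-(η / 2)) * X ^ (1 - η / 2) := by
          rw [← Real.rpow_add hX0]; congr 1; ring
        have h4 : X ^ (1 - η / 2) ≠ 0 := by positivity
        rw [h3]
        field_simp

end Basis

/-- Diophantine vectors are not lattice vectors. -/
lemma Diophantine.proj_ne_zero {α : EuclideanSpace ℝ (Fin 2)}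
    (hD : Diophantine fun i => α i / Real.pi) : proj α ≠ 0 := by
  intro h
  obtain ⟨κ, C, hC, hκ⟩ := hD
  have h1 : ∀ i, ∃ p : ℤ, α i / Real.pi = p := fun i => by
    have h2 : ((α i : ℝ) : AddCircle (2 * Real.pi)) = 0 := congrFun h i
    obtain ⟨m, hm⟩ := (AddCircle.coe_eq_zero_iff _).1 h2
    refine ⟨2 * m, ?_⟩
    rw [← hm]
    have := Real.pi_ne_zero
    simp
    field_simp
  choose p hp using h1
  have h2 := hκ p 1 one_pos
  simp only [hp] at h2
  simp at h2
  linarith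

/-- Converts a rate in `n` into a rate in the eigenvalue: `lam ≤ 2n`, and the exponent is negative
but above `-1`, so a factor `2` suffices. -/
lemma rpow_le_of_close {n lam s ε : ℝ} (hn : 1 ≤ n) (hlam : n < lam) (hlam2 : lam ≤ n + n ^ s)
    (hs : 0 < s) (hs1 : s ≤ 1 / 100) (hsε : 4 * s ≤ ε) :
    n ^ (-1 / 8 + 4 * s) ≤ 2 * lam ^ (-1 / 8 + ε) := by
  have hn0 : 0 < n := by linarith
  have h0 : 0 < lam := by linarith
  have h1 : n ^ s ≤ n := by
    conv_rhs => rw [← Real.rpow_one n]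
    exact Real.rpow_le_rpow_of_exponent_le hn (by linarith)
  have h2 : n ^ (-1 / 8 + 4 * s) ≤ (lam / 2) ^ (-1 / 8 + 4 * s) :=
    Real.rpow_le_rpow_of_nonpos (by positivity) (by linarith) (by linarith)
  rw [Real.div_rpow h0.le (by norm_num)] at h2
  have h3 : (1 / 2 : ℝ) ≤ 2 ^ (-1 / 8 + 4 * s) := by
    calc (1 / 2 : ℝ) = 2 ^ (-1 : ℝ) := by rw [Real.rpow_neg_one]; norm_num
      _ ≤ _ := Real.rpow_le_rpow_of_exponent_le (by norm_num) (by linarith)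
  calc _ ≤ _ := h2
    _ ≤ lam ^ (-1 / 8 + 4 * s) / (1 / 2) := by gcongr
    _ = 2 * lam ^ (-1 / 8 + 4 * s) := by ring
    _ ≤ 2 * lam ^ (-1 / 8 + ε) := by
      gcongr
      linarith

end TwoScatterers

end

open TwoScatterers in
theorem corollary1p2
    (x₁ x₂ : TwoScatterers.Torus)
    (α : EuclideanSpace ℝ (Fin 2)) (hα : TwoScatterers.proj α = x₂ - x₁)
    (hD : TwoScatterers.Diophantine fun i => α i / Real.pi)
    (U : Matrix.unitaryGroup (Fin 2) ℂ) (hU : (U : Matrix (Fin 2) (Fin 2) ℂ) ≠ -1)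
    (φ : ℕ → TwoScatterers.L2) (lam : ℕ → ℝ)
    (hφ : TwoScatterers.IsPerturbedBasis ![x₁, x₂] U φ lam)
    (ε : ℝ) (hε : 0 < ε) :
    ∃ k : ℕ → ℕ, StrictMono k ∧ TwoScatterers.DensityOne lam k ∧
      ∀ a : TwoScatterers.Torus → ℂ, TwoScatterers.IsSmooth a →
        (fun j : ℕ => (∫ x, a x * ((‖φ (k j) x‖ ^ 2 : ℝ) : ℂ)) -
            (1 / (4 * Real.pi ^ 2) : ℝ) * ∫ x, a x)
          =O[atTop] fun j : ℕ => lam (k j) ^ (-1 / 8 + ε) := by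
  -- The rate obtained is `n^{-1/8 + 4s}`, so `4s ≤ ε` is required. The choice depends on `ε` only,
  -- so one subsequence serves all observables.
  set s : ℝ := min (ε / 4) (1 / 100) with hs
  have hs0 : 0 < s := lt_min (by positivity) (by norm_num)
  have hs1 : s ≤ 1 / 100 := min_le_right _ _
  have hsε : 4 * s ≤ ε := by linarith [min_le_left (ε / 4) (1 / 100)]
  have hx : (![x₁, x₂] : Fin 2 → Torus) 0 ≠ ![x₁, x₂] 1 := fun h =>
    hD.proj_ne_zero (by rw [hα]; exact sub_eq_zero.2 h.symm)
  obtain ⟨k, hk, hdens, hreg⟩ := hφ.exists_regular_subsequence hx hU hα hD hs0 hs1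
  refine ⟨k, hk, hdens, fun a ha => ?_⟩
  obtain ⟨C, hC, hbound⟩ := exists_equidistribution_bound hs0 hs1 ha
  refine IsBigO.of_bound (C * 2) (Eventually.of_forall fun j => ?_)
  obtain ⟨hpos, h32, hex⟩ := hreg j
  have hmem := mem_Ioo_prevNorm hpos (hφ.eigenfunction (k j)).2
  have hgap : (nextNorm (prevNorm (lam (k j))) : ℝ) ≤
      prevNorm (lam (k j)) + (prevNorm (lam (k j)) : ℝ) ^ s := by
    have h := hex
    simp only [Exceptional, not_or] at h
    obtain ⟨m, hm, hlt, hle⟩ : ∃ m, IsNorm m ∧ prevNorm (lam (k j)) < m ∧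
        (m : ℝ) ≤ prevNorm (lam (k j)) + (prevNorm (lam (k j)) : ℝ) ^ s := by
      simpa using h.1
    exact le_trans (by exact_mod_cast nextNorm_le hm hlt) hle
  have hclose : |(prevNorm (lam (k j)) : ℝ) - lam (k j)| ≤ (prevNorm (lam (k j)) : ℝ) ^ s := by
    rw [abs_sub_comm, abs_of_pos (by linarith [hmem.1])]
    linarith [hmem.2]
  have h1 := hbound _ U (lam (k j)) (φ (k j)) (prevNorm (lam (k j))) (hφ.eigenfunction (k j)).1
    (hφ.orthonormal.1 (k j)) h32 hclose hex
  have h2 := rpow_le_of_close (n := prevNorm (lam (k j)))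
    (by exact_mod_cast (by lia : 1 ≤ prevNorm (lam (k j)))) hmem.1 (by linarith [hmem.2])
    hs0 hs1 hsε
  rw [Real.norm_of_nonneg (by positivity : 0 ≤ lam (k j) ^ (-1 / 8 + ε))]
  calc _ ≤ _ := h1
    _ ≤ C * (2 * lam (k j) ^ (-1 / 8 + ε)) := by gcongr
    _ = _ := by ring
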